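/- Let $\mathcal L_2=\mathrm{SL}(2,\mathbb R)/\mathrm{SL}(2,\mathbb Z)$ be the space of unimodular lattices $\Lambda=M\mathbb Z^2$ of $\mathbb R^2$. For $X=(u,h)\in\mathbb R^2$ put $|X|_+=|u|$, $|X|_-=|h|$, $\|X\|=\max(|u|,|h|)$, let $\lambda_1(\Lambda)$ be the length of the shortest nonzero vectors of $\Lambda$, and let $g_t=\mathrm{diag}(e^{t},e^{-t})$. Let $S$ be the set of $\Lambda\in\mathcal L_2$ that contain two independent vectors $v_0,v_1$ with $|v_1|_+<|v_1|_-$, $|v_0|_-<|v_1|_-$, $|v_1|_-=|v_0|_+$, such that the nonzero points of $\Lambda$ in the closed ball of radius $\lambda_1(\Lambda)$ are exactly $\pm v_0,\pm v_1$. For $\Lambda\in\mathcal L_2$ let $\tau(\Lambda)=\inf\{t>0: g_t\Lambda\in S\}$ and $R(\Lambda)=g_{\tau(\Lambda)}\Lambda$ (first return time and map). Let $\mu$ be the measure on $\mathcal L_2$ that is locally the image of the Haar measure of $\mathrm{SL}(2,\mathbb R)$ in Siegel's normalization, in which a Borel set $B$ has measure $2\,\mathrm{Leb}\{sM: M\in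 B,\ 0<s\le 1\}$. A measure $\mu_S$ on $S$ is induced by the flow if every $\Lambda\in S$ has a neighbourhood $W$ in $S$ and an $\varepsilon_\Lambda>0$ such that $\mu\big(\bigcup_{t\in[0,\varepsilon]}g_tV\big)=\varepsilon\,\mu_S(V)$ for all Borel $V\subset W$ and $0\le\varepsilon\le\varepsilon_\Lambda$. For $\theta\in\mathbb R$, a nonzero integer $Q$ is a best approximation denominator of $\theta$ if for all nonzero integers $U$: $|U|<|Q|$ implies $d(\theta Q,\mathbb Z)<d(\theta U,\mathbb Z)$, and $|U|\le|Q|$ implies $d(\theta Q,\mathbb Z)\le d(\theta U,\mathbb Z)$. Let $q_0(\theta)<q_1(\theta)<\cdots$ be the absolute values of these $Q$ in increasing order. Lévy's constant $L_{1,1}$ is the real number such that for almost every $\theta$, $\frac1n\ln q_n(\theta)\to L_{1,1}$ and $\frac1n\ln d(\theta q_n(\theta),\mathbb Z)\to -L_{1,1}$. Then the following hold. 1. The map $$F(x,y,\epsilon)=\frac1{(1+xy)^{1/2}}\begin{pmatrix}1&-\epsilon x\\ \epsilon y&1\end{pmatrix}\mathbb Z^2$$ is a bijection from $(0,1)^2\times\{-1,1\}$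 onto $S$. 2. $\mu$ is $\mathrm{SL}(2,\mathbb R)$-invariant and $\mu(\mathcal L_2)=\zeta(2)$. There is exactly one measure $\mu_S$ on $S$ induced by the flow. In the coordinates $(x,y,\epsilon)$ it has the density $\frac1{(1+xy)^2}$ with respect to (Lebesgue measure) $\times$ (counting measure), and $\mu_S(S)=2\ln 2$. 3. Lévy's constant exists and $$L_{1,1}=\frac{\mu(\mathcal L_2)}{\mu_S(S)}=\frac{\zeta(2)}{2\ln 2}=\frac{\pi^2}{12\ln 2}.$$ 4. For all $(x,y,\epsilon)\in(0,1)^2\times\{-1,1\}$ such that $1/x$ is not an integer, the first return time to $S$ is attained (as a minimum), and $$\tau(F(x,y,\epsilon))=\tfrac12\ln\frac{y+\lfloor 1/x\rfloor}{x},\qquad R(F(x,y,\epsilon))=F\Big(\big\{\tfrac1x\big\},\ \frac1{y+\lfloor 1/x\rfloor},\ -\epsilon\Big).$$ 5. Let $T(x,y)=\big(\{1/x\},\,1/(y+\lfloor 1/x\rfloor)\big)$ on $(0,1)^2$ with the probability measure $\nu$ of density $\frac{1}{\ln 2\,(1+xy)^2}$. Then $(T,\nu)$ with the projection $(x,y)\mapsto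 x$ is the natural extension of the Gauss map $x\mapsto\{1/x\}$ of $(0,1)$ with the Gauss measure $\frac{dx}{\ln 2\,(1+x)}$: both maps preserve their measures, $T$ is invertible mod $0$, the projection is a factor map, and the images under the iterates $T^n$, $n\ge0$, of the sets $A\times(0,1)$, $A\subset(0,1)$ Borel, generate the Borel $\sigma$-algebra mod $0$. The first return map $R$ on $S$ with the probability measure $\mu_S/\mu_S(S)$ is a two-fold extension of $(T,\nu)$: $R$ preserves $\mu_S/\mu_S(S)$, and the map $P:S\to(0,1)^2$, $F(x,y,\epsilon)\mapsto(x,y)$, sends $\mu_S/\mu_S(S)$ to $\nu$, satisfies $P\circ R=T\circ P$ almost everywhere, and every point of $(0,1)^2$ has exactly two preimages under $P$. -/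

import Mathlib

open MeasureTheory Set Filter Topology
open scoped MatrixGroups

namespace PlaneLattices

noncomputable section

/-! ### The space of unimodular lattices of the plane -/

/-- The subgroup `SL(2,ℤ)` of `SL(2,ℝ)`. -/
abbrev intSL : Subgroup SL(2, ℝ) :=
  (Matrix.SpecialLinearGroup.map (n := Fin 2) (Int.castRingHom ℝ)).range

/-- The space `SL(2,ℝ) / SL(2,ℤ)` of unimodular lattices. The class of `M` is the
lattice `M ℤ²`; the group `SL(2,ℝ)` acts by left multiplication. -/
abbrev LatticeSpace : Type := SL(2, ℝ) ⧸ intSL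

/-- The lattice `M ℤ²`. -/
abbrev toLattice (M : SL(2, ℝ)) : LatticeSpace := QuotientGroup.mk M

/-- `SL(2,ℝ)` carries its Borel `σ`-algebra, and `LatticeSpace` the quotient one. -/
instance : MeasurableSpace SL(2, ℝ) := borel _

instance : BorelSpace SL(2, ℝ) := ⟨rfl⟩

/-- The vectors of a lattice `M ℤ²`. A vector `v = (u, h)` of the plane is a function
`Fin 2 → ℝ` with `v 0 = u` (horizontal part) and `v 1 = h` (vertical part), and its norm is
`max |u| |h|`. -/
def latticeVectors (Λ : LatticeSpace) : Set (Fin 2 → ℝ) :=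
  {v | ∃ M : SL(2, ℝ), toLattice M = Λ ∧
    ∃ m : Fin 2 → ℤ, v = (M : Matrix (Fin 2) (Fin 2) ℝ).mulVec (fun i => (m i : ℝ))}

/-- The first minimum: the length of the shortest nonzero vectors. -/
def firstMinimum (Λ : LatticeSpace) : ℝ :=
  sInf {r | ∃ v ∈ latticeVectors Λ, v ≠ 0 ∧ r = ‖v‖}

/-- The diagonal flow `g_t = diag(e^t, e^{-t})`. -/
def flow (t : ℝ) : SL(2, ℝ) :=
  ⟨!![Real.exp t, 0; 0, Real.exp (-t)], by
    rw [Matrix.det_fin_two_of, ← Real.exp_add]; simp⟩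

/-! ### The transversal, the return time and the return map -/

/-- The lattices that have two independent vectors `v₀`, `v₁` with
`|v₁|₊ , |v₀|₋ < |v₁|₋ = |v₀|₊` and such that the nonzero lattice points in the closed ball
of radius the first minimum are exactly `±v₀` and `±v₁`. -/
def transversal : Set LatticeSpace :=
  {Λ | ∃ v₀ ∈ latticeVectors Λ, ∃ v₁ ∈ latticeVectors Λ,
    LinearIndependent ℝ ![v₀, v₁] ∧
    |v₁ 0| < |v₁ 1| ∧ |v₀ 1| < |v₁ 1| ∧ |v₁ 1| = |v₀ 0| ∧
    {w | w ∈ latticeVectors Λ ∧ w ≠ 0 ∧ ‖w‖ ≤ firstMinimum Λ} = {v₀, -v₀, v₁, -v₁}}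

/-- The positive times at which the orbit of `Λ` visits the transversal. -/
def visitTimes (Λ : LatticeSpace) : Set ℝ :=
  {t | 0 < t ∧ flow t • Λ ∈ transversal}

/-- The first return (or entrance) time. -/
def returnTime (Λ : LatticeSpace) : ℝ := sInf (visitTimes Λ)

/-- The first return (or entrance) map. -/
def returnMap (Λ : LatticeSpace) : LatticeSpace := flow (returnTime Λ) • Λ

/-! ### The invariant measure and the induced measure -/

/-- The matrix `(det A)^{-1/2} A` of determinant one, for `det A > 0`
(and the identity for other matrices). -/
def unimodular (A : Matrix (Fin 2) (Fin 2) ℝ) : SL(2, ℝ) :=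
  open Classical in
  if h : 0 < A.det then
    ⟨(Real.sqrt A.det)⁻¹ • A, by
      rw [Matrix.det_smul, Fintype.card_fin, inv_pow, Real.sq_sqrt h.le, inv_mul_cancel₀ h.ne']⟩
  else 1

/-- The Haar measure of `SL(2,ℝ)` in Siegel's normalization: the measure of `B` is twice the
Lebesgue measure in `ℝ⁴` of the cone `{s M : M ∈ B, 0 < s ≤ 1}`. Equivalently,
`dA = Δ dΔ dM` for `A = Δ^{1/2} M`, `M ∈ SL(2,ℝ)`, `Δ > 0`. -/
def haarSL : Measure SL(2, ℝ) :=
  (2 : ENNReal) • Measure.map (fun a : Fin 2 → Fin 2 → ℝ => unimodular (Matrix.of a))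
    ((volume : Measure (Fin 2 → Fin 2 → ℝ)).restrict
      {a | 0 < (Matrix.of a).det ∧ (Matrix.of a).det ≤ 1})

/-- The invariant measure on the space of lattices that is locally the image of `haarSL`:
the measure of the image of `B` is `haarSL B` for every Borel set `B` on which the projection is
one-to-one. It is the supremum of the images of these restrictions of `haarSL`, which is
reached at any Borel fundamental domain. -/
def latticeMeasure : Measure LatticeSpace :=
  ⨆ B : {B : Set SL(2, ℝ) // MeasurableSet B ∧ InjOn toLattice B},
    (haarSL.restrict B.1).map toLattice

/-- `σ` is the measure induced by the flow on the transversal: it is carried by the transversal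
and, locally on it, `μ (⋃_{t ∈ [0,ε]} g_t V) = ε σ(V)` for small `ε`. -/
structure IsInducedMeasure (σ : Measure LatticeSpace) : Prop where
  carried : σ transversalᶜ = 0
  flow_box : ∀ Λ ∈ transversal, ∃ W ∈ 𝓝[transversal] Λ, ∃ ε₀ : ℝ, 0 < ε₀ ∧
    ∀ V : Set LatticeSpace, MeasurableSet V → V ⊆ W → V ⊆ transversal →
      ∀ ε ∈ Icc (0 : ℝ) ε₀,
        latticeMeasure (⋃ t ∈ Icc (0 : ℝ) ε, (fun Λ' => flow t • Λ') '' V)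
          = ENNReal.ofReal ε * σ V

/-- The open unit square. -/
def unitSquare : Set (ℝ × ℝ) := Ioo 0 1 ×ˢ Ioo 0 1

/-- The lattice `(1 + x y)^{-1/2} (1, -εx; εy, 1) ℤ²`, where `p = (x, y)` and `ε = ±1`. -/
def param (p : ℝ × ℝ) (ε : ℤˣ) : LatticeSpace :=
  toLattice (unimodular !![1, -((ε : ℤ) : ℝ) * p.1; ((ε : ℤ) : ℝ) * p.2, 1])

/-! ### Lévy's constant -/

/-- The distance from `x` to the integers. -/
def distInt (x : ℝ) : ℝ := Metric.infDist x (range ((↑) : ℤ → ℝ))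

/-- `Q` is a best Diophantine approximation denominator of `θ`. -/
def IsBestDenominator (θ : ℝ) (Q : ℤ) : Prop :=
  Q ≠ 0 ∧ ∀ U : ℤ, U ≠ 0 →
    (|U| < |Q| → distInt (θ * Q) < distInt (θ * U)) ∧
    (|U| ≤ |Q| → distInt (θ * Q) ≤ distInt (θ * U))

/-- The sequence `q₀ < q₁ < ⋯` of the absolute values of the best denominators of `θ`
(an infinite sequence when `θ` is irrational). -/
def bestDenominator (θ : ℝ) (n : ℕ) : ℕ :=
  Nat.nth (fun q : ℕ => ∃ Q : ℤ, IsBestDenominator θ Q ∧ Q.natAbs = q) n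

/-- `L` is the Lévy constant `L_{1,1}`: for almost every real `θ`, `(1/n) ln q_n(θ) → L` and
`(1/n) ln d(q_n(θ) θ, ℤ) → -L`. -/
def IsLevyConstant (L : ℝ) : Prop :=
  ∀ᵐ θ : ℝ,
    Tendsto (fun n : ℕ => 1 / (n : ℝ) * Real.log (bestDenominator θ n)) atTop (𝓝 L) ∧
    Tendsto (fun n : ℕ => 1 / (n : ℝ) * Real.log (distInt (θ * bestDenominator θ n)))
      atTop (𝓝 (-L))

/-! ### Natural extensions and two-fold extensions -/

/-- `(Y, ν, T)` with the projection `π` is the natural extension of `(X, m, G)`: `T` is an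
automorphism (invertible mod `0`), `π` is a factor map, and the images
under the iterates of `T` of the measurable sets coming from `X` generate, mod `0`, the
`σ`-algebra of `Y`. -/
def IsNaturalExtension {X Y : Type*} [mX : MeasurableSpace X] [MeasurableSpace Y]
    (T : Y → Y) (ν : Measure Y) (G : X → X) (m : Measure X) (π : Y → X) : Prop :=
  MeasurePreserving G m m ∧ MeasurePreserving T ν ν ∧ MeasurePreserving π ν m ∧
  π ∘ T =ᵐ[ν] G ∘ π ∧
  ∃ T' : Y → Y, MeasurePreserving T' ν ν ∧ T' ∘ T =ᵐ[ν] id ∧ T ∘ T' =ᵐ[ν] id ∧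
    ∀ B : Set Y, MeasurableSet B →
      ∃ C : Set Y, MeasurableSet[⨆ n : ℕ, mX.comap (π ∘ T'^[n])] C ∧ B =ᵐ[ν] C

/-- `(Z, σ, R)` is a two-fold extension of `(Y, ν, T)` by the factor map `P`: both systems
preserve their measures, `P` maps `σ` to `ν` and intertwines `R` and `T` almost everywhere, and
every point of `Y` has exactly two preimages in `Z`. The phase spaces are subsets `Z` and `Y` of
ambient measurable spaces. -/
structure IsTwoFoldExtension {α β : Type*} [MeasurableSpace α] [MeasurableSpace β]
    (Z : Set α) (σ : Measure α) (R : α → α) (Y : Set β) (ν : Measure β) (T : β → β)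
    (P : α → β) : Prop where
  carried : σ Zᶜ = 0
  carried_base : ν Yᶜ = 0
  aemeasurable_map : AEMeasurable R σ
  map_eq : σ.map R = σ
  measurePreserving_base : MeasurePreserving T ν ν
  aemeasurable_factor : AEMeasurable P σ
  map_factor : σ.map P = ν
  mapsTo : MapsTo P Z Y
  semiconj : P ∘ R =ᵐ[σ] T ∘ P
  two_preimages : ∀ y ∈ Y, (Z ∩ P ⁻¹' {y}).ncard = 2

/-- The Gauss map `x ↦ {1/x}`. -/
def gaussMap (x : ℝ) : ℝ := Int.fract (1 / x)

/-- The Gauss measure, of density `1 / (ln 2 (1 + x))` on `(0,1)`. -/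
def gaussMeasure : Measure ℝ :=
  ((volume : Measure ℝ).restrict (Ioo 0 1)).withDensity
    fun x => ENNReal.ofReal (1 / (Real.log 2 * (1 + x)))

/-- The planar map `(x, y) ↦ ({1/x}, 1 / (y + ⌊1/x⌋))`. -/
def gaussExt (p : ℝ × ℝ) : ℝ × ℝ :=
  (Int.fract (1 / p.1), 1 / (p.2 + (⌊1 / p.1⌋ : ℝ)))

/-- The probability measure of density `1 / (ln 2 (1 + x y)²)` on the unit square. -/
def gaussExtMeasure : Measure (ℝ × ℝ) :=
  ((volume : Measure (ℝ × ℝ)).restrict unitSquare).withDensity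
    fun p => ENNReal.ofReal (1 / (Real.log 2 * (1 + p.1 * p.2) ^ 2))

end

end PlaneLattices

open PlaneLattices

namespace PlaneLattices

noncomputable section

/-! ### Vectors of a lattice -/

/-! The flow stretches the horizontal part u and shrinks the vertical part h. An orbit visits the
transversal when two consecutive minimal vectors v₀, v₁ exchange the role of shortest vector. Up to
signs they form a basis with positive diagonal entries. The off-diagonal entries have opposite signs
because v₀ ± v₁ lie outside the ball, and their ratios to the diagonal entries are the coordinates x
and y. After the visit v₁ is the only shortest vector until it is matched by v₀ + ε n v₁ with n =
⌊1/x⌋. This Euclidean division step gives the return time ½ ln((y + n)/x) and the return map in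
coordinates (`notMem_transversal_of_lt`, `flow_smul_param_return`).

In the coordinates (t, x, y) of the orbit segments, Siegel's measure is dt dx dy / (1 + xy)²
(`haarSL_cell`). Flow boxes therefore induce the density 1 / (1 + xy)². Almost every lattice lies on
exactly one orbit segment between consecutive visits (`IsGeneric.exists_frame`,
`isSection_returnDomain`), so the mass of the space of lattices is the integral of the return time
τ. Since 2τ = -ln x - ln y∘T, and T preserves the density, which is symmetric in x and y, each of
the two sheets contributes ∫ -ln x / (1 + x) dx = π²/12, and the total is π²/6 = ζ(2)
(`lintegral_returnTimeCoord`, `latticeMeasure_univ`).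

Lévy's constant is computed separately and then compared with the ratio of the masses. The logarithm
of |qₙθ - pₙ| is minus a Birkhoff sum of -ln for the Gauss map, and ln of the next denominator is
that sum up to ln 2 (`log_abs_defect`, `log_contDen`). The Gauss map is ergodic by Lebesgue's
density theorem and the bounded distortion of its inverse branches (`gaussMap_density`), and
Birkhoff's theorem, derived from the maximal inequality, gives the limit π²/(12 ln 2).

The planar map is the natural extension because y is the continued fraction of the digits read along
the past orbit of x, and the sign ε, which changes at each return, makes the return map a two-fold
extension of it. -/

lemma toLattice_eq_iff {M N : SL(2, ℝ)} :
    toLattice M = toLattice N ↔ ∃ g : SL(2, ℤ),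
      N = M * Matrix.SpecialLinearGroup.map (Int.castRingHom ℝ) g := by
  rw [toLattice, toLattice, QuotientGroup.eq, MonoidHom.mem_range]
  constructor
  · rintro ⟨g, hg⟩
    exact ⟨g, by rw [hg]; group⟩
  · rintro ⟨g, rfl⟩
    exact ⟨g, by group⟩

lemma norm_eq_max (v : Fin 2 → ℝ) : ‖v‖ = max |v 0| |v 1| := by
  simp [Pi.norm_def, Fin.univ_succ]

/-- The vector of the lattice `M ℤ²` with coordinates `m`, `n`. -/
def latticeVec (M : SL(2, ℝ)) (m n : ℤ) : Fin 2 → ℝ :=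
  ![M 0 0 * m + M 0 1 * n, M 1 0 * m + M 1 1 * n]

@[simp] lemma latticeVec_zero (M : SL(2, ℝ)) (m n : ℤ) :
    latticeVec M m n 0 = M 0 0 * m + M 0 1 * n := rfl

@[simp] lemma latticeVec_one (M : SL(2, ℝ)) (m n : ℤ) :
    latticeVec M m n 1 = M 1 0 * m + M 1 1 * n := rfl

lemma mulVec_intCast (M : SL(2, ℝ)) (m : Fin 2 → ℤ) :
    (M : Matrix (Fin 2) (Fin 2) ℝ).mulVec (fun i => (m i : ℝ)) = latticeVec M (m 0) (m 1) := by
  ext i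
  fin_cases i <;> simp [Matrix.mulVec, dotProduct, Fin.sum_univ_two, latticeVec]

lemma det_eq_one (M : SL(2, ℝ)) : M 0 0 * M 1 1 - M 0 1 * M 1 0 = 1 := by
  have := M.2
  rwa [Matrix.det_fin_two] at this

/-- `latticeVectors` ranges over every matrix of the class. Two of them differ by an integral
unimodular matrix, which maps ℤ² to itself, so one matrix already gives all the vectors. -/
lemma mem_latticeVectors {M : SL(2, ℝ)} {v : Fin 2 → ℝ} :
    v ∈ latticeVectors (toLattice M) ↔ ∃ m n : ℤ, v = latticeVec M m n := by
  constructor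
  · rintro ⟨N, hN, m, rfl⟩
    obtain ⟨g, rfl⟩ := toLattice_eq_iff.1 hN.symm
    refine ⟨g 0 0 * m 0 + g 0 1 * m 1, g 1 0 * m 0 + g 1 1 * m 1, ?_⟩
    rw [mulVec_intCast]
    ext i
    fin_cases i <;>
      simp [Matrix.mul_apply, Fin.sum_univ_two, latticeVec] <;> ring
  · rintro ⟨m, n, rfl⟩
    exact ⟨M, rfl, ![m, n], by rw [mulVec_intCast]; rfl⟩

lemma latticeVec_mem (M : SL(2, ℝ)) (m n : ℤ) : latticeVec M m n ∈ latticeVectors (toLattice M) :=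
  mem_latticeVectors.2 ⟨m, n, rfl⟩

/-- Cramer's rule with determinant one. It turns bounds on a vector into bounds on its integer
coordinates, which is the discreteness of the lattice. -/
lemma coord_eq (M : SL(2, ℝ)) (m n : ℤ) :
    (m : ℝ) = M 1 1 * latticeVec M m n 0 - M 0 1 * latticeVec M m n 1 ∧
    (n : ℝ) = -M 1 0 * latticeVec M m n 0 + M 0 0 * latticeVec M m n 1 := by
  have h := det_eq_one M
  constructor
  · rw [latticeVec_zero, latticeVec_one]; linear_combination -(m : ℝ) * h
  · rw [latticeVec_zero, latticeVec_one]; linear_combination -(n : ℝ) * h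

lemma latticeVec_eq_zero_iff {M : SL(2, ℝ)} {m n : ℤ} :
    latticeVec M m n = 0 ↔ m = 0 ∧ n = 0 := by
  constructor
  · intro h
    have := coord_eq M m n
    simp only [h, Pi.zero_apply, mul_zero, sub_zero, add_zero] at this
    exact_mod_cast this
  · rintro ⟨rfl, rfl⟩
    ext i
    fin_cases i <;> simp [latticeVec]

lemma latticeVec_inj {M : SL(2, ℝ)} {m n m' n' : ℤ} (h : latticeVec M m n = latticeVec M m' n') :
    m = m' ∧ n = n' := by
  have h1 := coord_eq M m n
  have h2 := coord_eq M m' n'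
  rw [h] at h1
  constructor
  · exact_mod_cast h1.1.trans h2.1.symm
  · exact_mod_cast h1.2.trans h2.2.symm

lemma latticeVec_neg (M : SL(2, ℝ)) (m n : ℤ) : latticeVec M (-m) (-n) = -latticeVec M m n := by
  ext i
  fin_cases i <;> simp [latticeVec] <;> ring

lemma finite_latticeVec_le (M : SL(2, ℝ)) (C : ℝ) :
    {z : ℤ × ℤ | ‖latticeVec M z.1 z.2‖ ≤ C}.Finite := by
  -- The entries of the inverse matrix are those of M up to sign, so K bounds both integer
  -- coordinates.
  set K : ℝ := (|M 0 0| + |M 0 1| + |M 1 0| + |M 1 1|) * C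
  refine (Set.finite_Icc ((-⌈K⌉, -⌈K⌉) : ℤ × ℤ) (⌈K⌉, ⌈K⌉)).subset ?_
  rintro ⟨m, n⟩ h
  rw [mem_ofPred_eq, norm_eq_max, max_le_iff] at h
  obtain ⟨h1, h2⟩ := coord_eq M m n
  set u := latticeVec M m n 0
  set w := latticeVec M m n 1
  have hC : 0 ≤ C := (abs_nonneg _).trans h.1
  have key : ∀ a b : ℝ, |a| + |b| ≤ |M 0 0| + |M 0 1| + |M 1 0| + |M 1 1| →
      |a * u + b * w| ≤ ⌈K⌉ := by
    intro a b hab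
    calc |a * u + b * w| ≤ |a| * |u| + |b| * |w| := by
          rw [← abs_mul, ← abs_mul]; exact abs_add_le _ _
      _ ≤ |a| * C + |b| * C := by gcongr; exacts [h.1, h.2]
      _ ≤ K := by rw [← add_mul]; exact mul_le_mul_of_nonneg_right hab hC
      _ ≤ ⌈K⌉ := Int.le_ceil _
  have e1 : |(m : ℝ)| ≤ ⌈K⌉ := by
    rw [h1, sub_eq_add_neg, ← neg_mul]
    apply key
    rw [abs_neg]
    linarith [abs_nonneg (M 0 0), abs_nonneg (M 1 0)]
  have e2 : |(n : ℝ)| ≤ ⌈K⌉ := by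
    rw [h2]
    apply key
    rw [abs_neg]
    linarith [abs_nonneg (M 0 1), abs_nonneg (M 1 1)]
  have e1' : |m| ≤ ⌈K⌉ := by exact_mod_cast e1
  have e2' : |n| ≤ ⌈K⌉ := by exact_mod_cast e2
  rw [abs_le] at e1' e2'
  exact ⟨⟨e1'.1, e2'.1⟩, ⟨e1'.2, e2'.2⟩⟩

lemma firstMinimum_le {Λ : LatticeSpace} {v : Fin 2 → ℝ} (hv : v ∈ latticeVectors Λ) (h0 : v ≠ 0) :
    firstMinimum Λ ≤ ‖v‖ :=
  csInf_le ⟨0, by rintro _ ⟨w, -, -, rfl⟩; exact norm_nonneg w⟩ ⟨v, hv, h0, rfl⟩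

lemma firstMinimum_eq {Λ : LatticeSpace} {v : Fin 2 → ℝ} (hv : v ∈ latticeVectors Λ) (h0 : v ≠ 0)
    (hmin : ∀ w ∈ latticeVectors Λ, w ≠ 0 → ‖v‖ ≤ ‖w‖) : firstMinimum Λ = ‖v‖ :=
  le_antisymm (firstMinimum_le hv h0)
    (le_csInf ⟨_, v, hv, h0, rfl⟩ (by rintro _ ⟨w, hw, hw0, rfl⟩; exact hmin w hw hw0))

/-- A lattice whose vectors of length at most the length of one of them are all proportional is
not in the transversal. -/
lemma notMem_transversal {Λ : LatticeSpace} {v : Fin 2 → ℝ} (hv : v ∈ latticeVectors Λ)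
    (h0 : v ≠ 0) (hprop : ∀ w ∈ latticeVectors Λ, ‖w‖ ≤ ‖v‖ → ∃ c : ℝ, w = c • v) :
    Λ ∉ transversal := by
  rintro ⟨v₀, hv₀, v₁, hv₁, hind, -, -, -, hset⟩
  have aux : ∀ w ∈ ({v₀, -v₀, v₁, -v₁} : Set (Fin 2 → ℝ)), ∃ c : ℝ, w = c • v := by
    intro w hw
    rw [← hset] at hw
    exact hprop w hw.1 (hw.2.2.trans (firstMinimum_le hv h0))
  obtain ⟨a, ha⟩ := aux v₀ (by simp)
  obtain ⟨b, hb⟩ := aux v₁ (by simp)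
  rw [LinearIndependent.pair_iff] at hind
  have hv0 : v₀ ≠ 0 := by
    rintro rfl
    exact one_ne_zero (hind 1 0 (by simp)).1
  have := hind b (-a) (by rw [ha, hb, smul_smul, smul_smul, mul_comm, neg_mul, neg_smul,
    add_neg_cancel])
  rw [neg_eq_zero] at this
  exact hv0 (by rw [ha, this.2, zero_smul])

/-! ### The coordinates -/

/-- The matrix `g_t (1 + x y)^{-1/2} (1, -εx; εy, 1)`. -/
def frame (t : ℝ) (p : ℝ × ℝ) (ε : ℤˣ) : SL(2, ℝ) :=
  flow t * unimodular !![1, -((ε : ℤ) : ℝ) * p.1; ((ε : ℤ) : ℝ) * p.2, 1]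

lemma mul_entry (M N : SL(2, ℝ)) (i j : Fin 2) :
    (M * N) i j = M i 0 * N 0 j + M i 1 * N 1 j := by
  rw [Matrix.SpecialLinearGroup.coe_mul, Matrix.mul_apply, Fin.sum_univ_two]

lemma flow_entries (t : ℝ) : flow t 0 0 = Real.exp t ∧ flow t 0 1 = 0 ∧ flow t 1 0 = 0 ∧
    flow t 1 1 = Real.exp (-t) := ⟨rfl, rfl, rfl, rfl⟩

lemma coe_unimodular {A : Matrix (Fin 2) (Fin 2) ℝ} (h : 0 < A.det) :
    (unimodular A : Matrix (Fin 2) (Fin 2) ℝ) = (Real.sqrt A.det)⁻¹ • A := by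
  have : unimodular A = ⟨(Real.sqrt A.det)⁻¹ • A, by
      rw [Matrix.det_smul, Fintype.card_fin, inv_pow, Real.sq_sqrt h.le, inv_mul_cancel₀ h.ne']⟩ :=
    dif_pos h
  rw [this]

lemma flow_add (s t : ℝ) : flow (s + t) = flow s * flow t := by
  obtain ⟨a1, a2, a3, a4⟩ := flow_entries s
  obtain ⟨b1, b2, b3, b4⟩ := flow_entries t
  obtain ⟨c1, c2, c3, c4⟩ := flow_entries (s + t)
  ext i j
  rw [mul_entry]
  fin_cases i <;> fin_cases j <;> simp [a1, a2, a3, a4, b1, b2, b3, b4, c1, c2, c3, c4,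
    Real.exp_add, mul_comm]

lemma flow_zero : flow 0 = 1 := by
  ext i j
  fin_cases i <;> fin_cases j <;> simp [flow]

lemma flow_smul_param (t : ℝ) (p : ℝ × ℝ) (ε : ℤˣ) :
    flow t • param p ε = toLattice (frame t p ε) := rfl

lemma toLattice_frame_zero (p : ℝ × ℝ) (ε : ℤˣ) : toLattice (frame 0 p ε) = param p ε := by
  rw [← flow_smul_param, flow_zero, one_smul]

lemma sign_mul_self (ε : ℤˣ) : ((ε : ℤ) : ℝ) * ((ε : ℤ) : ℝ) = 1 := by
  rcases Int.units_eq_one_or ε with rfl | rfl <;> norm_num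

lemma abs_sign (ε : ℤˣ) : |((ε : ℤ) : ℝ)| = 1 := by
  rcases Int.units_eq_one_or ε with rfl | rfl <;> norm_num

lemma one_add_mul_pos {p : ℝ × ℝ} (hp : p ∈ unitSquare) : 0 < 1 + p.1 * p.2 := by
  have := mul_pos hp.1.1 hp.2.1
  linarith

/-- The entries of `frame t p ε`. -/
lemma frame_entries (t : ℝ) {p : ℝ × ℝ} (hp : p ∈ unitSquare) (ε : ℤˣ) :
    frame t p ε 0 0 = Real.exp t * (Real.sqrt (1 + p.1 * p.2))⁻¹ ∧
    frame t p ε 0 1 = -((ε : ℤ) : ℝ) * p.1 * (Real.exp t * (Real.sqrt (1 + p.1 * p.2))⁻¹) ∧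
    frame t p ε 1 0 = ((ε : ℤ) : ℝ) * p.2 * (Real.exp (-t) * (Real.sqrt (1 + p.1 * p.2))⁻¹) ∧
    frame t p ε 1 1 = Real.exp (-t) * (Real.sqrt (1 + p.1 * p.2))⁻¹ := by
  have hdet : Matrix.det !![1, -((ε : ℤ) : ℝ) * p.1; ((ε : ℤ) : ℝ) * p.2, 1] = 1 + p.1 * p.2 := by
    rw [Matrix.det_fin_two_of]
    linear_combination p.1 * p.2 * sign_mul_self ε
  have hpos := one_add_mul_pos hp
  rw [← hdet] at hpos
  obtain ⟨a1, a2, a3, a4⟩ := flow_entries t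
  simp only [frame, mul_entry, coe_unimodular hpos, hdet, a1, a2, a3, a4, Matrix.smul_apply,
    smul_eq_mul, Matrix.of_apply, Matrix.cons_val', Matrix.cons_val_zero, Matrix.cons_val_one,
    Matrix.cons_val_fin_one]
  refine ⟨?_, ?_, ?_, ?_⟩ <;> ring

/-- Recognition of the matrices `frame t p ε`. -/
lemma eq_frame {M : SL(2, ℝ)} {ε : ℤˣ} (ha : 0 < M 0 0) (hd : 0 < M 1 1)
    (hb : 0 < -((ε : ℤ) : ℝ) * M 0 1) (hc : 0 < ((ε : ℤ) : ℝ) * M 1 0)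
    (hab : |M 0 1| < M 0 0) (hcd : |M 1 0| < M 1 1) :
    (-((ε : ℤ) : ℝ) * M 0 1 / M 0 0, ((ε : ℤ) : ℝ) * M 1 0 / M 1 1) ∈ unitSquare ∧
    M = frame (1 / 2 * Real.log (M 0 0 / M 1 1))
      (-((ε : ℤ) : ℝ) * M 0 1 / M 0 0, ((ε : ℤ) : ℝ) * M 1 0 / M 1 1) ε := by
  have he := sign_mul_self ε
  have hb' : -((ε : ℤ) : ℝ) * M 0 1 = |M 0 1| := by
    rw [← abs_of_pos hb, abs_mul, abs_neg, abs_sign, one_mul]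
  have hc' : ((ε : ℤ) : ℝ) * M 1 0 = |M 1 0| := by
    rw [← abs_of_pos hc, abs_mul, abs_sign, one_mul]
  have hmem : (-((ε : ℤ) : ℝ) * M 0 1 / M 0 0, ((ε : ℤ) : ℝ) * M 1 0 / M 1 1) ∈ unitSquare := by
    refine ⟨⟨div_pos hb ha, ?_⟩, ⟨div_pos hc hd, ?_⟩⟩
    · rw [div_lt_one ha, hb']; exact hab
    · rw [div_lt_one hd, hc']; exact hcd
  refine ⟨hmem, ?_⟩
  have hdet := det_eq_one M
  obtain ⟨e1, e2, e3, e4⟩ := frame_entries (1 / 2 * Real.log (M 0 0 / M 1 1)) hmem ε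
  -- Determinant one turns 1 + xy into 1/(ad). For t = ½ ln(a/d), the factors e^{±t}(1 + xy)^{-1/2}
  -- are then √(a/d)·√(ad) = a and √(d/a)·√(ad) = d.
  have hexp : Real.exp (1 / 2 * Real.log (M 0 0 / M 1 1)) = Real.sqrt (M 0 0 / M 1 1) := by
    rw [mul_comm, Real.sqrt_eq_rpow, Real.rpow_def_of_pos (div_pos ha hd)]
  have hsq : 1 + -((ε : ℤ) : ℝ) * M 0 1 / M 0 0 * (((ε : ℤ) : ℝ) * M 1 0 / M 1 1)
      = (M 0 0 * M 1 1)⁻¹ := by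
    field_simp
    linear_combination hdet - M 0 1 * M 1 0 * he
  have hA : Real.exp (1 / 2 * Real.log (M 0 0 / M 1 1)) *
      (Real.sqrt (1 + -((ε : ℤ) : ℝ) * M 0 1 / M 0 0 * (((ε : ℤ) : ℝ) * M 1 0 / M 1 1)))⁻¹
      = M 0 0 := by
    rw [hexp, hsq, Real.sqrt_inv, inv_inv, ← Real.sqrt_mul (div_pos ha hd).le,
      show M 0 0 / M 1 1 * (M 0 0 * M 1 1) = M 0 0 ^ 2 by field_simp, Real.sqrt_sq ha.le]
  have hD : Real.exp (-(1 / 2 * Real.log (M 0 0 / M 1 1))) *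
      (Real.sqrt (1 + -((ε : ℤ) : ℝ) * M 0 1 / M 0 0 * (((ε : ℤ) : ℝ) * M 1 0 / M 1 1)))⁻¹
      = M 1 1 := by
    rw [Real.exp_neg, hexp, hsq, Real.sqrt_inv, inv_inv, ← Real.sqrt_inv,
      ← Real.sqrt_mul (inv_pos.2 (div_pos ha hd)).le,
      show (M 0 0 / M 1 1)⁻¹ * (M 0 0 * M 1 1) = M 1 1 ^ 2 by field_simp, Real.sqrt_sq hd.le]
  simp only at e1 e2 e3 e4
  rw [hA] at e1 e2
  rw [hD] at e3 e4
  ext i j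
  fin_cases i <;> fin_cases j
  · exact e1.symm
  · refine Eq.trans ?_ e2.symm
    change M 0 1 = _
    field_simp
    linear_combination -M 0 1 * he
  · refine Eq.trans ?_ e3.symm
    change M 1 0 = _
    field_simp
    linear_combination -M 1 0 * he
  · exact e4.symm

lemma frame_pos (t : ℝ) {p : ℝ × ℝ} (hp : p ∈ unitSquare) (ε : ℤˣ) :
    0 < frame t p ε 0 0 ∧ 0 < frame t p ε 1 1 ∧
    0 < -((ε : ℤ) : ℝ) * frame t p ε 0 1 ∧ 0 < ((ε : ℤ) : ℝ) * frame t p ε 1 0 ∧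
    |frame t p ε 0 1| < frame t p ε 0 0 ∧ |frame t p ε 1 0| < frame t p ε 1 1 := by
  obtain ⟨e1, e2, e3, e4⟩ := frame_entries t hp ε
  have hr : 0 < (Real.sqrt (1 + p.1 * p.2))⁻¹ := inv_pos.2 (Real.sqrt_pos.2 (one_add_mul_pos hp))
  have h1 := mul_pos (Real.exp_pos t) hr
  have h2 := mul_pos (Real.exp_pos (-t)) hr
  have he := sign_mul_self ε
  obtain ⟨⟨hx0, hx1⟩, ⟨hy0, hy1⟩⟩ := hp
  rw [e1, e2, e3, e4]
  refine ⟨h1, h2, ?_, ?_, ?_, ?_⟩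
  · rw [show ∀ e z w : ℝ, -e * (-e * z * w) = (e * e) * (z * w) by intros; ring, he, one_mul]
    exact mul_pos hx0 h1
  · rw [show ∀ e z w : ℝ, e * (e * z * w) = (e * e) * (z * w) by intros; ring, he, one_mul]
    exact mul_pos hy0 h2
  · rw [abs_mul, abs_mul, abs_neg, abs_sign, one_mul, abs_of_pos hx0, abs_of_pos h1]
    exact mul_lt_of_lt_one_left h1 hx1
  · rw [abs_mul, abs_mul, abs_sign, one_mul, abs_of_pos hy0, abs_of_pos h2]
    exact mul_lt_of_lt_one_left h2 hy1

/-- The coordinates of `frame t p ε` are determined by the matrix. -/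
lemma frame_inj {t t' : ℝ} {p p' : ℝ × ℝ} (hp : p ∈ unitSquare) (hp' : p' ∈ unitSquare)
    {ε ε' : ℤˣ} (h : frame t p ε = frame t' p' ε') : t = t' ∧ p = p' ∧ ε = ε' := by
  obtain ⟨a1, a2, a3, a4⟩ := frame_entries t hp ε
  obtain ⟨b1, b2, b3, b4⟩ := frame_entries t' hp' ε'
  obtain ⟨ha, hd, hb, hc, -, -⟩ := frame_pos t hp ε
  obtain ⟨-, -, hb', hc', -, -⟩ := frame_pos t' hp' ε'
  rw [← h] at b1 b2 b3 b4 hb' hc'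
  rw [← a1] at a2
  rw [← b1] at b2
  rw [← a4] at a3
  rw [← b4] at b3
  -- The sign of the lower left entry determines ε.
  have hε : ε = ε' := by
    rcases Int.units_eq_one_or ε with rfl | rfl <;> rcases Int.units_eq_one_or ε' with rfl | rfl
    · rfl
    · norm_num at hc hc'; linarith
    · norm_num at hc hc'; linarith
    · rfl
  subst hε
  have he : ((ε : ℤ) : ℝ) ≠ 0 := by
    intro h0
    have := sign_mul_self ε
    simp [h0] at this
  have h1 : p.1 = p'.1 := by
    have := a2.symm.trans b2
    exact mul_left_cancel₀ (neg_ne_zero.2 he) (mul_right_cancel₀ ha.ne' this)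
  have h2 : p.2 = p'.2 := by
    have := a3.symm.trans b3
    exact mul_left_cancel₀ he (mul_right_cancel₀ hd.ne' this)
  refine ⟨?_, Prod.ext h1 h2, rfl⟩
  have hr : (Real.sqrt (1 + p.1 * p.2))⁻¹ ≠ 0 :=
    (inv_pos.2 (Real.sqrt_pos.2 (one_add_mul_pos hp))).ne'
  rw [← h1, ← h2] at b1
  exact Real.exp_injective (mul_right_cancel₀ hr (a1.symm.trans b1))

/-- A change of basis of the lattice `M ℤ²`. -/
lemma exists_change_basis (M : SL(2, ℝ)) {a b c d : ℤ} (h : a * d - b * c = 1) :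
    ∃ N : SL(2, ℝ), toLattice M = toLattice N ∧
      N 0 0 = latticeVec M a c 0 ∧ N 1 0 = latticeVec M a c 1 ∧
      N 0 1 = latticeVec M b d 0 ∧ N 1 1 = latticeVec M b d 1 := by
  let g : SL(2, ℤ) := ⟨!![a, b; c, d], by rw [Matrix.det_fin_two_of, h]⟩
  refine ⟨M * Matrix.SpecialLinearGroup.map (Int.castRingHom ℝ) g, toLattice_eq_iff.2 ⟨g, rfl⟩, ?_⟩
  simp only [mul_entry]
  exact ⟨rfl, rfl, rfl, rfl⟩

/-! ### Short vectors and the transversal -/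

/-- Two terms of the same sign do not cancel, and a nonzero integer has absolute value at least one.
-/
lemma add_le_abs_of_mul_pos {a b : ℝ} {m n : ℤ} (hm : m ≠ 0) (hn : n ≠ 0)
    (h : 0 ≤ (a * m) * (b * n)) : |a| + |b| ≤ |a * m + b * n| := by
  have h1 : (1 : ℝ) ≤ |(m : ℝ)| := by exact_mod_cast Int.one_le_abs hm
  have h2 : (1 : ℝ) ≤ |(n : ℝ)| := by exact_mod_cast Int.one_le_abs hn
  have h3 : |a * m + b * n| = |a * m| + |b * n| := by
    rw [abs_add_eq_add_abs_iff]
    rcases mul_nonneg_iff.1 h with h | h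
    · exact Or.inl h
    · exact Or.inr h
  rw [h3, abs_mul, abs_mul]
  nlinarith [abs_nonneg a, abs_nonneg b]

lemma eq_one_or_of_abs_mul_lt {a C : ℝ} {m : ℤ} (hm : m ≠ 0) (ha : 0 < a) (h : |a * m| ≤ C)
    (hC : C < 2 * a) : m = 1 ∨ m = -1 := by
  rw [abs_mul, abs_of_pos ha] at h
  have h1 : |(m : ℝ)| < 2 := by
    by_contra! h2
    nlinarith
  have h2 : |m| < 2 := by exact_mod_cast h1
  rw [abs_lt] at h2
  omega

/-- The short vectors of the lattices close to the transversal. -/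
lemma short_vectors {M : SL(2, ℝ)} (ha : 0 < M 0 0) (hd : 0 < M 1 1) (hbc : M 0 1 * M 1 0 < 0)
    (hab : |M 0 1| < M 0 0) (hcd : |M 1 0| < M 1 1) (h1 : M 1 1 < M 0 0 + |M 0 1|)
    (h2 : M 0 0 < M 1 1 + |M 1 0|) {m n : ℤ} (hmn : m ≠ 0 ∨ n ≠ 0)
    (hle : ‖latticeVec M m n‖ ≤ max (M 0 0) (M 1 1)) :
    (m = 1 ∧ n = 0) ∨ (m = -1 ∧ n = 0) ∨ (m = 0 ∧ n = 1) ∨ (m = 0 ∧ n = -1) := by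
  rw [norm_eq_max, max_le_iff, latticeVec_zero, latticeVec_one] at hle
  obtain ⟨hu, hw⟩ := hle
  have hb : 0 < |M 0 1| := abs_pos.2 (by rintro h; simp [h] at hbc)
  have hc : 0 < |M 1 0| := abs_pos.2 (by rintro h; simp [h] at hbc)
  by_cases hm : m = 0
  · have hn : n ≠ 0 := by tauto
    subst hm
    rw [Int.cast_zero, mul_zero, zero_add] at hw
    rcases eq_one_or_of_abs_mul_lt hn hd hw (max_lt (by linarith) (by linarith)) with h | h <;>
      simp [h]
  by_cases hn : n = 0
  · subst hn
    rw [Int.cast_zero, mul_zero, add_zero] at hu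
    rcases eq_one_or_of_abs_mul_lt hm ha hu (max_lt (by linarith) (by linarith)) with h | h <;>
      simp [h]
  -- When m and n are both nonzero, bc < 0 makes the two terms have the same sign in one of the two
  -- coordinates. The vector then has length at least a + |b| or |c| + d, and both exceed max a d.
  exfalso
  by_cases hs : 0 ≤ (M 0 0 * m) * (M 0 1 * n)
  · have := add_le_abs_of_mul_pos hm hn hs
    rw [abs_of_pos ha] at this
    exact absurd (this.trans hu) (not_le.2 (max_lt (by linarith) h1))
  · have hs' : 0 ≤ (M 1 0 * m) * (M 1 1 * n) := by
      push Not at hs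
      have e1 : M 0 1 * ((m : ℝ) * n) < 0 := by
        by_contra! h
        nlinarith
      have e2 : 0 < M 1 0 * ((m : ℝ) * n) := by
        by_contra! h
        nlinarith [mul_nonneg_of_nonpos_of_nonpos e1.le h, sq_nonneg ((m : ℝ) * n),
          mul_nonneg (neg_nonneg.2 hbc.le) (sq_nonneg ((m : ℝ) * n)),
          mul_pos_of_neg_of_neg hbc (neg_lt_zero.2 (pow_pos (abs_pos.2
            (mul_ne_zero (Int.cast_ne_zero (α := ℝ).2 hm) (Int.cast_ne_zero.2 hn))) 2)),
          sq_abs ((m : ℝ) * n)]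
      nlinarith
    have := add_le_abs_of_mul_pos hm hn hs'
    rw [abs_of_pos hd] at this
    exact absurd (this.trans hw) (not_le.2 (max_lt (by linarith) (by linarith)))

lemma latticeVec_one_zero (M : SL(2, ℝ)) : latticeVec M 1 0 = ![M 0 0, M 1 0] := by
  simp [latticeVec]

lemma latticeVec_zero_one (M : SL(2, ℝ)) : latticeVec M 0 1 = ![M 0 1, M 1 1] := by
  simp [latticeVec]

lemma norm_latticeVec_one_zero (M : SL(2, ℝ)) : ‖latticeVec M 1 0‖ = max |M 0 0| |M 1 0| := by
  rw [norm_eq_max]; simp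

lemma norm_latticeVec_zero_one (M : SL(2, ℝ)) : ‖latticeVec M 0 1‖ = max |M 0 1| |M 1 1| := by
  rw [norm_eq_max]; simp

lemma linearIndependent_latticeVec (M : SL(2, ℝ)) :
    LinearIndependent ℝ ![latticeVec M 1 0, latticeVec M 0 1] := by
  rw [LinearIndependent.pair_iff]
  intro s t h
  have h0 := congr_fun h 0
  have h1 := congr_fun h 1
  simp at h0 h1
  have hd := det_eq_one M
  constructor
  · linear_combination -s * hd + M 1 1 * h0 - M 0 1 * h1
  · linear_combination -t * hd - M 1 0 * h0 + M 0 0 * h1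

/-- The shortest vectors of a lattice of the transversal. -/
lemma minimal_vectors {M : SL(2, ℝ)} (ha : 0 < M 0 0) (hd : M 0 0 = M 1 1)
    (hbc : M 0 1 * M 1 0 < 0) (hab : |M 0 1| < M 0 0) (hcd : |M 1 0| < M 1 1) :
    {w | w ∈ latticeVectors (toLattice M) ∧ w ≠ 0 ∧ ‖w‖ ≤ firstMinimum (toLattice M)}
      = {latticeVec M 1 0, -latticeVec M 1 0, latticeVec M 0 1, -latticeVec M 0 1} := by
  have hb : 0 < |M 0 1| := abs_pos.2 (by rintro h; simp [h] at hbc)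
  have hc : 0 < |M 1 0| := abs_pos.2 (by rintro h; simp [h] at hbc)
  have n0 : ‖latticeVec M 1 0‖ = M 0 0 := by
    rw [norm_latticeVec_one_zero, abs_of_pos ha, max_eq_left (by linarith)]
  have n1 : ‖latticeVec M 0 1‖ = M 0 0 := by
    rw [norm_latticeVec_zero_one, ← hd, abs_of_pos ha, max_eq_right hab.le]
  have z0 : latticeVec M 1 0 ≠ 0 := by simp [latticeVec_eq_zero_iff]
  have z1 : latticeVec M 0 1 ≠ 0 := by simp [latticeVec_eq_zero_iff]
  have short : ∀ w ∈ latticeVectors (toLattice M), w ≠ 0 → ‖w‖ ≤ M 0 0 →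
      w ∈ ({latticeVec M 1 0, -latticeVec M 1 0, latticeVec M 0 1, -latticeVec M 0 1} :
        Set (Fin 2 → ℝ)) := by
    intro w hw hw0 hle
    obtain ⟨m, n, rfl⟩ := mem_latticeVectors.1 hw
    rw [Ne, latticeVec_eq_zero_iff, not_and_or] at hw0
    rcases short_vectors ha (hd ▸ ha) hbc hab hcd (by linarith) (by linarith) hw0
      (hle.trans (le_max_left _ _)) with ⟨rfl, rfl⟩ | ⟨rfl, rfl⟩ | ⟨rfl, rfl⟩ | ⟨rfl, rfl⟩
    · simp
    · rw [show latticeVec M (-1) 0 = -latticeVec M 1 0 by rw [← latticeVec_neg, neg_zero]]; simp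
    · simp
    · rw [show latticeVec M 0 (-1) = -latticeVec M 0 1 by rw [← latticeVec_neg, neg_zero]]; simp
  have hfm : firstMinimum (toLattice M) = M 0 0 := by
    rw [← n0]
    refine firstMinimum_eq (latticeVec_mem M 1 0) z0 fun w hw hw0 => ?_
    by_contra! hlt
    rw [n0] at hlt
    have := short w hw hw0 hlt.le
    simp only [mem_insert_iff, mem_singleton_iff] at this
    rcases this with rfl | rfl | rfl | rfl
    · exact absurd hlt (by rw [n0]; exact lt_irrefl _)
    · exact absurd hlt (by rw [norm_neg, n0]; exact lt_irrefl _)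
    · exact absurd hlt (by rw [n1]; exact lt_irrefl _)
    · exact absurd hlt (by rw [norm_neg, n1]; exact lt_irrefl _)
  ext w
  constructor
  · rintro ⟨hw, hw0, hle⟩
    exact short w hw hw0 (hfm ▸ hle)
  · have neg_mem : ∀ v ∈ latticeVectors (toLattice M), -v ∈ latticeVectors (toLattice M) := by
      intro v hv
      obtain ⟨m, n, rfl⟩ := mem_latticeVectors.1 hv
      rw [← latticeVec_neg]
      exact latticeVec_mem _ _ _
    simp only [mem_insert_iff, mem_singleton_iff]
    rintro (rfl | rfl | rfl | rfl)
    · exact ⟨latticeVec_mem _ _ _, z0, by rw [hfm, n0]⟩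
    · exact ⟨neg_mem _ (latticeVec_mem _ _ _), neg_ne_zero.2 z0, by rw [hfm, norm_neg, n0]⟩
    · exact ⟨latticeVec_mem _ _ _, z1, by rw [hfm, n1]⟩
    · exact ⟨neg_mem _ (latticeVec_mem _ _ _), neg_ne_zero.2 z1, by rw [hfm, norm_neg, n1]⟩

lemma mem_transversal_of_eq {M : SL(2, ℝ)} (ha : 0 < M 0 0) (hd : M 0 0 = M 1 1)
    (hbc : M 0 1 * M 1 0 < 0) (hab : |M 0 1| < M 0 0) (hcd : |M 1 0| < M 1 1) :
    toLattice M ∈ transversal := by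
  refine ⟨latticeVec M 1 0, latticeVec_mem _ _ _, latticeVec M 0 1, latticeVec_mem _ _ _,
    linearIndependent_latticeVec M, ?_, ?_, ?_, minimal_vectors ha hd hbc hab hcd⟩
  · simp only [latticeVec_zero_one, Matrix.cons_val_zero, Matrix.cons_val_one]
    rwa [← hd, abs_of_pos ha]
  · simp only [latticeVec_one_zero, latticeVec_zero_one, Matrix.cons_val_one,
      Matrix.cons_val_fin_one]
    rwa [abs_of_pos (hd ▸ ha : 0 < M 1 1)]
  · simp only [latticeVec_one_zero, latticeVec_zero_one, Matrix.cons_val_zero, Matrix.cons_val_one]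
    rw [hd]

/-- Close to the transversal, it is the hypersurface where the diagonal entries agree. -/
lemma mem_transversal_iff {M : SL(2, ℝ)} (ha : 0 < M 0 0) (hd : 0 < M 1 1)
    (hbc : M 0 1 * M 1 0 < 0)
    (hab : |M 0 1| < M 0 0) (hcd : |M 1 0| < M 1 1) (h1 : M 1 1 < M 0 0 + |M 0 1|)
    (h2 : M 0 0 < M 1 1 + |M 1 0|) : toLattice M ∈ transversal ↔ M 0 0 = M 1 1 := by
  refine ⟨fun hS => ?_, fun h => mem_transversal_of_eq ha h hbc hab hcd⟩
  by_contra hne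
  have z0 : latticeVec M 1 0 ≠ 0 := by simp [latticeVec_eq_zero_iff]
  have z1 : latticeVec M 0 1 ≠ 0 := by simp [latticeVec_eq_zero_iff]
  have n0 := norm_latticeVec_one_zero M
  have n1 := norm_latticeVec_zero_one M
  rw [abs_of_pos ha] at n0
  rw [abs_of_pos hd] at n1
  have e1 : latticeVec M (-1) 0 = -latticeVec M 1 0 := by rw [← latticeVec_neg, neg_zero]
  have e2 : latticeVec M 0 (-1) = -latticeVec M 0 1 := by rw [← latticeVec_neg, neg_zero]
  -- When the diagonal entries differ, one column is strictly shorter than the other, and every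
  -- lattice vector of at most its length is a multiple of it.
  rcases lt_or_gt_of_ne hne with h | h
  · have l0 : ‖latticeVec M 1 0‖ < M 1 1 := by rw [n0]; exact max_lt h hcd
    have l1 : M 1 1 ≤ ‖latticeVec M 0 1‖ := by rw [n1]; exact le_max_right _ _
    refine notMem_transversal (latticeVec_mem M 1 0) z0 ?_ hS
    intro w hw hle
    obtain ⟨m, n, rfl⟩ := mem_latticeVectors.1 hw
    by_cases h0 : m = 0 ∧ n = 0
    · exact ⟨0, by rw [zero_smul, latticeVec_eq_zero_iff]; exact h0⟩
    rw [not_and_or] at h0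
    rcases short_vectors ha hd hbc hab hcd h1 h2 h0
      ((hle.trans l0.le).trans (le_max_right _ _))
      with ⟨rfl, rfl⟩ | ⟨rfl, rfl⟩ | ⟨rfl, rfl⟩ | ⟨rfl, rfl⟩
    · exact ⟨1, by simp⟩
    · exact ⟨-1, by simp [e1]⟩
    · linarith
    · rw [e2, norm_neg] at hle; linarith
  · have l0 : ‖latticeVec M 0 1‖ < M 0 0 := by rw [n1]; exact max_lt hab h
    have l1 : M 0 0 ≤ ‖latticeVec M 1 0‖ := by rw [n0]; exact le_max_left _ _
    refine notMem_transversal (latticeVec_mem M 0 1) z1 ?_ hS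
    intro w hw hle
    obtain ⟨m, n, rfl⟩ := mem_latticeVectors.1 hw
    by_cases h0 : m = 0 ∧ n = 0
    · exact ⟨0, by rw [zero_smul, latticeVec_eq_zero_iff]; exact h0⟩
    rw [not_and_or] at h0
    rcases short_vectors ha hd hbc hab hcd h1 h2 h0
      ((hle.trans l0.le).trans (le_max_left _ _))
      with ⟨rfl, rfl⟩ | ⟨rfl, rfl⟩ | ⟨rfl, rfl⟩ | ⟨rfl, rfl⟩
    · linarith
    · rw [e1, norm_neg] at hle; linarith
    · exact ⟨1, by simp⟩
    · exact ⟨-1, by simp [e2]⟩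

lemma frame_mul_neg (t : ℝ) {p : ℝ × ℝ} (hp : p ∈ unitSquare) (ε : ℤˣ) :
    frame t p ε 0 1 * frame t p ε 1 0 < 0 := by
  obtain ⟨-, -, hb, hc, -, -⟩ := frame_pos t hp ε
  have := mul_pos hb hc
  have he := sign_mul_self ε
  nlinarith

lemma frame_zero_diag {p : ℝ × ℝ} (hp : p ∈ unitSquare) (ε : ℤˣ) :
    frame 0 p ε 0 0 = frame 0 p ε 1 1 := by
  obtain ⟨e1, -, -, e4⟩ := frame_entries 0 hp ε
  rw [e1, e4, neg_zero]

lemma param_mem_transversal {p : ℝ × ℝ} (hp : p ∈ unitSquare) (ε : ℤˣ) :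
    param p ε ∈ transversal := by
  rw [← toLattice_frame_zero]
  obtain ⟨ha, hd, hb, hc, hab, hcd⟩ := frame_pos 0 hp ε
  exact mem_transversal_of_eq ha (frame_zero_diag hp ε) (frame_mul_neg 0 hp ε) hab hcd

/-- The set of the four minimal vectors depends on the lattice only. Positive diagonal entries that
dominate the off-diagonal ones single out v₀ and v₁ among them, so the lattice determines the
matrix. -/
lemma param_injective {p p' : ℝ × ℝ} (hp : p ∈ unitSquare) (hp' : p' ∈ unitSquare) {ε ε' : ℤˣ}
    (h : param p ε = param p' ε') : p = p' ∧ ε = ε' := by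
  have key : ∀ {p : ℝ × ℝ} (_ : p ∈ unitSquare) (ε : ℤˣ),
      {w | w ∈ latticeVectors (param p ε) ∧ w ≠ 0 ∧ ‖w‖ ≤ firstMinimum (param p ε)} =
      {latticeVec (frame 0 p ε) 1 0, -latticeVec (frame 0 p ε) 1 0,
        latticeVec (frame 0 p ε) 0 1, -latticeVec (frame 0 p ε) 0 1} := by
    intro p hp ε
    rw [← toLattice_frame_zero]
    obtain ⟨ha, hd, hb, hc, hab, hcd⟩ := frame_pos 0 hp ε
    exact minimal_vectors ha (frame_zero_diag hp ε) (frame_mul_neg 0 hp ε) hab hcd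
  have h1 := key hp ε
  rw [h, key hp' ε'] at h1
  obtain ⟨ha, hd, -, -, hab, hcd⟩ := frame_pos 0 hp ε
  obtain ⟨ha', hd', -, -, hab', hcd'⟩ := frame_pos 0 hp' ε'
  have e := frame_zero_diag hp ε
  have e' := frame_zero_diag hp' ε'
  set M := frame 0 p ε with hM
  set N := frame 0 p' ε' with hN
  have hMN : M = N := by
    rw [abs_lt] at hab hcd hab' hcd'
    have c0 : latticeVec M 1 0 = latticeVec N 1 0 := by
      have : latticeVec M 1 0 ∈ ({latticeVec N 1 0, -latticeVec N 1 0,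
        latticeVec N 0 1, -latticeVec N 0 1} : Set (Fin 2 → ℝ)) := by rw [h1]; simp
      simp only [mem_insert_iff, mem_singleton_iff] at this
      rcases this with h | h | h | h
      · exact h
      · have := congr_fun h 0; simp at this; linarith
      · have h0 := congr_fun h 0; have h1 := congr_fun h 1; simp at h0 h1; linarith
      · have h0 := congr_fun h 0; have h1 := congr_fun h 1; simp at h0 h1; linarith
    have c1 : latticeVec M 0 1 = latticeVec N 0 1 := by
      have : latticeVec M 0 1 ∈ ({latticeVec N 1 0, -latticeVec N 1 0,
        latticeVec N 0 1, -latticeVec N 0 1} : Set (Fin 2 → ℝ)) := by rw [h1]; simp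
      simp only [mem_insert_iff, mem_singleton_iff] at this
      rcases this with h | h | h | h
      · have h0 := congr_fun h 0; have h1 := congr_fun h 1; simp at h0 h1; linarith
      · have h0 := congr_fun h 0; have h1 := congr_fun h 1; simp at h0 h1; linarith
      · exact h
      · have := congr_fun h 1; simp at this; linarith
    rw [latticeVec_one_zero, latticeVec_one_zero] at c0
    rw [latticeVec_zero_one, latticeVec_zero_one] at c1
    ext i j
    fin_cases i <;> fin_cases j
    · exact congr_fun c0 0
    · exact congr_fun c1 0
    · exact congr_fun c0 1
    · exact congr_fun c1 1
  exact (frame_inj hp hp' hMN).2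

/-! ### The first return -/

/-- Along the orbit of `param (x, y) ε` the vector `v₁` is the only shortest vector, up to sign,
until the time `½ ln ((y + n) / x)`. -/
lemma notMem_transversal_of_lt {x y : ℝ} (hp : (x, y) ∈ unitSquare) (ε : ℤˣ) {n : ℕ} (hn : 1 ≤ n)
    (hnx : n * x < 1) {t : ℝ} (ht : 0 < t) (htau : t < 1 / 2 * Real.log ((y + n) / x)) :
    toLattice (frame t (x, y) ε) ∉ transversal := by
  obtain ⟨e1, e2, e3, e4⟩ := frame_entries t hp ε
  obtain ⟨ha, hd, -, -, -, -⟩ := frame_pos t hp ε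
  have hr : 0 < (Real.sqrt (1 + x * y))⁻¹ := inv_pos.2 (Real.sqrt_pos.2 (one_add_mul_pos hp))
  obtain ⟨⟨hx0, hx1⟩, ⟨hy0, hy1⟩⟩ := hp
  simp only at hx0 hx1 hy0 hy1 e1 e2 e3 e4
  rw [← e1] at e2
  rw [← e4] at e3
  have hn' : (1 : ℝ) ≤ n := by exact_mod_cast hn
  have hDA : frame t (x, y) ε 1 1 < frame t (x, y) ε 0 0 := by
    rw [e1, e4]
    gcongr
    linarith
  -- The bound on t says that the horizontal length A x of v₁ is still smaller than the vertical
  -- length D (y + n) of v₀ + ε n v₁.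
  have hAD : frame t (x, y) ε 0 0 * x < frame t (x, y) ε 1 1 * (y + n) := by
    have : Real.exp (2 * t) < (y + n) / x := by
      rw [← Real.lt_log_iff_exp_lt (by positivity)]
      linarith
    rw [lt_div_iff₀ hx0] at this
    rw [e1, e4]
    have h3 : Real.exp t = Real.exp (-t) * Real.exp (2 * t) := by
      rw [← Real.exp_add]; ring_nf
    rw [h3]
    have := mul_lt_mul_of_pos_left this (mul_pos (Real.exp_pos (-t)) hr)
    linarith
  set M := frame t (x, y) ε with hM
  have hxA : M 0 0 * x < M 0 0 := mul_lt_of_lt_one_right ha hx1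
  have hn1 : ‖latticeVec M 0 1‖ = max (M 0 0 * x) (M 1 1) := by
    rw [norm_latticeVec_zero_one, e2, abs_of_pos hd, abs_mul, abs_mul, abs_neg, abs_sign, one_mul,
      abs_of_pos hx0, abs_of_pos ha, mul_comm]
  refine notMem_transversal (latticeVec_mem M 0 1) (by simp [latticeVec_eq_zero_iff]) ?_
  intro w hw hle
  obtain ⟨m, k, rfl⟩ := mem_latticeVectors.1 hw
  by_cases hm : m = 0
  · refine ⟨k, ?_⟩
    ext i
    fin_cases i <;> simp [hm, mul_comm]
  exfalso
  rw [hn1] at hle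
  -- up to a sign, the first coordinate of the vector is positive
  have main : ∀ m k : ℤ, 0 < m → max (M 0 0 * |(m : ℝ) - k * x|) (M 1 1 * |m * y + k|)
      ≤ max (M 0 0 * x) (M 1 1) → False := by
    intro m k hm hle
    have hm' : (1 : ℝ) ≤ m := by exact_mod_cast hm
    have hlt : max (M 0 0 * x) (M 1 1) < M 0 0 := max_lt hxA hDA
    have hlt' : max (M 0 0 * x) (M 1 1) < M 1 1 * (y + n) :=
      max_lt hAD (lt_mul_of_one_lt_right hd (by linarith))
    have h1 : |(m : ℝ) - k * x| < 1 := by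
      have := ((le_max_left _ _).trans hle).trans_lt hlt
      by_contra! h
      nlinarith
    have h2 : |m * y + k| < y + n := by
      have := ((le_max_right _ _).trans hle).trans_lt hlt'
      exact lt_of_mul_lt_mul_left this hd.le
    rw [abs_lt] at h1 h2
    -- For k ≤ 0 the horizontal part would be at least A, and for k ≥ n the vertical part would
    -- exceed D (y + n). For 1 ≤ k ≤ n - 1 both parts strictly exceed those of v₁, since (k + 1) x ≤
    -- n x < 1 ≤ m.
    have hk : 1 ≤ k := by
      by_contra! h
      have : (k : ℝ) ≤ 0 := by exact_mod_cast Int.lt_add_one_iff.1 h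
      nlinarith
    have hkn : k < n := by
      have : (k : ℝ) < n := by nlinarith
      exact_mod_cast this
    have hkn' : (k : ℝ) ≤ n - 1 := by
      have : (k : ℤ) ≤ n - 1 := by omega
      exact_mod_cast this
    have hk' : (1 : ℝ) ≤ k := by exact_mod_cast hk
    have hu : x < m - k * x := by nlinarith
    have hw' : 1 < m * y + k := by nlinarith
    rw [abs_of_pos (hx0.trans hu), abs_of_pos (one_pos.trans hw')] at hle
    have : max (M 0 0 * x) (M 1 1) < max (M 0 0 * (m - k * x)) (M 1 1 * (m * y + k)) :=
      max_lt_max (mul_lt_mul_of_pos_left hu ha) (lt_mul_of_one_lt_right hd hw')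
    linarith
  rw [norm_eq_max, latticeVec_zero, latticeVec_one, e2, e3] at hle
  have r1 : M 0 0 * m + -((ε : ℤ) : ℝ) * x * M 0 0 * k
      = M 0 0 * (m - (((ε : ℤ) * k : ℤ) : ℝ) * x) := by push_cast; ring
  have r2 : ((ε : ℤ) : ℝ) * y * M 1 1 * m + M 1 1 * k
      = ((ε : ℤ) : ℝ) * (M 1 1 * (m * y + (((ε : ℤ) * k : ℤ) : ℝ))) := by
    push_cast
    linear_combination -(M 1 1 * k) * sign_mul_self ε
  rw [r1, r2, abs_mul, abs_mul, abs_mul, abs_sign, one_mul, abs_of_pos ha, abs_of_pos hd] at hle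
  rcases lt_or_gt_of_ne hm with h | h
  · refine main (-m) (-((ε : ℤ) * k)) (by omega) ?_
    rw [show ((-m : ℤ) : ℝ) - ((-((ε : ℤ) * k) : ℤ) : ℝ) * x =
        -(m - (((ε : ℤ) * k : ℤ) : ℝ) * x) by push_cast; ring,
      show ((-m : ℤ) : ℝ) * y + ((-((ε : ℤ) * k) : ℤ) : ℝ) =
        -(m * y + (((ε : ℤ) * k : ℤ) : ℝ)) by push_cast; ring, abs_neg, abs_neg]
    exact hle
  · exact main m _ h hle

/-- The first return. -/
lemma flow_smul_param_return {x y : ℝ} (hp : (x, y) ∈ unitSquare) (ε : ℤˣ) {n : ℕ} (hn : 1 ≤ n)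
    (hnx : n * x < 1) (hnx' : 1 < (n + 1) * x) :
    flow (1 / 2 * Real.log ((y + n) / x)) • param (x, y) ε
      = param (1 / x - n, 1 / (y + n)) (-ε) := by
  set t := 1 / 2 * Real.log ((y + n) / x) with ht
  obtain ⟨e1, e2, e3, e4⟩ := frame_entries t hp ε
  obtain ⟨ha, hd, -, -, -, -⟩ := frame_pos t hp ε
  have he := sign_mul_self ε
  have hr : 0 < (Real.sqrt (1 + x * y))⁻¹ := inv_pos.2 (Real.sqrt_pos.2 (one_add_mul_pos hp))
  obtain ⟨⟨hx0, hx1⟩, ⟨hy0, hy1⟩⟩ := hp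
  simp only at hx0 hx1 hy0 hy1 e1 e2 e3 e4
  rw [← e1] at e2
  rw [← e4] at e3
  have hn' : (1 : ℝ) ≤ n := by exact_mod_cast hn
  have hyn : 0 < y + n := by linarith
  have hAD : frame t (x, y) ε 0 0 * x = frame t (x, y) ε 1 1 * (y + n) := by
    have : Real.exp (2 * t) = (y + n) / x := by
      rw [ht, ← mul_assoc, mul_one_div_cancel two_ne_zero, one_mul, Real.exp_log (by positivity)]
    rw [eq_div_iff hx0.ne'] at this
    rw [e1, e4]
    have h3 : Real.exp t = Real.exp (-t) * Real.exp (2 * t) := by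
      rw [← Real.exp_add]; ring_nf
    rw [h3]
    linear_combination Real.exp (-t) * (Real.sqrt (1 + x * y))⁻¹ * this
  set M := frame t (x, y) ε with hM
  set A := M 0 0 with hA
  set D := M 1 1 with hD
  -- The new basis is (-ε v₁, ε v₀ + n v₁): up to sign v₁ takes the place of v₀, and v₀ + ε n v₁
  -- that of v₁. The signs make the diagonal positive, and they replace ε by -ε.
  obtain ⟨N, hMN, n1, n3, n2, n4⟩ := exists_change_basis M
    (a := 0) (b := (ε : ℤ)) (c := -(ε : ℤ)) (d := n)
    (by rcases Int.units_eq_one_or ε with h | h <;> simp [h])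
  simp only [latticeVec_zero, latticeVec_one, e2, e3] at n1 n2 n3 n4
  push_cast at n1 n2 n3 n4
  replace n1 : N 0 0 = A * x := by rw [n1]; linear_combination A * x * he
  replace n2 : N 0 1 = ((ε : ℤ) : ℝ) * (A * (1 - n * x)) := by rw [n2]; ring
  replace n3 : N 1 0 = -((ε : ℤ) : ℝ) * D := by rw [n3]; ring
  replace n4 : N 1 1 = D * (y + n) := by rw [n4]; linear_combination D * y * he
  have p1 : 0 < A * x := mul_pos ha hx0
  have p2 : 0 < D * (y + n) := mul_pos hd hyn
  have p3 : 0 < A * (1 - n * x) := mul_pos ha (by linarith)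
  have hneg : (((-ε : ℤˣ) : ℤ) : ℝ) = -((ε : ℤ) : ℝ) := by push_cast; ring
  have hab : |N 0 1| < N 0 0 := by
    rw [n1, n2, abs_mul, abs_sign, one_mul, abs_of_pos p3]
    exact mul_lt_mul_of_pos_left (by linarith) ha
  have hcd : |N 1 0| < N 1 1 := by
    rw [n3, n4, abs_mul, abs_neg, abs_sign, one_mul, abs_of_pos hd]
    exact lt_mul_of_one_lt_right hd (by linarith)
  obtain ⟨-, hfr⟩ := eq_frame (M := N) (ε := -ε) (by rw [n1]; exact p1) (by rw [n4]; exact p2)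
    (by rw [hneg, n2, neg_neg, ← mul_assoc, he, one_mul]; exact p3)
    (by rw [hneg, n3, ← mul_assoc, neg_mul_neg, he, one_mul]; exact hd) hab hcd
  rw [flow_smul_param, ← hM, hMN, ← toLattice_frame_zero, hfr]
  congr 2
  · rw [n1, n4, hAD, div_self p2.ne', Real.log_one, mul_zero]
  · rw [hneg, n1, n2, n3, n4]
    have hA0 : A ≠ 0 := ha.ne'
    have hD0 : D ≠ 0 := hd.ne'
    ext
    · change - -((ε : ℤ) : ℝ) * (((ε : ℤ) : ℝ) * (A * (1 - n * x))) / (A * x) = 1 / x - n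
      field_simp
      linear_combination (1 - n * x) * he
    · change -((ε : ℤ) : ℝ) * (-((ε : ℤ) : ℝ) * D) / (D * (y + n)) = 1 / (y + n)
      field_simp
      linear_combination he

/-! ### Lattices with a pair of consecutive minimal vectors -/

/-- After the coefficients are rounded to integers, the remainder falls strictly inside the box,
because one of the two entries is strictly smaller than the other. -/
lemma abs_combination_lt {α β u v : ℝ} (hα : |α| ≤ 1 / 2) (hβ : |β| ≤ 1 / 2) (h : |v| < u) :
    |α * u + β * v| < u := by
  have hu : 0 < u := (abs_nonneg _).trans_lt h
  calc |α * u + β * v| ≤ |α| * |u| + |β| * |v| := by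
        rw [← abs_mul, ← abs_mul]; exact abs_add_le _ _
    _ ≤ 1 / 2 * u + 1 / 2 * |v| := by rw [abs_of_pos hu]; gcongr
    _ < u := by linarith

/-- Rounding the coordinates of a lattice vector with respect to v₀, v₁ leaves a remainder strictly
inside the box. It is zero, so v₀ and v₁ form a basis. As v₀ + v₁ and v₀ - v₁ are not in the box,
the off-diagonal entries have opposite signs, and `eq_frame` applies. -/
lemma exists_frame_of_box_of_pos {M : SL(2, ℝ)} {v₀ v₁ : Fin 2 → ℝ}
    (h₀ : v₀ ∈ latticeVectors (toLattice M)) (h₁ : v₁ ∈ latticeVectors (toLattice M))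
    (hu₀ : 0 < v₀ 0) (hw₁ : 0 < v₁ 1) (hu : |v₁ 0| < v₀ 0) (hw : |v₀ 1| < v₁ 1)
    (hbox : ∀ w ∈ latticeVectors (toLattice M), w ≠ 0 → |w 0| ≤ v₀ 0 → |w 1| ≤ v₁ 1 →
      w = v₀ ∨ w = -v₀ ∨ w = v₁ ∨ w = -v₁) :
    ∃ ε : ℤˣ, (|v₁ 0| / v₀ 0, |v₀ 1| / v₁ 1) ∈ unitSquare ∧
      toLattice M = toLattice (frame (1 / 2 * Real.log (v₀ 0 / v₁ 1))
        (|v₁ 0| / v₀ 0, |v₀ 1| / v₁ 1) ε) ∧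
      frame (1 / 2 * Real.log (v₀ 0 / v₁ 1)) (|v₁ 0| / v₀ 0, |v₀ 1| / v₁ 1) ε 0 0 = v₀ 0 ∧
      frame (1 / 2 * Real.log (v₀ 0 / v₁ 1)) (|v₁ 0| / v₀ 0, |v₀ 1| / v₁ 1) ε 1 1 = v₁ 1 := by
  obtain ⟨a, c, rfl⟩ := mem_latticeVectors.1 h₀
  obtain ⟨b, d, rfl⟩ := mem_latticeVectors.1 h₁
  have hM := det_eq_one M
  set v₀ := latticeVec M a c with hv₀
  set v₁ := latticeVec M b d with hv₁
  have hdet : v₀ 0 * v₁ 1 - v₁ 0 * v₀ 1 = ((a * d - b * c : ℤ) : ℝ) := by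
    push_cast
    simp only [hv₀, hv₁, latticeVec_zero, latticeVec_one]
    linear_combination ((a : ℝ) * d - b * c) * hM
  have hdpos : 0 < v₀ 0 * v₁ 1 - v₁ 0 * v₀ 1 := by
    have h1 : |v₁ 0 * v₀ 1| < v₀ 0 * v₁ 1 := by
      rw [abs_mul]
      exact mul_lt_mul'' hu hw (abs_nonneg _) (abs_nonneg _)
    have := le_abs_self (v₁ 0 * v₀ 1)
    linarith
  have hgen : ∀ m n : ℤ, ∃ r s : ℤ, m = a * r + b * s ∧ n = c * r + d * s := by
    intro m n
    set w := latticeVec M m n with hw'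
    set δ := v₀ 0 * v₁ 1 - v₁ 0 * v₀ 1 with hδ
    set α := (v₁ 1 * w 0 - v₁ 0 * w 1) / δ with hα
    set β := (-v₀ 1 * w 0 + v₀ 0 * w 1) / δ with hβ
    have c1 : w 0 = α * v₀ 0 + β * v₁ 0 := by
      rw [hα, hβ]
      have := hdpos.ne'
      field_simp
      rw [hδ]
      ring
    have c2 : w 1 = α * v₀ 1 + β * v₁ 1 := by
      rw [hα, hβ]
      have := hdpos.ne'
      field_simp
      rw [hδ]
      ring
    refine ⟨round α, round β, ?_⟩
    set z := latticeVec M (m - (a * round α + b * round β)) (n - (c * round α + d * round β)) with hz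
    have z0 : z 0 = (α - round α) * v₀ 0 + (β - round β) * v₁ 0 := by
      have : z 0 = w 0 - round α * v₀ 0 - round β * v₁ 0 := by
        simp only [hz, hw', hv₀, hv₁, latticeVec_zero]
        push_cast
        ring
      rw [this, c1]
      ring
    have z1 : z 1 = (α - round α) * v₀ 1 + (β - round β) * v₁ 1 := by
      have : z 1 = w 1 - round α * v₀ 1 - round β * v₁ 1 := by
        simp only [hz, hw', hv₀, hv₁, latticeVec_one]
        push_cast
        ring
      rw [this, c2]
      ring
    have l0 : |z 0| < v₀ 0 := by
      rw [z0]; exact abs_combination_lt (abs_sub_round _) (abs_sub_round _) hu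
    have l1 : |z 1| < v₁ 1 := by
      rw [z1, add_comm]; exact abs_combination_lt (abs_sub_round _) (abs_sub_round _) hw
    have hz0 : z = 0 := by
      by_contra hne
      rcases hbox z (latticeVec_mem _ _ _) hne l0.le l1.le with h | h | h | h
      · rw [h, abs_of_pos hu₀] at l0; exact lt_irrefl _ l0
      · rw [h, Pi.neg_apply, abs_neg, abs_of_pos hu₀] at l0; exact lt_irrefl _ l0
      · rw [h, abs_of_pos hw₁] at l1; exact lt_irrefl _ l1
      · rw [h, Pi.neg_apply, abs_neg, abs_of_pos hw₁] at l1; exact lt_irrefl _ l1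
    rw [hz, latticeVec_eq_zero_iff, sub_eq_zero, sub_eq_zero] at hz0
    exact hz0
  -- The two vectors generate the lattice, so their integral determinant divides 1, and it is
  -- positive.
  have hone : a * d - b * c = 1 := by
    obtain ⟨r, s, h1, h2⟩ := hgen 1 0
    obtain ⟨r', s', h3, h4⟩ := hgen 0 1
    have hk : 0 < a * d - b * c := by
      rw [hdet] at hdpos
      exact_mod_cast hdpos
    have hdvd : (a * d - b * c) * (r * s' - r' * s) = 1 := by
      have : (a * d - b * c) * (r * s' - r' * s)
        = (a * r + b * s) * (c * r' + d * s') - (a * r' + b * s') * (c * r + d * s) := by ring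
      rw [this, ← h1, ← h2, ← h3, ← h4]
      norm_num
    exact Int.eq_one_of_mul_eq_one_right hk.le hdvd
  obtain ⟨N, hMN, n1, n2, n3, n4⟩ := exists_change_basis M hone
  rw [← hv₀] at n1 n2
  rw [← hv₁] at n3 n4
  have e0 : v₀ = latticeVec N 1 0 := by
    rw [latticeVec_one_zero, n1, n2]; ext i; fin_cases i <;> rfl
  have e1 : v₁ = latticeVec N 0 1 := by
    rw [latticeVec_zero_one, n3, n4]; ext i; fin_cases i <;> rfl
  have excl : ∀ k : ℤ, (k = 1 ∨ k = -1) → |v₀ 0 + k * v₁ 0| ≤ v₀ 0 → |v₀ 1 + k * v₁ 1| ≤ v₁ 1 →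
      False := by
    intro k hk h1 h2
    have hm : latticeVec N 1 k ∈ latticeVectors (toLattice M) := by
      rw [hMN]; exact latticeVec_mem _ _ _
    have q0 : latticeVec N 1 k 0 = v₀ 0 + k * v₁ 0 := by
      rw [latticeVec_zero, n1, n3]; push_cast; ring
    have q1 : latticeVec N 1 k 1 = v₀ 1 + k * v₁ 1 := by
      rw [latticeVec_one, n2, n4]; push_cast; ring
    have hne : latticeVec N 1 k ≠ 0 := by
      rw [Ne, latticeVec_eq_zero_iff]; omega
    rcases hbox _ hm hne (by rw [q0]; exact h1) (by rw [q1]; exact h2) with h | h | h | h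
    · rw [e0] at h; have := latticeVec_inj h; omega
    · rw [e0, ← latticeVec_neg] at h; have := latticeVec_inj h; omega
    · rw [e1] at h; have := latticeVec_inj h; omega
    · rw [e1, ← latticeVec_neg] at h; have := latticeVec_inj h; omega
  rw [abs_lt] at hu hw
  -- If both off-diagonal entries were nonnegative, v₀ - v₁ would lie in the box. If both were
  -- nonpositive, v₀ + v₁ would.
  have s1 : v₁ 0 < 0 ∨ v₀ 1 < 0 := by
    by_contra! h
    apply excl (-1) (Or.inr rfl)
    · push_cast; rw [abs_le]; constructor <;> linarith
    · push_cast; rw [abs_le]; constructor <;> linarith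
  have s2 : 0 < v₁ 0 ∨ 0 < v₀ 1 := by
    by_contra! h
    apply excl 1 (Or.inl rfl)
    · push_cast; rw [abs_le]; constructor <;> linarith
    · push_cast; rw [abs_le]; constructor <;> linarith
  have s3 : (v₁ 0 < 0 ∧ 0 < v₀ 1) ∨ (0 < v₁ 0 ∧ v₀ 1 < 0) := by
    rcases s1 with h | h <;> rcases s2 with h' | h'
    · linarith
    · exact Or.inl ⟨h, h'⟩
    · exact Or.inr ⟨h', h⟩
    · linarith
  have fin : ∀ ε : ℤˣ, 0 < -((ε : ℤ) : ℝ) * v₁ 0 → 0 < ((ε : ℤ) : ℝ) * v₀ 1 →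
      (|v₁ 0| / v₀ 0, |v₀ 1| / v₁ 1) ∈ unitSquare ∧
      toLattice M = toLattice (frame (1 / 2 * Real.log (v₀ 0 / v₁ 1))
        (|v₁ 0| / v₀ 0, |v₀ 1| / v₁ 1) ε) ∧
      frame (1 / 2 * Real.log (v₀ 0 / v₁ 1)) (|v₁ 0| / v₀ 0, |v₀ 1| / v₁ 1) ε 0 0 = v₀ 0 ∧
      frame (1 / 2 * Real.log (v₀ 0 / v₁ 1)) (|v₁ 0| / v₀ 0, |v₀ 1| / v₁ 1) ε 1 1 = v₁ 1 := by
    intro ε p1 p2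
    have a1 : |v₁ 0| = -((ε : ℤ) : ℝ) * v₁ 0 := by
      rw [← abs_of_pos p1, abs_mul, abs_neg, abs_sign, one_mul]
    have a2 : |v₀ 1| = ((ε : ℤ) : ℝ) * v₀ 1 := by
      rw [← abs_of_pos p2, abs_mul, abs_sign, one_mul]
    obtain ⟨f1, f2⟩ := eq_frame (M := N) (ε := ε) (by rwa [n1]) (by rwa [n4]) (by rwa [n3])
      (by rwa [n2]) (by rw [n1, n3, abs_lt]; exact hu) (by rw [n2, n4, abs_lt]; exact hw)
    rw [n1, n2, n3, n4, ← a1, ← a2] at f1 f2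
    rw [← f2]
    exact ⟨f1, hMN, n1, n4⟩
  rcases s3 with ⟨h, h'⟩ | ⟨h, h'⟩
  · exact ⟨1, fin 1 (by push_cast; linarith) (by push_cast; linarith)⟩
  · exact ⟨-1, fin (-1) (by push_cast; linarith) (by push_cast; linarith)⟩

lemma neg_mem_latticeVectors {Λ : LatticeSpace} {v : Fin 2 → ℝ} (hv : v ∈ latticeVectors Λ) :
    -v ∈ latticeVectors Λ := by
  obtain ⟨M, rfl⟩ := QuotientGroup.mk_surjective Λ
  obtain ⟨m, n, rfl⟩ := mem_latticeVectors.1 hv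
  rw [← latticeVec_neg]
  exact latticeVec_mem _ _ _

lemma exists_pos_multiple {Λ : LatticeSpace} {v : Fin 2 → ℝ} (hv : v ∈ latticeVectors Λ)
    {i : Fin 2} (hi : v i ≠ 0) :
    ∃ v' ∈ latticeVectors Λ, (v' = v ∨ v' = -v) ∧ 0 < v' i := by
  rcases lt_or_gt_of_ne hi with h | h
  · exact ⟨-v, neg_mem_latticeVectors hv, Or.inr rfl, by simpa using h⟩
  · exact ⟨v, hv, Or.inl rfl, h⟩

/-- If a box contains only the nonzero lattice points `±v₀` and `±v₁`, the vectors `v₀` and `v₁`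
form a basis of the lattice, and the lattice is on the orbit of a point of the transversal. -/
lemma exists_frame_of_box {M : SL(2, ℝ)} {v₀ v₁ : Fin 2 → ℝ}
    (h₀ : v₀ ∈ latticeVectors (toLattice M)) (h₁ : v₁ ∈ latticeVectors (toLattice M))
    (hu : |v₁ 0| < |v₀ 0|) (hw : |v₀ 1| < |v₁ 1|)
    (hbox : ∀ w ∈ latticeVectors (toLattice M), w ≠ 0 → |w 0| ≤ |v₀ 0| → |w 1| ≤ |v₁ 1| →
      w = v₀ ∨ w = -v₀ ∨ w = v₁ ∨ w = -v₁) :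
    ∃ ε : ℤˣ, (|v₁ 0| / |v₀ 0|, |v₀ 1| / |v₁ 1|) ∈ unitSquare ∧
      toLattice M = toLattice (frame (1 / 2 * Real.log (|v₀ 0| / |v₁ 1|))
        (|v₁ 0| / |v₀ 0|, |v₀ 1| / |v₁ 1|) ε) ∧
      frame (1 / 2 * Real.log (|v₀ 0| / |v₁ 1|))
        (|v₁ 0| / |v₀ 0|, |v₀ 1| / |v₁ 1|) ε 0 0 = |v₀ 0| ∧
      frame (1 / 2 * Real.log (|v₀ 0| / |v₁ 1|))
        (|v₁ 0| / |v₀ 0|, |v₀ 1| / |v₁ 1|) ε 1 1 = |v₁ 1| := by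
  obtain ⟨w₀, hw₀, e₀, p₀⟩ := exists_pos_multiple h₀
    (abs_pos.1 ((abs_nonneg _).trans_lt hu))
  obtain ⟨w₁, hw₁, e₁, p₁⟩ := exists_pos_multiple h₁
    (abs_pos.1 ((abs_nonneg _).trans_lt hw))
  have a₀ : ∀ i, |w₀ i| = |v₀ i| := by rcases e₀ with rfl | rfl <;> simp
  have a₁ : ∀ i, |w₁ i| = |v₁ i| := by rcases e₁ with rfl | rfl <;> simp
  have b₀ : w₀ 0 = |v₀ 0| := by rw [← a₀, abs_of_pos p₀]
  have b₁ : w₁ 1 = |v₁ 1| := by rw [← a₁, abs_of_pos p₁]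
  have := exists_frame_of_box_of_pos hw₀ hw₁ p₀ p₁ (by rwa [a₁, b₀]) (by rwa [a₀, b₁]) (by
    intro w hw hw0 l0 l1
    rw [b₀] at l0
    rw [b₁] at l1
    have := hbox w hw hw0 l0 l1
    rcases e₀ with rfl | rfl <;> rcases e₁ with rfl | rfl <;> (try rw [neg_neg]) <;>
      (try rw [neg_neg]) <;> tauto)
  rwa [b₀, b₁, a₀, a₁] at this

/-- For a lattice of the transversal the box of v₀ and v₁ lies in the ball of radius the first
minimum, and |v₀|₊ = |v₁|₋ makes the time of the frame zero. -/
lemma mem_transversal_iff_exists_param {Λ : LatticeSpace} :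
    Λ ∈ transversal ↔ ∃ p ∈ unitSquare, ∃ ε : ℤˣ, Λ = param p ε := by
  constructor
  · rintro ⟨v₀, h₀, v₁, h₁, -, hu, hw, he, hset⟩
    obtain ⟨M, rfl⟩ := QuotientGroup.mk_surjective Λ
    have hv₀ : ‖v₀‖ ≤ firstMinimum (toLattice M) := by
      have : v₀ ∈ ({v₀, -v₀, v₁, -v₁} : Set (Fin 2 → ℝ)) := by simp
      rw [← hset] at this
      exact this.2.2
    obtain ⟨ε, hmem, h, -, -⟩ := exists_frame_of_box h₀ h₁ (by rwa [← he]) hw (by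
      intro w hw hw0 l0 l1
      have : w ∈ ({v₀, -v₀, v₁, -v₁} : Set (Fin 2 → ℝ)) := by
        rw [← hset]
        refine ⟨hw, hw0, le_trans ?_ hv₀⟩
        rw [norm_eq_max, norm_eq_max]
        exact max_le (l0.trans (le_max_left _ _)) ((l1.trans he.le).trans (le_max_left _ _))
      simpa using this)
    refine ⟨_, hmem, ε, ?_⟩
    rw [← toLattice_frame_zero]
    refine Eq.trans h ?_
    rw [he, div_self (he ▸ (((abs_nonneg _).trans_lt hw).ne')), Real.log_one, mul_zero]
  · rintro ⟨p, hp, ε, rfl⟩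
    exact param_mem_transversal hp ε

lemma bijOn_param :
    BijOn (fun z : (ℝ × ℝ) × ℤˣ => param z.1 z.2) (unitSquare ×ˢ univ) transversal := by
  refine ⟨?_, ?_, ?_⟩
  · rintro ⟨p, ε⟩ h
    exact param_mem_transversal h.1 ε
  · rintro ⟨p, ε⟩ h ⟨p', ε'⟩ h' heq
    obtain ⟨rfl, rfl⟩ := param_injective h.1 h'.1 heq
    rfl
  · intro Λ hΛ
    obtain ⟨p, hp, ε, rfl⟩ := mem_transversal_iff_exists_param.1 hΛ
    exact ⟨(p, ε), ⟨hp, mem_univ _⟩, rfl⟩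

/-! ### The orbit of a generic lattice meets the transversal -/

/-- The entries of `M` are linearly independent over `ℤ`. -/
def IsGeneric (M : SL(2, ℝ)) : Prop :=
  ∀ k l m n : ℤ, M 0 0 * k + M 0 1 * l + M 1 0 * m + M 1 1 * n = 0 →
    k = 0 ∧ l = 0 ∧ m = 0 ∧ n = 0

lemma exists_forall_le {α : Type*} {P : α → Prop} {f : α → ℝ} (hex : ∃ z, P z)
    (hfin : ∀ C, {z | P z ∧ f z ≤ C}.Finite) : ∃ z, P z ∧ ∀ z', P z' → f z ≤ f z' := by
  obtain ⟨z₀, h₀⟩ := hex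
  obtain ⟨z, hz, hmin⟩ := Set.exists_min_image _ f (hfin (f z₀)) ⟨z₀, h₀, le_rfl⟩
  refine ⟨z, hz.1, fun z' hz' => ?_⟩
  by_cases h : f z' ≤ f z₀
  · exact hmin z' ⟨hz', h⟩
  · exact hz.2.trans (not_le.1 h).le

/-- The time `½ ln ((y + ⌊1/x⌋) / x)`. -/
def returnTimeCoord (p : ℝ × ℝ) : ℝ := 1 / 2 * Real.log ((p.2 + (⌊1 / p.1⌋ : ℝ)) / p.1)

/-- Take v₁ a shortest vector, and v₀ with the smallest horizontal part among the nonzero vectors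
strictly lower than v₁. Their box contains no other nonzero vectors up to sign. The time is
nonnegative because v₁ is shortest, and it is before the return because v₀ + ε n v₁ is not shorter
than v₁. Genericity excludes all ties. -/
lemma IsGeneric.exists_frame {M : SL(2, ℝ)} (hM : IsGeneric M) :
    ∃ p ∈ unitSquare, ∃ ε : ℤˣ, ∃ t, Int.fract (1 / p.1) ≠ 0 ∧ 0 ≤ t ∧ t < returnTimeCoord p ∧
      toLattice M = toLattice (frame t p ε) := by
  -- No nonzero vector lies on an axis, hence vectors with the same |·|₊, or the same |·|₋, agree up
  -- to sign.
  have gu : ∀ {m n : ℤ}, latticeVec M m n 0 = 0 → m = 0 ∧ n = 0 := by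
    intro m n h
    have := hM m n 0 0 (by rw [← h, latticeVec_zero]; push_cast; ring)
    exact ⟨this.1, this.2.1⟩
  have gw : ∀ {m n : ℤ}, latticeVec M m n 1 = 0 → m = 0 ∧ n = 0 := by
    intro m n h
    have := hM 0 0 m n (by rw [← h, latticeVec_one]; push_cast; ring)
    exact this.2.2
  have gu' : ∀ {m n m' n' : ℤ}, |latticeVec M m n 0| = |latticeVec M m' n' 0| →
      latticeVec M m n = latticeVec M m' n' ∨ latticeVec M m n = -latticeVec M m' n' := by
    intro m n m' n' h
    rcases abs_eq_abs.1 h with h | h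
    · left
      have := gu (m := m - m') (n := n - n') (by
        simp only [latticeVec_zero] at h ⊢; push_cast; linarith)
      rw [sub_eq_zero.1 this.1, sub_eq_zero.1 this.2]
    · right
      have := gu (m := m + m') (n := n + n') (by
        simp only [latticeVec_zero] at h ⊢; push_cast; linarith)
      rw [eq_neg_of_add_eq_zero_left this.1, eq_neg_of_add_eq_zero_left this.2, latticeVec_neg]
  have gw' : ∀ {m n m' n' : ℤ}, |latticeVec M m n 1| = |latticeVec M m' n' 1| →
      latticeVec M m n = latticeVec M m' n' ∨ latticeVec M m n = -latticeVec M m' n' := by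
    intro m n m' n' h
    rcases abs_eq_abs.1 h with h | h
    · left
      have := gw (m := m - m') (n := n - n') (by
        simp only [latticeVec_one] at h ⊢; push_cast; linarith)
      rw [sub_eq_zero.1 this.1, sub_eq_zero.1 this.2]
    · right
      have := gw (m := m + m') (n := n + n') (by
        simp only [latticeVec_one] at h ⊢; push_cast; linarith)
      rw [eq_neg_of_add_eq_zero_left this.1, eq_neg_of_add_eq_zero_left this.2, latticeVec_neg]
  -- a shortest vector
  obtain ⟨⟨m₁, n₁⟩, hz₁, hmin₁⟩ := exists_forall_le
    (P := fun z : ℤ × ℤ => latticeVec M z.1 z.2 ≠ 0) (f := fun z => ‖latticeVec M z.1 z.2‖)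
    ⟨(1, 0), by simp [latticeVec_eq_zero_iff]⟩
    (fun C => (finite_latticeVec_le M C).subset fun z hz => hz.2)
  simp only at hz₁ hmin₁
  have hw₁ : latticeVec M m₁ n₁ 1 ≠ 0 := fun h => hz₁ (latticeVec_eq_zero_iff.2 (gw h))
  set v₁ := latticeVec M m₁ n₁ with hv₁
  -- the next vector
  have hround : ∀ k l : ℤ, ∃ r : ℤ, |latticeVec M (k - r * m₁) (l - r * n₁) 1| < |v₁ 1| := by
    intro k l
    refine ⟨round (latticeVec M k l 1 / v₁ 1), ?_⟩
    have h : latticeVec M (k - round (latticeVec M k l 1 / v₁ 1) * m₁)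
        (l - round (latticeVec M k l 1 / v₁ 1) * n₁) 1
        = (latticeVec M k l 1 / v₁ 1 - round (latticeVec M k l 1 / v₁ 1)) * v₁ 1 := by
      rw [sub_mul, div_mul_cancel₀ _ hw₁]
      simp only [hv₁, latticeVec_one]
      push_cast
      ring
    rw [h, abs_mul]
    have := abs_sub_round (latticeVec M k l 1 / v₁ 1)
    nlinarith [abs_pos.2 hw₁]
  obtain ⟨⟨m₀, n₀⟩, ⟨hz₀, hlt₀⟩, hmin₀⟩ := exists_forall_le
    (P := fun z : ℤ × ℤ => latticeVec M z.1 z.2 ≠ 0 ∧ |latticeVec M z.1 z.2 1| < |v₁ 1|)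
    (f := fun z => |latticeVec M z.1 z.2 0|)
    (by
      -- If no nonzero vector were strictly lower than v₁, both basis vectors would be integer
      -- multiples of v₁, which is impossible.
      obtain ⟨r, hr⟩ := hround 1 0
      obtain ⟨s, hs⟩ := hround 0 1
      by_contra! hcon
      have c1 : latticeVec M (1 - r * m₁) (0 - r * n₁) = 0 := by
        by_contra h
        exact absurd hr (not_lt.2 (hcon (1 - r * m₁, 0 - r * n₁) h))
      have c2 : latticeVec M (0 - s * m₁) (1 - s * n₁) = 0 := by
        by_contra h
        exact absurd hs (not_lt.2 (hcon (0 - s * m₁, 1 - s * n₁) h))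
      rw [latticeVec_eq_zero_iff] at c1 c2
      have : (r * m₁) * (s * n₁) = (r * n₁) * (s * m₁) := by ring
      rw [show r * m₁ = 1 by omega, show s * n₁ = 1 by omega, show r * n₁ = 0 by omega] at this
      omega)
    (fun C => (finite_latticeVec_le M (max C |v₁ 1|)).subset fun z hz => by
      rw [mem_ofPred_eq, norm_eq_max]
      exact max_le_max hz.2 hz.1.2.le)
  simp only at hz₀ hlt₀ hmin₀
  set v₀ := latticeVec M m₀ n₀ with hv₀
  have hu : |v₁ 0| < |v₀ 0| := by
    by_contra! h
    rcases h.lt_or_eq with h | h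
    · have := hmin₁ (m₀, n₀) hz₀
      rw [norm_eq_max, norm_eq_max] at this
      exact absurd this (not_le.2 (max_lt_max h hlt₀))
    · rcases gu' h with h | h
      · rw [← hv₀, ← hv₁] at h
        rw [h] at hlt₀; exact lt_irrefl _ hlt₀
      · rw [← hv₀, ← hv₁] at h
        rw [h, Pi.neg_apply, abs_neg] at hlt₀; exact lt_irrefl _ hlt₀
  have hbox : ∀ w ∈ latticeVectors (toLattice M), w ≠ 0 → |w 0| ≤ |v₀ 0| → |w 1| ≤ |v₁ 1| →
      w = v₀ ∨ w = -v₀ ∨ w = v₁ ∨ w = -v₁ := by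
    intro w hw hw0 l0 l1
    obtain ⟨m, n, rfl⟩ := mem_latticeVectors.1 hw
    rcases l1.lt_or_eq with h | h
    · have := hmin₀ (m, n) ⟨hw0, h⟩
      have := gu' (le_antisymm l0 this)
      tauto
    · have := gw' h
      tauto
  obtain ⟨ε, hp, hΛ, f0, f1⟩ := exists_frame_of_box (latticeVec_mem M m₀ n₀) (latticeVec_mem M m₁ n₁)
    hu hlt₀ hbox
  have hu₀ : 0 < |v₀ 0| := (abs_nonneg _).trans_lt hu
  have hh₁ : 0 < |v₁ 1| := (abs_nonneg _).trans_lt hlt₀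
  have hge : |v₁ 1| ≤ |v₀ 0| := by
    have := hmin₁ (m₀, n₀) hz₀
    rw [norm_eq_max, norm_eq_max] at this
    rcases le_max_iff.1 ((le_max_right _ _).trans this) with h | h
    · exact h
    · exact absurd h (not_le.2 hlt₀)
  obtain ⟨-, e2, e3, -⟩ := frame_entries (1 / 2 * Real.log (|v₀ 0| / |v₁ 1|)) hp ε
  obtain ⟨e1, -, -, e4⟩ := frame_entries (1 / 2 * Real.log (|v₀ 0| / |v₁ 1|)) hp ε
  rw [← e1] at e2
  rw [← e4] at e3
  set t := 1 / 2 * Real.log (|v₀ 0| / |v₁ 1|) with ht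
  set x := |v₁ 0| / |v₀ 0| with hx
  set y := |v₀ 1| / |v₁ 1| with hy
  set N := frame t (x, y) ε with hN
  rw [f0] at e2
  rw [f1] at e3
  simp only at e2 e3
  obtain ⟨⟨hx0, hx1⟩, ⟨hy0, hy1⟩⟩ := id hp
  simp only at hx0 hx1 hy0 hy1
  set n := ⌊1 / x⌋ with hn
  have hxn : n * x ≤ 1 := by
    have := Int.floor_le (1 / x)
    rwa [le_div_iff₀ hx0] at this
  have hxn' : 1 - n * x < x := by
    have := Int.lt_floor_add_one (1 / x)
    rw [div_lt_iff₀ hx0] at this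
    linarith
  have hn1 : 1 ≤ n := by
    rw [hn, Int.le_floor, Int.cast_one, le_div_iff₀ hx0]
    linarith
  have hn1' : (1 : ℝ) ≤ n := by exact_mod_cast hn1
  have hv₁x : |v₁ 0| = |v₀ 0| * x := by rw [hx, mul_div_cancel₀ _ hu₀.ne']
  -- the vector `v₀ + ε n v₁`
  have hwmem : latticeVec N 1 (ε * n) ∈ latticeVectors (toLattice M) := by
    rw [hΛ]; exact latticeVec_mem _ _ _
  have hw0 : latticeVec N 1 (ε * n) ≠ 0 := by simp [latticeVec_eq_zero_iff]
  have q0 : latticeVec N 1 (ε * n) 0 = |v₀ 0| * (1 - n * x) := by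
    rw [latticeVec_zero, f0, e2]
    push_cast
    linear_combination -(|v₀ 0| * x * n) * sign_mul_self ε
  have q1 : latticeVec N 1 (ε * n) 1 = ((ε : ℤ) : ℝ) * (|v₁ 1| * (y + n)) := by
    rw [latticeVec_one, f1, e3]
    push_cast
    ring
  obtain ⟨k, l, hkl⟩ := mem_latticeVectors.1 hwmem
  have hn0 : 1 - n * x ≠ 0 := by
    intro h
    rw [h, mul_zero, hkl] at q0
    exact hw0 (hkl.trans (latticeVec_eq_zero_iff.2 (gu q0)))
  have hlt : |v₁ 0| < |v₁ 1| * (y + n) := by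
    have h1 : |latticeVec N 1 (ε * n) 1| = |v₁ 1| * (y + n) := by
      rw [q1, abs_mul, abs_sign, one_mul, abs_of_pos (mul_pos hh₁ (by linarith))]
    have h2 : |latticeVec N 1 (ε * n) 0| < |v₁ 0| := by
      rw [q0, abs_of_nonneg (mul_nonneg hu₀.le (by linarith)), hv₁x]
      exact mul_lt_mul_of_pos_left hxn' hu₀
    -- The vector has a smaller horizontal part than v₁, and it is not shorter than v₁, so its
    -- vertical part must be the large one.
    have h3 : |v₁ 0| ≤ |latticeVec N 1 (ε * n) 1| := by
      have := hmin₁ (k, l) (by rw [← hkl]; exact hw0)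
      rw [← hkl, norm_eq_max, norm_eq_max] at this
      rcases le_max_iff.1 ((le_max_left _ _).trans this) with h | h
      · linarith
      · exact h
    rw [← h1]
    -- Equality would be a nontrivial integral relation between the entries of M.
    refine lt_of_le_of_ne h3 fun h => ?_
    rw [hkl] at h
    rcases abs_eq_abs.1 h with h | h
    · have := hM m₁ n₁ (-k) (-l) (by
        rw [hv₁, latticeVec_zero, latticeVec_one] at h
        push_cast
        linarith)
      exact hz₁ (latticeVec_eq_zero_iff.2 ⟨this.1, this.2.1⟩)
    · have := hM m₁ n₁ k l (by
        rw [hv₁, latticeVec_zero, latticeVec_one] at h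
        linarith)
      exact hz₁ (latticeVec_eq_zero_iff.2 ⟨this.1, this.2.1⟩)
  refine ⟨(x, y), hp, ε, t, ?_, ?_, ?_, hΛ⟩
  · intro h
    rw [Int.fract, ← hn, sub_eq_zero, div_eq_iff hx0.ne'] at h
    exact hn0 (by linarith)
  · rw [ht]
    exact mul_nonneg (by norm_num) (Real.log_nonneg ((one_le_div hh₁).2 hge))
  · rw [ht, returnTimeCoord]
    simp only
    rw [← hn]
    refine mul_lt_mul_of_pos_left (Real.log_lt_log (div_pos hu₀ hh₁) ?_) (by norm_num)
    rw [div_lt_div_iff₀ hh₁ hx0, ← hv₁x]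
    linarith

/-! ### The first return time -/

lemma floor_nat {x : ℝ} (hx0 : 0 < x) (hx1 : x < 1) (h : Int.fract (1 / x) ≠ 0) :
    ∃ n : ℕ, 1 ≤ n ∧ (⌊1 / x⌋ : ℝ) = n ∧ n * x < 1 ∧ 1 < (n + 1) * x ∧
      Int.fract (1 / x) = 1 / x - n := by
  have h1 : 1 ≤ ⌊1 / x⌋ := by
    rw [Int.le_floor, Int.cast_one, le_div_iff₀ hx0]
    linarith
  obtain ⟨n, hn⟩ := Int.eq_ofNat_of_zero_le (zero_le_one.trans h1)
  have hf := Int.fract_nonneg (1 / x)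
  have hf1 := Int.fract_lt_one (1 / x)
  have hfr : Int.fract (1 / x) = 1 / x - n := by rw [Int.fract, hn]; simp
  refine ⟨n, by omega, by rw [hn]; simp, ?_, ?_, hfr⟩
  · have : 0 < 1 / x - n := hfr ▸ lt_of_le_of_ne hf h.symm
    have := mul_pos this hx0
    rw [sub_mul, div_mul_cancel₀ _ hx0.ne'] at this
    linarith
  · have := mul_lt_mul_of_pos_right (hfr ▸ hf1) hx0
    rw [sub_mul, div_mul_cancel₀ _ hx0.ne'] at this
    linarith

lemma gaussExt_mem {p : ℝ × ℝ} (hp : p ∈ unitSquare) (h : Int.fract (1 / p.1) ≠ 0) :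
    gaussExt p ∈ unitSquare := by
  obtain ⟨⟨hx0, hx1⟩, ⟨hy0, hy1⟩⟩ := hp
  obtain ⟨n, hn, hfl, -, -, -⟩ := floor_nat hx0 hx1 h
  have hn' : (1 : ℝ) ≤ n := by exact_mod_cast hn
  refine ⟨⟨lt_of_le_of_ne (Int.fract_nonneg _) h.symm, Int.fract_lt_one _⟩, ?_, ?_⟩
  · simp only [gaussExt, hfl]
    exact one_div_pos.2 (by linarith)
  · simp only [gaussExt, hfl]
    rw [div_lt_one (by linarith)]
    linarith

lemma returnTimeCoord_pos {p : ℝ × ℝ} (hp : p ∈ unitSquare) (h : Int.fract (1 / p.1) ≠ 0) :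
    0 < returnTimeCoord p := by
  obtain ⟨⟨hx0, hx1⟩, ⟨hy0, hy1⟩⟩ := hp
  obtain ⟨n, hn, hfl, -, -, -⟩ := floor_nat hx0 hx1 h
  have hn' : (1 : ℝ) ≤ n := by exact_mod_cast hn
  rw [returnTimeCoord, hfl]
  refine mul_pos (by norm_num) (Real.log_pos ?_)
  rw [one_lt_div hx0]
  linarith

lemma flow_returnTimeCoord {p : ℝ × ℝ} (hp : p ∈ unitSquare) (ε : ℤˣ)
    (h : Int.fract (1 / p.1) ≠ 0) :
    flow (returnTimeCoord p) • param p ε = param (gaussExt p) (-ε) := by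
  obtain ⟨x, y⟩ := p
  obtain ⟨n, hn, hfl, h1, h2, h3⟩ := floor_nat hp.1.1 hp.1.2 h
  simp only at hfl h1 h2 h3
  have := flow_smul_param_return hp ε hn h1 h2
  rw [returnTimeCoord, gaussExt]
  simp only
  rwa [hfl, h3]

lemma isLeast_visitTimes {p : ℝ × ℝ} (hp : p ∈ unitSquare) (ε : ℤˣ)
    (h : Int.fract (1 / p.1) ≠ 0) : IsLeast (visitTimes (param p ε)) (returnTimeCoord p) := by
  constructor
  · refine ⟨returnTimeCoord_pos hp h, ?_⟩
    rw [flow_returnTimeCoord hp ε h]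
    exact param_mem_transversal (gaussExt_mem hp h) _
  · rintro t ⟨ht, hmem⟩
    by_contra! hlt
    obtain ⟨x, y⟩ := p
    obtain ⟨n, hn, hfl, h1, -, -⟩ := floor_nat hp.1.1 hp.1.2 h
    rw [returnTimeCoord, hfl] at hlt
    exact notMem_transversal_of_lt hp ε hn h1 ht hlt hmem

lemma returnTime_param {p : ℝ × ℝ} (hp : p ∈ unitSquare) (ε : ℤˣ) (h : Int.fract (1 / p.1) ≠ 0) :
    returnTime (param p ε) = returnTimeCoord p := (isLeast_visitTimes hp ε h).csInf_eq

lemma returnMap_param {p : ℝ × ℝ} (hp : p ∈ unitSquare) (ε : ℤˣ) (h : Int.fract (1 / p.1) ≠ 0) :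
    returnMap (param p ε) = param (gaussExt p) (-ε) := by
  rw [returnMap, returnTime_param hp ε h, flow_returnTimeCoord hp ε h]

/-! ### The pointwise ergodic theorem -/

section Birkhoff

variable {α : Type*}

/-- The maximum of the first Birkhoff sums `S₀ = 0, …, S_n`. -/
def maxBirkhoff (T : α → α) (g : α → ℝ) : ℕ → α → ℝ
  | 0, _ => 0
  | n + 1, x => max 0 (g x + maxBirkhoff T g n (T x))

lemma maxBirkhoff_succ (T : α → α) (g : α → ℝ) (n : ℕ) (x : α) :
    maxBirkhoff T g (n + 1) x = max 0 (g x + maxBirkhoff T g n (T x)) := rfl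

lemma maxBirkhoff_nonneg (T : α → α) (g : α → ℝ) (n : ℕ) (x : α) : 0 ≤ maxBirkhoff T g n x := by
  cases n with
  | zero => exact le_rfl
  | succ n => exact le_max_left _ _

lemma maxBirkhoff_le_succ (T : α → α) (g : α → ℝ) (n : ℕ) (x : α) :
    maxBirkhoff T g n x ≤ maxBirkhoff T g (n + 1) x := by
  induction n generalizing x with
  | zero => exact maxBirkhoff_nonneg _ _ _ _
  | succ n ih =>
    rw [maxBirkhoff_succ, maxBirkhoff_succ T g (n + 1)]
    exact max_le_max le_rfl (by linarith [ih (T x)])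

lemma birkhoffSum_le_maxBirkhoff (T : α → α) (g : α → ℝ) (n : ℕ) (x : α) :
    birkhoffSum T g n x ≤ maxBirkhoff T g n x := by
  induction n generalizing x with
  | zero => simp [maxBirkhoff]
  | succ n ih =>
    rw [birkhoffSum_succ', maxBirkhoff_succ]
    exact (add_le_add_right (ih (T x)) _).trans (le_max_right _ _)

variable [MeasurableSpace α] {T : α → α} {μ : Measure α}

lemma measurable_maxBirkhoff (hT : Measurable T) {g : α → ℝ} (hg : Measurable g) (n : ℕ) :
    Measurable (maxBirkhoff T g n) := by
  induction n with
  | zero => exact measurable_const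
  | succ n ih => exact measurable_const.max (hg.add (ih.comp hT))

lemma integrable_maxBirkhoff (hT : MeasurePreserving T μ μ) {g : α → ℝ}
    (hg : Integrable g μ) (n : ℕ) : Integrable (maxBirkhoff T g n) μ := by
  induction n with
  | zero => exact integrable_zero _ _ _
  | succ n ih => exact (integrable_zero _ _ _).sup (hg.add (hT.integrable_comp_of_integrable ih))

/-- The maximal ergodic theorem. -/
lemma setIntegral_maxBirkhoff_nonneg (hT : MeasurePreserving T μ μ) {g : α → ℝ}
    (hgm : Measurable g) (hg : Integrable g μ) (n : ℕ) :
    0 ≤ ∫ x in {x | 0 < maxBirkhoff T g n x}, g x ∂μ := by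
  cases n with
  | zero => simp [maxBirkhoff]
  | succ n =>
    have hm := measurable_maxBirkhoff hT.measurable hgm (n + 1)
    have hs : MeasurableSet {x | 0 < maxBirkhoff T g (n + 1) x} :=
      measurableSet_lt measurable_const hm
    have hi := integrable_maxBirkhoff hT hg (n + 1)
    have hiT := hT.integrable_comp_of_integrable hi
    rw [← integral_indicator hs]
    -- Where the maximum M_{n+1} is positive, it equals g + Mₙ∘T ≤ g + M_{n+1}∘T; elsewhere it
    -- vanishes. The integrals of M_{n+1} and M_{n+1}∘T cancel by invariance.
    have hle : ∫ x, maxBirkhoff T g (n + 1) x ∂μ ≤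
        ∫ x, ({x | 0 < maxBirkhoff T g (n + 1) x}.indicator g x
          + (maxBirkhoff T g (n + 1) ∘ T) x) ∂μ := by
      refine integral_mono hi ((hg.indicator hs).add hiT) fun x => ?_
      by_cases hx : 0 < maxBirkhoff T g (n + 1) x
      · rw [indicator_of_mem (by exact hx)]
        have h1 : maxBirkhoff T g (n + 1) x = g x + maxBirkhoff T g n (T x) := by
          rw [maxBirkhoff_succ] at hx ⊢
          rcases lt_max_iff.1 hx with h | h
          · exact absurd h (lt_irrefl _)
          · exact max_eq_right h.le
        rw [h1]
        exact add_le_add_right (maxBirkhoff_le_succ _ _ _ _) _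
      · rw [indicator_of_notMem (by exact hx), zero_add]
        exact (not_lt.1 hx).trans (maxBirkhoff_nonneg _ _ _ _)
    rw [integral_add (hg.indicator hs) hiT,
      show ∫ x, (maxBirkhoff T g (n + 1) ∘ T) x ∂μ = ∫ x, maxBirkhoff T g (n + 1) x ∂μ by
        conv_rhs => rw [← hT.map_eq]
        rw [integral_map hT.aemeasurable hm.aestronglyMeasurable]
        rfl] at hle
    linarith

/-- The set where the maxima are unbounded is invariant, hence null or of full measure. In the
second case the sets {Mₙ > 0} exhaust the space, and the maximal inequality yields ∫ g ≥ 0 in the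
limit. -/
lemma ae_bddAbove_birkhoffSum (hT : Ergodic T μ) {g : α → ℝ}
    (hgm : Measurable g) (hg : Integrable g μ) (hneg : ∫ x, g x ∂μ < 0) :
    ∀ᵐ x ∂μ, ∃ C : ℝ, ∀ n, birkhoffSum T g n x ≤ C := by
  set E : Set α := {x | ∀ C : ℕ, ∃ n, (C : ℝ) < maxBirkhoff T g n x} with hE
  have hm := measurable_maxBirkhoff hT.measurable hgm
  have hEm : MeasurableSet E := by
    rw [hE, ofPred_forall]
    refine MeasurableSet.iInter fun C => ?_
    rw [ofPred_exists]
    exact MeasurableSet.iUnion fun n => measurableSet_lt measurable_const (hm n)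
  have hinv : T ⁻¹' E = E := by
    ext x
    constructor
    · intro h C
      obtain ⟨K, hK⟩ := exists_nat_ge (C + |g x|)
      obtain ⟨n, hn⟩ := h K
      refine ⟨n + 1, ?_⟩
      rw [maxBirkhoff_succ]
      refine lt_max_of_lt_right ?_
      have := neg_abs_le (g x)
      linarith
    · intro h C
      obtain ⟨K, hK⟩ := exists_nat_ge (C + |g x|)
      obtain ⟨n, hn⟩ := h K
      have hC : (0 : ℝ) ≤ C := Nat.cast_nonneg C
      have h0 := abs_nonneg (g x)
      have h1 := le_abs_self (g x)
      cases n with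
      | zero => exact absurd hn (not_lt.2 (by simp only [maxBirkhoff]; linarith))
      | succ n =>
        rw [maxBirkhoff_succ] at hn
        rcases lt_max_iff.1 hn with hn | hn
        · linarith
        · exact ⟨n, by linarith⟩
  have hnull : ∀ᵐ x ∂μ, x ∉ E := by
    have hc := hT.toPreErgodic.ae_empty_or_univ hEm hinv
    rcases hc with h | h
    · rwa [ae_eq_empty, measure_eq_zero_iff_ae_notMem] at h
    · exfalso
      have hmono : Monotone fun n => {x | 0 < maxBirkhoff T g n x} :=
        monotone_nat_of_le_succ fun n x hx => lt_of_lt_of_le hx (maxBirkhoff_le_succ _ _ _ _)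
      have hlim := tendsto_setIntegral_of_monotone (μ := μ) (f := g)
        (fun n => measurableSet_lt measurable_const (hm n)) hmono hg.integrableOn
      have huniv : (⋃ n, {x | 0 < maxBirkhoff T g n x} : Set α) =ᵐ[μ] univ := by
        rw [eventuallyEq_univ]
        filter_upwards [eventuallyEq_univ.1 h] with x hx
        obtain ⟨n, hn⟩ := hx 0
        exact mem_iUnion.2 ⟨n, by simpa using hn⟩
      rw [setIntegral_congr_set huniv, setIntegral_univ] at hlim
      exact absurd hneg (not_lt.2 (ge_of_tendsto' hlim fun n =>
        setIntegral_maxBirkhoff_nonneg hT.toMeasurePreserving hgm hg n))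
  filter_upwards [hnull] with x hx
  simp only [hE, mem_ofPred_eq, not_forall, not_exists, not_lt] at hx
  obtain ⟨C, hC⟩ := hx
  exact ⟨C, fun n => (birkhoffSum_le_maxBirkhoff T g n x).trans (hC n)⟩

/-- The function f - ∫ f - 1/(k + 1) has a negative integral, so its Birkhoff sums are bounded
above. -/
lemma ae_birkhoffSum_le [IsProbabilityMeasure μ] (hT : Ergodic T μ) {f : α → ℝ}
    (hfm : Measurable f) (hf : Integrable f μ) :
    ∀ᵐ x ∂μ, ∀ k : ℕ, ∃ C : ℝ, ∀ n : ℕ,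
      birkhoffSum T f n x ≤ n * (∫ x, f x ∂μ + 1 / (k + 1)) + C := by
  rw [ae_all_iff]
  intro k
  have hpos : (0 : ℝ) < 1 / (k + 1) := by positivity
  have hi : Integrable (fun x => f x - (∫ x, f x ∂μ + 1 / (k + 1))) μ :=
    hf.sub (integrable_const _)
  have := ae_bddAbove_birkhoffSum hT (hfm.sub_const (∫ x, f x ∂μ + 1 / ((k : ℝ) + 1))) hi (by
    rw [integral_sub hf (integrable_const _)]
    simp only [integral_const, probReal_univ, smul_eq_mul, one_mul]
    linarith)
  filter_upwards [this] with x hx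
  obtain ⟨C, hC⟩ := hx
  refine ⟨C, fun n => ?_⟩
  have h := hC n
  simp only [birkhoffSum, Finset.sum_sub_distrib, Finset.sum_const, Finset.card_range,
    nsmul_eq_mul] at h ⊢
  linarith

/-- **Birkhoff's ergodic theorem**, for ergodic maps. -/
theorem ae_tendsto_birkhoffSum_div [IsProbabilityMeasure μ] (hT : Ergodic T μ) {f : α → ℝ}
    (hfm : Measurable f) (hf : Integrable f μ) :
    ∀ᵐ x ∂μ, Tendsto (fun n : ℕ => birkhoffSum T f n x / n) atTop (𝓝 (∫ x, f x ∂μ)) := by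
  -- The upper bounds for f and for -f enclose the averages, and the constants disappear after
  -- division by n.
  filter_upwards [ae_birkhoffSum_le hT hfm hf, ae_birkhoffSum_le hT hfm.neg hf.neg] with x h1 h2
  rw [Metric.tendsto_atTop]
  intro ε hε
  obtain ⟨k, hk⟩ := exists_nat_one_div_lt (half_pos hε)
  obtain ⟨C, hC⟩ := h1 k
  obtain ⟨C', hC'⟩ := h2 k
  obtain ⟨N, hN⟩ := exists_nat_gt ((|C| + |C'|) / (ε / 2))
  refine ⟨N + 1, fun n hn => ?_⟩
  have hn0 : (0 : ℝ) < n := by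
    have : 0 < n := by omega
    exact_mod_cast this
  have hNn : (N : ℝ) ≤ n := by
    have : N ≤ n := by omega
    exact_mod_cast this
  rw [div_lt_iff₀ (half_pos hε)] at hN
  have hCn : |C| + |C'| < n * (ε / 2) :=
    hN.trans_le (mul_le_mul_of_nonneg_right hNn (half_pos hε).le)
  have e1 := hC n
  have e2 := hC' n
  have e3 : birkhoffSum T (-f) n x = -birkhoffSum T f n x := by
    simp [birkhoffSum]
  have e4 : ∫ x, (-f) x ∂μ = -∫ x, f x ∂μ := by
    simp [integral_neg]
  rw [e3, e4] at e2
  have a1 := le_abs_self C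
  have a2 := le_abs_self C'
  have a3 := abs_nonneg C
  have a4 := abs_nonneg C'
  have hkn : n * (1 / ((k : ℝ) + 1)) < n * (ε / 2) := mul_lt_mul_of_pos_left hk hn0
  rw [Real.dist_eq, abs_lt]
  constructor
  · rw [neg_lt_sub_iff_lt_add, ← sub_lt_iff_lt_add', lt_div_iff₀ hn0]
    nlinarith
  · rw [sub_lt_iff_lt_add, div_lt_iff₀ hn0]
    nlinarith

end Birkhoff

/-! ### The Gauss map and the planar map preserve their measures -/

lemma measurable_gaussMap : Measurable gaussMap :=
  measurable_fract.comp (measurable_const.div measurable_id)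

lemma measurable_gaussExt : Measurable gaussExt := by
  refine (measurable_gaussMap.comp measurable_fst).prodMk ?_
  refine measurable_const.div (measurable_snd.add ?_)
  exact (measurable_from_top (f := fun n : ℤ => (n : ℝ))).comp
    (Int.measurable_floor.comp (measurable_const.div measurable_fst))

lemma measurableSet_unitSquare : MeasurableSet unitSquare := measurableSet_Ioo.prod measurableSet_Ioo

lemma measurable_density :
    Measurable fun p : ℝ × ℝ => ENNReal.ofReal (1 / (1 + p.1 * p.2) ^ 2) := by fun_prop

/-- The measure of density `1 / (1 + x y)²` on the unit square. -/
def squareMeasure : Measure (ℝ × ℝ) :=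
  ((volume : Measure (ℝ × ℝ)).restrict unitSquare).withDensity
    fun p => ENNReal.ofReal (1 / (1 + p.1 * p.2) ^ 2)

lemma log_two_pos : 0 < Real.log 2 := Real.log_pos one_lt_two

lemma gaussExtMeasure_eq : gaussExtMeasure = ENNReal.ofReal (Real.log 2)⁻¹ • squareMeasure := by
  rw [gaussExtMeasure, squareMeasure, ← withDensity_smul _ measurable_density]
  congr 1
  ext p
  rw [Pi.smul_apply, smul_eq_mul, ← ENNReal.ofReal_mul (inv_pos.2 log_two_pos).le]
  congr 1
  rw [one_div, one_div, mul_inv]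

/-- The points of the unit square that the planar map sends to the unit square. -/
def regularSquare : Set (ℝ × ℝ) := {p | p ∈ unitSquare ∧ Int.fract (1 / p.1) ≠ 0}

lemma measurableSet_regularSquare : MeasurableSet regularSquare := by
  refine measurableSet_unitSquare.inter ?_
  exact (measurableSet_eq_fun (measurable_gaussMap.comp measurable_fst) measurable_const).compl

lemma countable_fract_inv_eq_zero : {x : ℝ | Int.fract (1 / x) = 0}.Countable := by
  refine (countable_range fun n : ℤ => 1 / (n : ℝ)).mono fun x hx => ?_
  rw [mem_ofPred_eq, Int.fract_eq_zero_iff] at hx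
  obtain ⟨n, hn⟩ := hx
  exact ⟨n, by simp only; rw [hn, one_div_one_div]⟩

lemma ae_fst {p : ℝ → Prop} (h : ∀ᵐ x : ℝ, p x) : ∀ᵐ z : ℝ × ℝ, p z.1 :=
  (Measure.quasiMeasurePreserving_fst (μ := (volume : Measure ℝ)) (ν := volume)).ae h

lemma ae_fract_ne_zero : ∀ᵐ x : ℝ, Int.fract (1 / x) ≠ 0 := by
  have := countable_fract_inv_eq_zero.ae_notMem (volume : Measure ℝ)
  filter_upwards [this] with x hx using hx

lemma squareMeasure_ae {P : ℝ × ℝ → Prop} (h : ∀ᵐ z : ℝ × ℝ, z ∈ unitSquare → P z) :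
    ∀ᵐ z ∂squareMeasure, P z :=
  (withDensity_absolutelyContinuous _ _).ae_le ((ae_restrict_iff' measurableSet_unitSquare).2 h)

lemma squareMeasure_ae_mem : ∀ᵐ z ∂squareMeasure, z ∈ unitSquare :=
  squareMeasure_ae (Eventually.of_forall fun _ h => h)

lemma squareMeasure_ae_regular : ∀ᵐ z ∂squareMeasure, z ∈ regularSquare :=
  squareMeasure_ae ((ae_fst ae_fract_ne_zero).mono fun _ h h' => ⟨h', h⟩)

lemma squareMeasure_apply {A : Set (ℝ × ℝ)} (hA : MeasurableSet A) :
    squareMeasure A = ∫⁻ p in A ∩ unitSquare, ENNReal.ofReal (1 / (1 + p.1 * p.2) ^ 2) := by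
  rw [squareMeasure, withDensity_apply _ hA, Measure.restrict_restrict hA]

lemma lintegral_squareMeasure {f : ℝ × ℝ → ENNReal} (hf : Measurable f) :
    ∫⁻ p, f p ∂squareMeasure
      = ∫⁻ p in unitSquare, ENNReal.ofReal (1 / (1 + p.1 * p.2) ^ 2) * f p := by
  rw [squareMeasure, lintegral_withDensity_eq_lintegral_mul _ measurable_density hf]
  rfl

/-- The density is symmetric in x and y. With it, statements about x or about T transfer to y and to
the inverse of T. -/
lemma squareMeasure_map_swap : squareMeasure.map Prod.swap = squareMeasure := by
  have hs : MeasurePreserving (Prod.swap : ℝ × ℝ → ℝ × ℝ) volume volume :=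
    Measure.measurePreserving_swap
  ext A hA
  rw [Measure.map_apply measurable_swap hA, squareMeasure_apply hA,
    squareMeasure_apply (measurable_swap hA)]
  have hpre : Prod.swap ⁻¹' A ∩ unitSquare = Prod.swap ⁻¹' (A ∩ unitSquare) := by
    ext ⟨x, y⟩
    simp [unitSquare, and_comm]
  rw [hpre, ← hs.setLIntegral_comp_preimage (hA.inter measurableSet_unitSquare) measurable_density]
  refine lintegral_congr fun p => ?_
  rw [Prod.fst_swap, Prod.snd_swap, mul_comm]

/-- The inverse of the planar map is the map itself conjugated by the exchange of coordinates: (u,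
v) comes from (1/(u + n), {1/v}) with n = ⌊1/v⌋. -/
lemma gaussExt_image : gaussExt '' regularSquare = Prod.swap ⁻¹' regularSquare := by
  ext ⟨u, v⟩
  constructor
  · rintro ⟨p, ⟨hp, hfr⟩, h⟩
    have hmem := gaussExt_mem hp hfr
    rw [h] at hmem
    refine ⟨⟨hmem.2, hmem.1⟩, ?_⟩
    rw [← h]
    simp only [gaussExt, Prod.fst_swap, one_div_one_div]
    rw [Int.fract_add_intCast, Int.fract_eq_self.2 ⟨hp.2.1.le, hp.2.2⟩]
    exact hp.2.1.ne'
  · rintro ⟨⟨hv, hu⟩, hfr⟩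
    simp only [Prod.fst_swap, Prod.snd_swap] at hu hv hfr
    obtain ⟨n, hn, hfl, h1, h2, h3⟩ := floor_nat hv.1 hv.2 hfr
    have hn' : (1 : ℝ) ≤ n := by exact_mod_cast hn
    have hfl' : ⌊u + (n : ℝ)⌋ = n := by
      rw [Int.floor_add_natCast, Int.floor_eq_zero_iff.2 ⟨hu.1.le, hu.2⟩, zero_add]
    have hfr' : Int.fract (u + (n : ℝ)) = u := by
      rw [Int.fract_add_natCast, Int.fract_eq_self.2 ⟨hu.1.le, hu.2⟩]
    refine ⟨(1 / (u + n), Int.fract (1 / v)), ⟨⟨⟨?_, ?_⟩, ⟨?_, ?_⟩⟩, ?_⟩, ?_⟩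
    · exact one_div_pos.2 (by linarith [hu.1])
    · rw [div_lt_one (by linarith [hu.1])]
      linarith [hu.1]
    · exact lt_of_le_of_ne (Int.fract_nonneg _) (Ne.symm hfr)
    · exact Int.fract_lt_one _
    · simp only [one_div_one_div]
      rw [hfr']
      exact hu.1.ne'
    · simp only [gaussExt, one_div_one_div]
      rw [hfr', hfl', h3]
      simp

/-- The digit n is recovered from the image as the integer part of y + n, the inverse of its second
coordinate. -/
lemma gaussExt_injOn : InjOn gaussExt regularSquare := by
  rintro ⟨x, y⟩ ⟨hp, hfr⟩ ⟨x', y'⟩ ⟨hp', hfr'⟩ h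
  obtain ⟨n, hn, hfl, -, -, h3⟩ := floor_nat hp.1.1 hp.1.2 hfr
  obtain ⟨n', hn', hfl', -, -, h3'⟩ := floor_nat hp'.1.1 hp'.1.2 hfr'
  simp only [gaussExt, Prod.mk.injEq, one_div, inv_inj] at h
  simp only [one_div] at hfl hfl' h3 h3'
  rw [hfl, hfl'] at h
  have e1 := congr_arg Int.floor h.2
  rw [Int.floor_add_natCast, Int.floor_add_natCast, Int.floor_eq_zero_iff.2 ⟨hp.2.1.le, hp.2.2⟩,
    Int.floor_eq_zero_iff.2 ⟨hp'.2.1.le, hp'.2.2⟩, zero_add, zero_add] at e1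
  have e2 : (n : ℝ) = n' := by exact_mod_cast e1
  ext
  · have := h.1
    rw [h3, h3', e2] at this
    simpa using this
  · have := h.2
    rw [e2] at this
    simpa using this

/-- The derivative of the planar map. -/
def gaussExtDeriv (p : ℝ × ℝ) : ℝ × ℝ →L[ℝ] ℝ × ℝ :=
  ((-(p.1 ^ 2)⁻¹) • ContinuousLinearMap.id ℝ ℝ).prodMap
    ((-((p.2 + (⌊1 / p.1⌋ : ℝ)) ^ 2)⁻¹) • ContinuousLinearMap.id ℝ ℝ)

lemma det_gaussExtDeriv (p : ℝ × ℝ) :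
    (gaussExtDeriv p).det = (p.1 ^ 2)⁻¹ * ((p.2 + (⌊1 / p.1⌋ : ℝ)) ^ 2)⁻¹ := by
  have : ((gaussExtDeriv p : ℝ × ℝ →L[ℝ] ℝ × ℝ) : ℝ × ℝ →ₗ[ℝ] ℝ × ℝ) =
    LinearMap.prodMap ((-(p.1 ^ 2)⁻¹) • LinearMap.id)
      ((-((p.2 + (⌊1 / p.1⌋ : ℝ)) ^ 2)⁻¹) • LinearMap.id) := rfl
  rw [ContinuousLinearMap.det, this, LinearMap.det_prodMap, LinearMap.det_smul, LinearMap.det_smul]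
  simp

lemma hasFDerivAt_gaussExt {p : ℝ × ℝ} (hp : p ∈ regularSquare) :
    HasFDerivAt gaussExt (gaussExtDeriv p) p := by
  obtain ⟨hp, hfr⟩ := hp
  obtain ⟨n, hn, hfl, h1, h2, h3⟩ := floor_nat hp.1.1 hp.1.2 hfr
  have hn' : (1 : ℝ) ≤ n := by exact_mod_cast hn
  have hx0 := hp.1.1
  have hd1 : HasDerivAt (fun x : ℝ => x⁻¹ - n) (-(p.1 ^ 2)⁻¹) p.1 :=
    (hasDerivAt_inv hx0.ne').sub_const _
  have hd2 : HasDerivAt (fun y : ℝ => (y + n)⁻¹) (-((p.2 + n) ^ 2)⁻¹) p.2 := by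
    have hne : p.2 + n ≠ 0 := by linarith [hp.2.1]
    have := (hasDerivAt_inv hne).comp p.2 ((hasDerivAt_id p.2).add_const (n : ℝ))
    simpa [Function.comp_def] using this
  have key : HasFDerivAt (Prod.map (fun x : ℝ => x⁻¹ - n) fun y : ℝ => (y + n)⁻¹)
      (gaussExtDeriv p) p := by
    have := HasFDerivAt.prodMap p hd1.hasFDerivAt hd2.hasFDerivAt
    convert this using 1
    rw [gaussExtDeriv, hfl]
    congr 1 <;> ext <;> simp
  refine key.congr_of_eventuallyEq ?_
  have hopen : {q : ℝ × ℝ | 0 < q.1 ∧ n * q.1 < 1 ∧ 1 < (n + 1) * q.1} ∈ 𝓝 p := by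
    refine IsOpen.mem_nhds ?_ ⟨hx0, h1, h2⟩
    have c1 : Continuous fun q : ℝ × ℝ => n * q.1 := by fun_prop
    have c2 : Continuous fun q : ℝ × ℝ => (n + 1 : ℝ) * q.1 := by fun_prop
    exact (isOpen_lt continuous_const continuous_fst).inter
      ((isOpen_lt c1 continuous_const).inter (isOpen_lt continuous_const c2))
  filter_upwards [hopen] with q ⟨q0, q1, q2⟩
  have hfl' : ⌊1 / q.1⌋ = n := by
    rw [Int.floor_eq_iff, le_div_iff₀ q0, div_lt_iff₀ q0]
    push_cast
    exact ⟨q1.le, q2⟩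
  simp [gaussExt, Int.fract, ← one_div, hfl', Prod.map]

/-- With (x', y') the image, 1 + x'y' = (1 + xy)/(x(y + n)), and the Jacobian is 1/(x(y + n))². The
two factors cancel. -/
lemma gaussExt_density {p : ℝ × ℝ} (hp : p ∈ regularSquare) :
    |(gaussExtDeriv p).det| * (1 / (1 + (gaussExt p).1 * (gaussExt p).2) ^ 2)
      = 1 / (1 + p.1 * p.2) ^ 2 := by
  obtain ⟨hp, hfr⟩ := hp
  obtain ⟨n, hn, hfl, h1, h2, h3⟩ := floor_nat hp.1.1 hp.1.2 hfr
  have hn' : (1 : ℝ) ≤ n := by exact_mod_cast hn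
  have hx0 := hp.1.1
  have hy0 := hp.2.1
  have hyn : 0 < p.2 + n := by linarith
  have hxy := one_add_mul_pos hp
  have e : 1 + (1 / p.1 - n) * (1 / (p.2 + n)) = (1 + p.1 * p.2) / (p.1 * (p.2 + n)) := by
    field_simp
    ring
  rw [det_gaussExtDeriv, hfl, gaussExt, hfl]
  simp only
  rw [h3, e, abs_of_nonneg (by positivity)]
  field_simp

/-- Change of variables on the regular points, where the map is injective. Their image also has full
measure, by the symmetry of the density. -/
lemma measurePreserving_gaussExt_square :
    MeasurePreserving gaussExt squareMeasure squareMeasure := by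
  refine ⟨measurable_gaussExt, ?_⟩
  ext A hA
  have hreg : ∀ B : Set (ℝ × ℝ), squareMeasure B = squareMeasure (B ∩ regularSquare) := by
    intro B
    refine measure_congr ?_
    filter_upwards [squareMeasure_ae_regular] with z hz
    exact propext ⟨fun h => ⟨h, hz⟩, fun h => h.1⟩
  have hreg' : squareMeasure A = squareMeasure (A ∩ Prod.swap ⁻¹' regularSquare) := by
    refine measure_congr ?_
    have : ∀ᵐ z ∂squareMeasure, z.swap ∈ regularSquare := by
      have h := squareMeasure_ae_regular
      rw [← squareMeasure_map_swap] at h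
      exact ae_of_ae_map measurable_swap.aemeasurable h
    filter_upwards [this] with z hz
    exact propext ⟨fun h => ⟨h, hz⟩, fun h => h.1⟩
  have hsub : regularSquare ⊆ unitSquare := fun _ h => h.1
  have hsub' : Prod.swap ⁻¹' regularSquare ⊆ unitSquare := fun _ h => ⟨h.1.2, h.1.1⟩
  have hm : MeasurableSet (gaussExt ⁻¹' A ∩ regularSquare) :=
    (measurable_gaussExt hA).inter measurableSet_regularSquare
  rw [Measure.map_apply measurable_gaussExt hA, hreg, squareMeasure_apply hm,
    inter_eq_left.2 (inter_subset_right.trans hsub), hreg',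
    squareMeasure_apply (hA.inter (measurable_swap measurableSet_regularSquare)),
    inter_eq_left.2 (inter_subset_right.trans hsub')]
  have himg : A ∩ Prod.swap ⁻¹' regularSquare = gaussExt '' (gaussExt ⁻¹' A ∩ regularSquare) := by
    rw [← gaussExt_image, inter_comm (gaussExt ⁻¹' A), image_inter_preimage, inter_comm]
  rw [himg, lintegral_image_eq_lintegral_abs_det_fderiv_mul volume hm
    (fun p hp => (hasFDerivAt_gaussExt hp.2).hasFDerivWithinAt)
    (gaussExt_injOn.mono inter_subset_right)]
  refine setLIntegral_congr_fun hm fun p hp => ?_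
  rw [← gaussExt_density hp.2, ENNReal.ofReal_mul (abs_nonneg _)]

/-! ### Marginals and total masses. -/

lemma setLIntegral_density {x : ℝ} (hx : 0 < x) :
    ∫⁻ y in Ioo (0 : ℝ) 1, ENNReal.ofReal (1 / (1 + x * y) ^ 2) = ENNReal.ofReal (1 / (1 + x)) := by
  have hd : ∀ y ∈ uIcc (0 : ℝ) 1, HasDerivAt (fun y => y / (1 + x * y)) (1 / (1 + x * y) ^ 2) y := by
    intro y hy
    rw [uIcc_of_le zero_le_one] at hy
    have hne : 1 + x * y ≠ 0 := by nlinarith [mul_nonneg hx.le hy.1]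
    have := (hasDerivAt_id y).div (((hasDerivAt_id y).const_mul x).const_add 1) hne
    refine this.congr_deriv ?_
    rw [id_eq]
    congr 1
    ring
  have hcont : ContinuousOn (fun y : ℝ => 1 / (1 + x * y) ^ 2) (Icc 0 1) := by
    refine ContinuousOn.div continuousOn_const (by fun_prop) fun y hy => ?_
    have : 0 < 1 + x * y := by nlinarith [mul_nonneg hx.le hy.1]
    positivity
  have hint : IntervalIntegrable (fun y : ℝ => 1 / (1 + x * y) ^ 2) volume 0 1 := by
    refine ContinuousOn.intervalIntegrable ?_
    rwa [uIcc_of_le zero_le_one]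
  have h1 := intervalIntegral.integral_eq_sub_of_hasDerivAt hd hint
  rw [intervalIntegral.integral_of_le zero_le_one, integral_Ioc_eq_integral_Ioo] at h1
  rw [← ofReal_integral_eq_lintegral_ofReal, h1]
  · simp
  · exact (hcont.integrableOn_Icc).mono_set Ioo_subset_Icc_self
  · exact Eventually.of_forall fun y => by positivity

lemma squareMeasure_map_fst : squareMeasure.map Prod.fst =
    ((volume : Measure ℝ).restrict (Ioo 0 1)).withDensity fun x => ENNReal.ofReal (1 / (1 + x)) := by
  ext A hA
  rw [Measure.map_apply measurable_fst hA, squareMeasure_apply (measurable_fst hA),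
    withDensity_apply _ hA, Measure.restrict_restrict hA]
  have : (Prod.fst ⁻¹' A ∩ unitSquare : Set (ℝ × ℝ)) = (A ∩ Ioo 0 1) ×ˢ Ioo 0 1 := by
    ext ⟨x, y⟩
    simp [unitSquare]
    tauto
  rw [this, Measure.volume_eq_prod, ← Measure.prod_restrict,
    lintegral_prod _ measurable_density.aemeasurable]
  refine setLIntegral_congr_fun (hA.inter measurableSet_Ioo) fun x hx => ?_
  exact setLIntegral_density hx.2.1

lemma gaussMeasure_eq : gaussMeasure = ENNReal.ofReal (Real.log 2)⁻¹ •
    ((volume : Measure ℝ).restrict (Ioo 0 1)).withDensity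
      fun x => ENNReal.ofReal (1 / (1 + x)) := by
  rw [gaussMeasure, ← withDensity_smul _ (by fun_prop)]
  congr 1
  ext p
  rw [Pi.smul_apply, smul_eq_mul, ← ENNReal.ofReal_mul (inv_pos.2 log_two_pos).le]
  congr 1
  rw [one_div, one_div, mul_inv]

lemma measurePreserving_fst : MeasurePreserving Prod.fst gaussExtMeasure gaussMeasure := by
  refine ⟨measurable_fst, ?_⟩
  rw [gaussExtMeasure_eq, gaussMeasure_eq, Measure.map_smul, squareMeasure_map_fst]

lemma measurePreserving_gaussExt : MeasurePreserving gaussExt gaussExtMeasure gaussExtMeasure := by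
  refine ⟨measurable_gaussExt, ?_⟩
  rw [gaussExtMeasure_eq, Measure.map_smul, measurePreserving_gaussExt_square.map_eq]

/-- The Gauss map is a factor of the planar map and its measure is the corresponding marginal, so
the invariance is inherited. -/
lemma measurePreserving_gaussMap : MeasurePreserving gaussMap gaussMeasure gaussMeasure := by
  refine ⟨measurable_gaussMap, ?_⟩
  conv_lhs => rw [← measurePreserving_fst.map_eq]
  rw [Measure.map_map measurable_gaussMap measurable_fst,
    show gaussMap ∘ Prod.fst = Prod.fst ∘ gaussExt from rfl,
    ← Measure.map_map measurable_fst measurable_gaussExt, measurePreserving_gaussExt.map_eq,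
    measurePreserving_fst.map_eq]

lemma gaussMeasure_univ : gaussMeasure univ = 1 := by
  have hd : ∀ y ∈ uIcc (0 : ℝ) 1, HasDerivAt (fun y => Real.log (1 + y)) (1 / (1 + y)) y := by
    intro y hy
    rw [uIcc_of_le zero_le_one] at hy
    exact ((hasDerivAt_id y).const_add 1).log (by simp only [id]; linarith [hy.1])
  have hcont : ContinuousOn (fun y : ℝ => 1 / (1 + y)) (Icc 0 1) := by
    refine ContinuousOn.div continuousOn_const (by fun_prop) fun y hy => ?_
    linarith [hy.1]
  have hint : IntervalIntegrable (fun y : ℝ => 1 / (1 + y)) volume 0 1 := by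
    refine ContinuousOn.intervalIntegrable ?_
    rwa [uIcc_of_le zero_le_one]
  have h1 := intervalIntegral.integral_eq_sub_of_hasDerivAt hd hint
  rw [intervalIntegral.integral_of_le zero_le_one, integral_Ioc_eq_integral_Ioo] at h1
  rw [gaussMeasure_eq, Measure.smul_apply, withDensity_apply _ MeasurableSet.univ,
    Measure.restrict_univ, ← ofReal_integral_eq_lintegral_ofReal, h1, smul_eq_mul,
    ← ENNReal.ofReal_mul (inv_pos.2 log_two_pos).le]
  · norm_num
  · exact (hcont.integrableOn_Icc).mono_set Ioo_subset_Icc_self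
  · refine (ae_restrict_iff' measurableSet_Ioo).2 (Eventually.of_forall fun y hy => ?_)
    have := hy.1
    positivity

instance : IsProbabilityMeasure gaussMeasure := ⟨gaussMeasure_univ⟩

lemma gaussExtMeasure_univ : gaussExtMeasure univ = 1 := by
  rw [← gaussMeasure_univ, ← measurePreserving_fst.map_eq,
    Measure.map_apply measurable_fst MeasurableSet.univ, preimage_univ]

lemma squareMeasure_univ : squareMeasure univ = ENNReal.ofReal (Real.log 2) := by
  have h := gaussExtMeasure_univ
  rw [gaussExtMeasure_eq, Measure.smul_apply, smul_eq_mul] at h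
  have h2 := congr_arg (fun z => ENNReal.ofReal (Real.log 2) * z) h
  rw [← mul_assoc, ← ENNReal.ofReal_mul log_two_pos.le, mul_inv_cancel₀ log_two_pos.ne',
    ENNReal.ofReal_one, one_mul, mul_one] at h2
  exact h2

instance : IsFiniteMeasure squareMeasure := ⟨by rw [squareMeasure_univ]; exact ENNReal.ofReal_lt_top⟩

/-! ### The integral of the logarithm -/

lemma integrableOn_integral_pow_mul_log (n : ℕ) :
    IntegrableOn (fun x : ℝ => x ^ n * -Real.log x) (Ioc 0 1) ∧
    ∫ x in Ioc (0 : ℝ) 1, x ^ n * -Real.log x = 1 / ((n : ℝ) + 1) ^ 2 := by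
  have hn : (n : ℝ) + 1 ≠ 0 := by positivity
  -- The primitive is written with x ln x, which is continuous at 0, so that it can be evaluated at
  -- the endpoint even for n = 0.
  set g : ℝ → ℝ := fun x => x ^ (n + 1) / (n + 1) ^ 2 - x ^ n * (x * Real.log x) / (n + 1) with hg
  have hcont : ContinuousOn g (Icc 0 1) := by
    refine Continuous.continuousOn ?_
    have := Real.continuous_mul_log
    fun_prop
  have hderiv : ∀ x ∈ Ioo (0 : ℝ) 1, HasDerivAt g (x ^ n * -Real.log x) x := by
    intro x hx
    have h1 := ((hasDerivAt_pow (n + 1) x).div_const (((n : ℝ) + 1) ^ 2))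
    have h2 := (((hasDerivAt_pow (n + 1) x).mul (Real.hasDerivAt_log hx.1.ne')).div_const
      ((n : ℝ) + 1))
    have h3 := h1.sub h2
    have hfun : g = (fun x : ℝ => x ^ (n + 1) / ((n : ℝ) + 1) ^ 2)
        - fun x : ℝ => ((fun x : ℝ => x ^ (n + 1)) * Real.log) x / ((n : ℝ) + 1) := by
      ext y
      simp only [hg, Pi.sub_apply, Pi.mul_apply]
      ring
    rw [hfun]
    refine h3.congr_deriv ?_
    have hx0 := hx.1.ne'
    rw [Nat.add_sub_cancel]
    push_cast
    field_simp
    ring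
  have hint : IntegrableOn (fun x : ℝ => x ^ n * -Real.log x) (Ioc 0 1) :=
    intervalIntegral.integrableOn_deriv_of_nonneg hcont hderiv fun x hx =>
      mul_nonneg (pow_nonneg hx.1.le _) (neg_nonneg.2 (Real.log_nonpos hx.1.le hx.2.le))
  refine ⟨hint, ?_⟩
  rw [← intervalIntegral.integral_of_le zero_le_one,
    intervalIntegral.integral_eq_sub_of_hasDerivAt_of_le zero_le_one hcont hderiv
      ((intervalIntegrable_iff_integrableOn_Ioc_of_le zero_le_one).2 hint)]
  simp [hg]

lemma hasSum_of_eq {f g : ℕ → ℝ} {a b : ℝ} (h : HasSum f a) (hf : ∀ k, f k = g k) (hab : a = b) :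
    HasSum g b := by
  rw [← hab, ← funext hf]
  exact h

/-- The even terms of ζ(2) sum to ζ(2)/4 = π²/24 and the odd ones to the rest, so odd minus even is
π²/12. -/
lemma hasSum_alternating :
    HasSum (fun k : ℕ => 1 / ((2 * k : ℕ) + 1 : ℝ) ^ 2 - 1 / ((2 * k + 1 : ℕ) + 1 : ℝ) ^ 2)
      (Real.pi ^ 2 / 12) := by
  have h := hasSum_zeta_two
  have heven : HasSum (fun k : ℕ => 1 / ((2 * k : ℕ) : ℝ) ^ 2) (Real.pi ^ 2 / 24) := by
    refine hasSum_of_eq (h.mul_left (1 / 4 : ℝ)) (fun k => ?_) (by ring)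
    push_cast
    rw [mul_pow, one_div_mul_one_div]
    norm_num
  have hodd_summable : Summable fun k : ℕ => 1 / ((2 * k + 1 : ℕ) : ℝ) ^ 2 :=
    h.summable.comp_injective (i := fun k : ℕ => 2 * k + 1) fun a b hab => by simpa using hab
  have hodd : HasSum (fun k : ℕ => 1 / ((2 * k + 1 : ℕ) : ℝ) ^ 2)
      (Real.pi ^ 2 / 6 - Real.pi ^ 2 / 24) := by
    obtain ⟨s, hs⟩ := hodd_summable
    have := (HasSum.even_add_odd (f := fun n : ℕ => 1 / (n : ℝ) ^ 2) heven hs).unique h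
    rwa [← this, add_sub_cancel_left]
  have hshift : HasSum (fun k : ℕ => 1 / ((2 * (k + 1) : ℕ) : ℝ) ^ 2) (Real.pi ^ 2 / 24) := by
    have := (hasSum_nat_add_iff' (f := fun k : ℕ => 1 / ((2 * k : ℕ) : ℝ) ^ 2) 1).2 heven
    simpa using this
  refine hasSum_of_eq (hodd.sub hshift) (fun k => ?_) (by ring)
  push_cast
  ring

/-- Expand 1/(1 + x) in its geometric series and integrate term by term. Consecutive terms are
grouped in pairs to make the summands nonnegative, so that no domination is needed. -/
lemma lintegral_neg_log :
    ∫⁻ x in Ioo (0 : ℝ) 1, ENNReal.ofReal (1 / (1 + x)) * ENNReal.ofReal (-Real.log x)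
      = ENNReal.ofReal (Real.pi ^ 2 / 12) := by
  have hpt : ∀ x ∈ Ioo (0 : ℝ) 1,
      ENNReal.ofReal (1 / (1 + x)) * ENNReal.ofReal (-Real.log x) =
      ∑' k : ℕ, ENNReal.ofReal (x ^ (2 * k) * -Real.log x - x ^ (2 * k + 1) * -Real.log x) := by
    intro x hx
    have hlog : 0 ≤ -Real.log x := neg_nonneg.2 (Real.log_nonpos hx.1.le hx.2.le)
    have hx2 : x ^ 2 < 1 := by nlinarith [hx.1, hx.2]
    have hs : HasSum (fun k : ℕ => x ^ (2 * k) * -Real.log x - x ^ (2 * k + 1) * -Real.log x)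
        (1 / (1 + x) * -Real.log x) := by
      refine hasSum_of_eq ((hasSum_geometric_of_lt_one (sq_nonneg x) hx2).mul_right
        ((1 - x) * -Real.log x)) (fun k => ?_) ?_
      · rw [← pow_mul, pow_succ]
        ring
      · have h1 : 1 + x ≠ 0 := by linarith [hx.1]
        have h2 : 1 - x ≠ 0 := by linarith [hx.2]
        have h3 : 1 - x ^ 2 = (1 + x) * (1 - x) := by ring
        rw [h3, mul_inv]
        field_simp
    rw [← ENNReal.ofReal_mul (one_div_nonneg.2 (by linarith [hx.1])), ← hs.tsum_eq,
      ENNReal.ofReal_tsum_of_nonneg _ hs.summable]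
    intro k
    rw [← sub_mul, pow_succ]
    refine mul_nonneg ?_ hlog
    nlinarith [pow_nonneg hx.1.le (2 * k), hx.2]
  rw [setLIntegral_congr_fun measurableSet_Ioo hpt, lintegral_tsum (fun k => by fun_prop)]
  have hterm : ∀ k : ℕ,
      ∫⁻ x in Ioo (0 : ℝ) 1,
        ENNReal.ofReal (x ^ (2 * k) * -Real.log x - x ^ (2 * k + 1) * -Real.log x) =
      ENNReal.ofReal (1 / ((2 * k : ℕ) + 1 : ℝ) ^ 2 - 1 / ((2 * k + 1 : ℕ) + 1 : ℝ) ^ 2) := by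
    intro k
    obtain ⟨i1, e1⟩ := integrableOn_integral_pow_mul_log (2 * k)
    obtain ⟨i2, e2⟩ := integrableOn_integral_pow_mul_log (2 * k + 1)
    have i3 : IntegrableOn (fun x : ℝ => x ^ (2 * k) * -Real.log x - x ^ (2 * k + 1) * -Real.log x)
      (Ioc 0 1) := i1.sub i2
    rw [← e1, ← e2, ← integral_sub i1 i2, ofReal_integral_eq_lintegral_ofReal i3,
      setLIntegral_congr Ioo_ae_eq_Ioc]
    refine (ae_restrict_iff' measurableSet_Ioc).2 (Eventually.of_forall fun x hx => ?_)
    have hlog : 0 ≤ -Real.log x := neg_nonneg.2 (Real.log_nonpos hx.1.le hx.2)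
    change 0 ≤ x ^ (2 * k) * -Real.log x - x ^ (2 * k + 1) * -Real.log x
    rw [← sub_mul, pow_succ]
    refine mul_nonneg ?_ hlog
    nlinarith [pow_nonneg hx.1.le (2 * k), hx.2]
  rw [tsum_congr hterm, ← ENNReal.ofReal_tsum_of_nonneg _ hasSum_alternating.summable,
    hasSum_alternating.tsum_eq]
  intro k
  rw [sub_nonneg]
  refine one_div_le_one_div_of_le (by positivity) ?_
  push_cast
  gcongr
  linarith

lemma lintegral_neg_log_fst :
    ∫⁻ p, ENNReal.ofReal (-Real.log p.1) ∂squareMeasure = ENNReal.ofReal (Real.pi ^ 2 / 12) := by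
  have hm : Measurable fun x : ℝ => ENNReal.ofReal (-Real.log x) := by fun_prop
  rw [← lintegral_map (f := fun x : ℝ => ENNReal.ofReal (-Real.log x)) hm measurable_fst,
    squareMeasure_map_fst, lintegral_withDensity_eq_lintegral_mul _ (by fun_prop) hm,
    ← lintegral_neg_log]
  rfl

lemma lintegral_neg_log_snd :
    ∫⁻ p, ENNReal.ofReal (-Real.log p.2) ∂squareMeasure = ENNReal.ofReal (Real.pi ^ 2 / 12) := by
  rw [← lintegral_neg_log_fst]
  conv_rhs => rw [← squareMeasure_map_swap]
  rw [lintegral_map (by fun_prop) measurable_swap]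
  rfl

/-! ### The mean return time and the mean of -ln. -/

lemma measurable_returnTimeCoord : Measurable returnTimeCoord := by
  refine measurable_const.mul (Real.measurable_log.comp (Measurable.div ?_ measurable_fst))
  exact measurable_snd.add ((measurable_from_top (f := fun n : ℤ => (n : ℝ))).comp
    (Int.measurable_floor.comp (measurable_const.div measurable_fst)))

/-- The second coordinate of T(p) is 1/(y + n), so twice the return time is -ln y∘T - ln x. The
invariance under T and the symmetry of the density give both terms the same integral. -/
lemma lintegral_returnTimeCoord :
    ∫⁻ p, ENNReal.ofReal (returnTimeCoord p) ∂squareMeasure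
      = ENNReal.ofReal (Real.pi ^ 2 / 12) := by
  have hpt : ∀ᵐ p ∂squareMeasure, ENNReal.ofReal (returnTimeCoord p) =
      ENNReal.ofReal (1 / 2) * (ENNReal.ofReal (-Real.log (gaussExt p).2)
        + ENNReal.ofReal (-Real.log p.1)) := by
    filter_upwards [squareMeasure_ae_regular] with p hp
    obtain ⟨hp, hfr⟩ := hp
    have h2 := gaussExt_mem hp hfr
    rw [← ENNReal.ofReal_add (neg_nonneg.2 (Real.log_nonpos h2.2.1.le h2.2.2.le))
      (neg_nonneg.2 (Real.log_nonpos hp.1.1.le hp.1.2.le)), ← ENNReal.ofReal_mul (by norm_num)]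
    have h3 : 0 < p.2 + (⌊1 / p.1⌋ : ℝ) := by
      have := h2.2.1
      simp only [gaussExt] at this
      exact one_div_pos.1 this
    rw [returnTimeCoord, gaussExt, Real.log_div h3.ne' hp.1.1.ne', one_div (p.2 + _),
      Real.log_inv, neg_neg, sub_eq_add_neg]
  have hm : Measurable fun p : ℝ × ℝ => ENNReal.ofReal (-Real.log p.2) := by fun_prop
  have hm' : Measurable fun p : ℝ × ℝ => ENNReal.ofReal (-Real.log (gaussExt p).2) :=
    hm.comp measurable_gaussExt
  rw [lintegral_congr_ae hpt, lintegral_const_mul _ (by fun_prop), lintegral_add_right _ (by fun_prop),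
    measurePreserving_gaussExt_square.lintegral_comp hm, lintegral_neg_log_fst,
    lintegral_neg_log_snd, ← ENNReal.ofReal_add (by positivity) (by positivity),
    ← ENNReal.ofReal_mul (by norm_num)]
  congr 1
  ring

lemma lintegral_neg_log_gaussMeasure :
    ∫⁻ x, ENNReal.ofReal (-Real.log x) ∂gaussMeasure
      = ENNReal.ofReal (Real.pi ^ 2 / (12 * Real.log 2)) := by
  rw [gaussMeasure_eq, lintegral_smul_measure,
    lintegral_withDensity_eq_lintegral_mul _ (by fun_prop) (by fun_prop)]
  change _ • ∫⁻ x in Ioo (0 : ℝ) 1, ENNReal.ofReal (1 / (1 + x)) * ENNReal.ofReal (-Real.log x) = _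
  rw [lintegral_neg_log, smul_eq_mul, ← ENNReal.ofReal_mul (inv_pos.2 log_two_pos).le]
  congr 1
  have := log_two_pos.ne'
  field_simp

lemma gaussMeasure_absolutelyContinuous :
    gaussMeasure ≪ (volume : Measure ℝ).restrict (Ioo 0 1) :=
  withDensity_absolutelyContinuous _ _

lemma gaussMeasure_ae_mem : ∀ᵐ x ∂gaussMeasure, x ∈ Ioo (0 : ℝ) 1 :=
  gaussMeasure_absolutelyContinuous.ae_le (ae_restrict_mem measurableSet_Ioo)

lemma absolutelyContinuous_gaussMeasure :
    (volume : Measure ℝ).restrict (Ioo 0 1) ≪ gaussMeasure := by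
  refine withDensity_absolutelyContinuous' (Measurable.aemeasurable (by fun_prop)) ?_
  refine (ae_restrict_iff' measurableSet_Ioo).2 (Eventually.of_forall fun y hy => ?_)
  have := log_two_pos
  have := hy.1
  exact (ENNReal.ofReal_pos.2 (by positivity)).ne'

lemma neg_log_ae_nonneg : 0 ≤ᵐ[gaussMeasure] fun x => -Real.log x := by
  filter_upwards [gaussMeasure_ae_mem] with x hx
  exact neg_nonneg.2 (Real.log_nonpos hx.1.le hx.2.le)

lemma integrable_neg_log : Integrable (fun x => -Real.log x) gaussMeasure := by
  refine ⟨Measurable.aestronglyMeasurable (by fun_prop), ?_⟩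
  rw [hasFiniteIntegral_iff_ofReal neg_log_ae_nonneg, lintegral_neg_log_gaussMeasure]
  exact ENNReal.ofReal_lt_top

lemma integral_neg_log :
    ∫ x, -Real.log x ∂gaussMeasure = Real.pi ^ 2 / (12 * Real.log 2) := by
  rw [integral_eq_lintegral_of_nonneg_ae neg_log_ae_nonneg
    (Measurable.aestronglyMeasurable (by fun_prop)), lintegral_neg_log_gaussMeasure,
    ENNReal.toReal_ofReal]
  have := log_two_pos
  positivity

/-! ### Continued fractions -/

/-- The denominators `0, 1, a₀, …` of the continued fraction with digits `a`. -/
def contDen (a : ℕ → ℤ) : ℕ → ℤ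
  | 0 => 0
  | 1 => 1
  | n + 2 => a n * contDen a (n + 1) + contDen a n

/-- The numerators `1, 0, 1, …` of the continued fraction with digits `a`. -/
def contNum (a : ℕ → ℤ) : ℕ → ℤ
  | 0 => 1
  | 1 => 0
  | n + 2 => a n * contNum a (n + 1) + contNum a n

/-- The number `1 / (a₀ + 1 / (a₁ + ⋯ 1 / (a_{n-1} + t)))`. -/
def branch (a : ℕ → ℤ) : ℕ → ℝ → ℝ
  | 0, t => t
  | n + 1, t => branch a n (1 / (a n + t))

lemma contDen_succ_succ (a : ℕ → ℤ) (n : ℕ) :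
    contDen a (n + 2) = a n * contDen a (n + 1) + contDen a n := rfl

lemma contNum_succ_succ (a : ℕ → ℤ) (n : ℕ) :
    contNum a (n + 2) = a n * contNum a (n + 1) + contNum a n := rfl

lemma cont_det (a : ℕ → ℤ) (n : ℕ) :
    contNum a n * contDen a (n + 1) - contNum a (n + 1) * contDen a n = (-1) ^ n := by
  induction n with
  | zero => simp [contNum, contDen]
  | succ n ih =>
    rw [contDen_succ_succ, contNum_succ_succ, pow_succ]
    linear_combination -ih

section Digits

variable {a : ℕ → ℤ}

lemma contDen_bounds (ha : ∀ n, 1 ≤ a n) (n : ℕ) : 0 ≤ contDen a n ∧ 1 ≤ contDen a (n + 1) := by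
  induction n with
  | zero => simp [contDen]
  | succ n ih =>
    refine ⟨by linarith [ih.2], ?_⟩
    rw [contDen_succ_succ]
    nlinarith [ha n, ih.1, ih.2]

lemma contDen_add_le (ha : ∀ n, 1 ≤ a n) (n : ℕ) : contDen a (n + 1) + contDen a n ≤ contDen a (n + 2) := by
  rw [contDen_succ_succ]
  nlinarith [ha n, contDen_bounds ha n]

lemma contDen_le_succ (ha : ∀ n, 1 ≤ a n) (n : ℕ) : contDen a n ≤ contDen a (n + 1) := by
  cases n with
  | zero => simp [contDen]
  | succ n => linarith [contDen_add_le ha n, (contDen_bounds ha n).1]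

/-- Strict growth starts at index 2 only: the denominators of index 1 and 2 are 1 and a₀, which
agree when a₀ = 1. -/
lemma contDen_lt_succ (ha : ∀ n, 1 ≤ a n) (n : ℕ) : contDen a (n + 2) < contDen a (n + 3) := by
  have h1 := contDen_add_le ha (n + 1)
  have h2 := (contDen_bounds ha n).2
  change contDen a (n + 2) + contDen a (n + 1) ≤ contDen a (n + 3) at h1
  omega

lemma le_contDen (ha : ∀ n, 1 ≤ a n) (n : ℕ) : (n : ℤ) + 1 ≤ contDen a (n + 2) := by
  induction n with
  | zero => simpa using (contDen_bounds ha 1).2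
  | succ n ih =>
    have h1 : contDen a (n + 2) < contDen a (n + 1 + 2) := contDen_lt_succ ha n
    push_cast
    omega

lemma branch_den_pos (ha : ∀ n, 1 ≤ a n) {t : ℝ} (ht : 0 ≤ t) (n : ℕ) :
    (contDen a (n + 1) : ℝ) ≤ contDen a (n + 1) + t * contDen a n ∧
    0 < (contDen a (n + 1) : ℝ) + t * contDen a n := by
  have h1 : (0 : ℝ) ≤ contDen a n := by exact_mod_cast (contDen_bounds ha n).1
  have h2 : (1 : ℝ) ≤ contDen a (n + 1) := by exact_mod_cast (contDen_bounds ha n).2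
  have := mul_nonneg ht h1
  constructor <;> linarith

/-- The map t ↦ 1/(aₙ + t) acts on numerators and denominators by the recurrence, so `branch` is the
Möbius map of two consecutive convergents. -/
lemma branch_mul (ha : ∀ n, 1 ≤ a n) {t : ℝ} (ht : 0 ≤ t) (n : ℕ) :
    branch a n t * (contDen a (n + 1) + t * contDen a n)
      = contNum a (n + 1) + t * contNum a n := by
  induction n generalizing t with
  | zero => simp [branch, contDen, contNum]
  | succ n ih =>
    have h1 : (1 : ℝ) ≤ a n := by exact_mod_cast ha n
    have h2 : 0 < a n + t := by linarith
    have h := ih (one_div_nonneg.2 h2.le)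
    rw [branch, contDen_succ_succ, contNum_succ_succ]
    field_simp at h
    push_cast
    linear_combination h

lemma branch_eq (ha : ∀ n, 1 ≤ a n) {t : ℝ} (ht : 0 ≤ t) (n : ℕ) :
    branch a n t = (contNum a (n + 1) + t * contNum a n) / (contDen a (n + 1) + t * contDen a n) := by
  rw [← branch_mul ha ht, mul_div_cancel_right₀ _ (branch_den_pos ha ht n).2.ne']

lemma abs_branch_sub_le (ha : ∀ n, 1 ≤ a n) {s t : ℝ} (hs : s ∈ Icc (0 : ℝ) 1) (ht : t ∈ Icc (0 : ℝ) 1) (n : ℕ) :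
    |branch a n s - branch a n t| ≤ 1 / (contDen a (n + 1) : ℝ) ^ 2 := by
  obtain ⟨s1, s2⟩ := branch_den_pos ha hs.1 n
  obtain ⟨t1, t2⟩ := branch_den_pos ha ht.1 n
  have h0 : (0 : ℝ) < contDen a (n + 1) := by
    have := (contDen_bounds ha n).2
    have : 0 < contDen a (n + 1) := by omega
    exact_mod_cast this
  have hd : (contNum a n * contDen a (n + 1) - contNum a (n + 1) * contDen a n : ℝ) = (-1) ^ n := by
    exact_mod_cast cont_det a n
  have h : branch a n s - branch a n t = (-1) ^ n * (s - t) /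
      ((contDen a (n + 1) + s * contDen a n) * (contDen a (n + 1) + t * contDen a n)) := by
    rw [branch_eq ha hs.1, branch_eq ha ht.1, div_sub_div _ _ s2.ne' t2.ne', ← hd]
    congr 1
    ring
  rw [h, abs_div, abs_mul, abs_pow, abs_neg, abs_one, one_pow, one_mul, abs_of_pos (mul_pos s2 t2)]
  refine div_le_div₀ zero_le_one ?_ (by positivity) ?_
  · rw [abs_le]
    constructor <;> linarith [hs.1, hs.2, ht.1, ht.2]
  · rw [sq]
    exact mul_le_mul s1 t1 h0.le s2.le

lemma branch_mem (ha : ∀ n, 1 ≤ a n) {t : ℝ} (ht : t ∈ Ioo (0 : ℝ) 1) (n : ℕ) :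
    branch a n t ∈ Ioo (0 : ℝ) 1 ∧ gaussMap^[n] (branch a n t) = t := by
  induction n generalizing t with
  | zero => exact ⟨ht, rfl⟩
  | succ n ih =>
    have h1 : (1 : ℝ) ≤ a n := by exact_mod_cast ha n
    have h2 : 1 / (a n + t) ∈ Ioo (0 : ℝ) 1 :=
      ⟨one_div_pos.2 (by linarith [ht.1]), by
        rw [div_lt_one (by linarith [ht.1])]; linarith [ht.1]⟩
    obtain ⟨h3, h4⟩ := ih h2
    refine ⟨h3, ?_⟩
    rw [Function.iterate_succ_apply', branch, h4, gaussMap, one_div_one_div, Int.fract_intCast_add,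
      Int.fract_eq_self.2 ⟨ht.1.le, ht.2⟩]

lemma hasDerivAt_branch (ha : ∀ n, 1 ≤ a n) {t : ℝ} (ht : 0 < t) (n : ℕ) :
    HasDerivAt (branch a n) ((-1) ^ n / (contDen a (n + 1) + t * contDen a n) ^ 2) t := by
  have h2 := (branch_den_pos ha ht.le n).2
  have h1 := (((hasDerivAt_id t).mul_const (contNum a n : ℝ)).const_add (contNum a (n + 1) : ℝ)).div
    (((hasDerivAt_id t).mul_const (contDen a n : ℝ)).const_add (contDen a (n + 1) : ℝ)) h2.ne'
  have hd : (contNum a n * contDen a (n + 1) - contNum a (n + 1) * contDen a n : ℝ) = (-1) ^ n := by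
    exact_mod_cast cont_det a n
  refine (h1.congr_deriv ?_).congr_of_eventuallyEq ?_
  · rw [← hd, id_eq]
    congr 1
    ring
  · filter_upwards [lt_mem_nhds ht] with s hs
    rw [branch_eq ha hs.le]
    rfl

/-- Bounded distortion: the derivative of the branch is ±1/(q_{n+1} + t qₙ)², and qₙ ≤ q_{n+1} makes
the denominator at most (2q_{n+1})², whatever the digits. -/
lemma measure_branch_image_ge (ha : ∀ n, 1 ≤ a n) {E : Set ℝ} (hE : MeasurableSet E) (hE' : E ⊆ Ioo 0 1) (n : ℕ) :
    ENNReal.ofReal (1 / (4 * (contDen a (n + 1) : ℝ) ^ 2)) * volume E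
      ≤ volume (branch a n '' E) := by
  have hinj : InjOn (branch a n) E := by
    intro s hs t ht h
    rw [← (branch_mem ha (hE' hs) n).2, h, (branch_mem ha (hE' ht) n).2]
  have h := lintegral_image_eq_lintegral_abs_deriv_mul hE
    (fun t ht => (hasDerivAt_branch ha (hE' ht).1 n).hasDerivWithinAt) hinj (fun _ => 1)
  rw [setLIntegral_one] at h
  rw [h, ← setLIntegral_const]
  refine setLIntegral_mono' hE fun t ht => ?_
  rw [mul_one]
  refine ENNReal.ofReal_le_ofReal ?_
  obtain ⟨h1, h2⟩ := branch_den_pos ha (hE' ht).1.le n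
  rw [abs_div, abs_pow, abs_neg, abs_one, one_pow, abs_of_pos (pow_pos h2 2)]
  refine one_div_le_one_div_of_le (pow_pos h2 2) ?_
  have h3 : (contDen a n : ℝ) ≤ contDen a (n + 1) := by exact_mod_cast contDen_le_succ ha n
  have h4 : (0 : ℝ) ≤ contDen a n := by exact_mod_cast (contDen_bounds ha n).1
  have h5 : t * contDen a n ≤ contDen a (n + 1) :=
    (mul_le_of_le_one_left h4 (hE' ht).2.le).trans h3
  rw [show (4 : ℝ) * (contDen a (n + 1) : ℝ) ^ 2 = (2 * contDen a (n + 1)) ^ 2 by ring]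
  exact pow_le_pow_left₀ h2.le (by linarith) 2

lemma tendsto_contDen (ha : ∀ n, 1 ≤ a n) : Tendsto (fun n => (contDen a (n + 1) : ℝ)) atTop atTop := by
  rw [← tendsto_add_atTop_iff_nat 1]
  refine tendsto_atTop_mono (fun n => ?_) tendsto_natCast_atTop_atTop
  have := le_contDen ha n
  have : (n : ℤ) ≤ contDen a (n + 1 + 1) := by
    rw [add_assoc]; exact le_trans (by omega) this
  exact_mod_cast this

lemma tendsto_inv_contDen_sq (ha : ∀ n, 1 ≤ a n) :
    Tendsto (fun n => 1 / (contDen a (n + 1) : ℝ) ^ 2) atTop (𝓝 0) := by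
  simp only [one_div]
  exact ((tendsto_pow_atTop two_ne_zero).comp (tendsto_contDen ha)).inv_tendsto_atTop

end Digits

/-! ### The digits of a number -/

/-- The orbit of `x` under the Gauss map stays in `(0,1)`. -/
def IsRegular (x : ℝ) : Prop := ∀ n, gaussMap^[n] x ∈ Ioo (0 : ℝ) 1

/-- The digits of the continued fraction of `x`. -/
def digit (x : ℝ) (n : ℕ) : ℤ := ⌊1 / gaussMap^[n] x⌋

lemma one_le_floor_inv {x : ℝ} (hx : x ∈ Ioo (0 : ℝ) 1) : 1 ≤ ⌊1 / x⌋ := by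
  rw [Int.le_floor, Int.cast_one, le_div_iff₀ hx.1]
  linarith [hx.2]

lemma IsRegular.one_le_digit {x : ℝ} (hx : IsRegular x) (n : ℕ) : 1 ≤ digit x n :=
  one_le_floor_inv (hx n)

lemma digit_add (x : ℝ) (n : ℕ) :
    gaussMap^[n] x = 1 / (digit x n + gaussMap^[n + 1] x) := by
  rw [Function.iterate_succ_apply', gaussMap, digit, Int.floor_add_fract, one_div_one_div]

lemma branch_digit (x : ℝ) (n : ℕ) :
    branch (digit x) n (gaussMap^[n] x) = x := by
  induction n with
  | zero => rfl
  | succ n ih => rw [branch, ← digit_add x n, ih]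

lemma gaussMeasure_ae_isRegular : ∀ᵐ x ∂gaussMeasure, IsRegular x := by
  refine ae_all_iff.2 fun n => ?_
  exact (measurePreserving_gaussMap.iterate n).quasiMeasurePreserving.ae gaussMeasure_ae_mem

/-! ### Ergodicity of the Gauss map -/

/-- By invariance, the branch of the first n digits of x maps s ∩ (0,1) into itself. The image lies
within 1/q² of x and has measure at least |s ∩ (0,1)|/(4q²). A point outside s would thus have
positive lower density, against Lebesgue's theorem. -/
lemma gaussMap_density {s : Set ℝ} (hs : MeasurableSet s) (hinv : gaussMap ⁻¹' s = s)
    (h0 : volume (s ∩ Ioo 0 1) ≠ 0) : ∀ᵐ x ∂gaussMeasure, x ∈ s := by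
  set A := s ∩ Ioo (0 : ℝ) 1 with hA
  have hAm : MeasurableSet A := hs.inter measurableSet_Ioo
  have hdens := Besicovitch.ae_tendsto_measure_inter_div_of_measurableSet (volume : Measure ℝ) hAm
  have hdens' := gaussMeasure_absolutelyContinuous.ae_le (ae_restrict_of_ae hdens)
  filter_upwards [hdens', gaussMeasure_ae_isRegular] with x hx hreg
  by_contra hxs
  have hxA : x ∉ A := fun h => hxs h.1
  rw [indicator_of_notMem hxA] at hx
  have ha := hreg.one_le_digit
  have hr : Tendsto (fun n => 1 / (contDen (digit x) (n + 1) : ℝ) ^ 2) atTop (𝓝[>] 0) := by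
    refine tendsto_nhdsWithin_iff.2 ⟨tendsto_inv_contDen_sq ha, Eventually.of_forall fun n => ?_⟩
    have : (0 : ℝ) < contDen (digit x) (n + 1) := by
      have := (contDen_bounds ha n).2
      have : 0 < contDen (digit x) (n + 1) := by omega
      exact_mod_cast this
    exact one_div_pos.2 (pow_pos this 2)
  have hlim := hx.comp hr
  -- The constant 1/8 is the quotient of the factor 1/(4q²) of the distortion bound by the length
  -- 2/q² of the interval.
  have hge : ∀ n, ENNReal.ofReal (1 / 8) * volume A ≤
      volume (A ∩ Metric.closedBall x (1 / (contDen (digit x) (n + 1) : ℝ) ^ 2)) /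
        volume (Metric.closedBall x (1 / (contDen (digit x) (n + 1) : ℝ) ^ 2)) := by
    intro n
    have hpos : (0 : ℝ) < contDen (digit x) (n + 1) := by
      have := (contDen_bounds ha n).2
      have : 0 < contDen (digit x) (n + 1) := by omega
      exact_mod_cast this
    have hsub : branch (digit x) n '' A ⊆
        A ∩ Metric.closedBall x (1 / (contDen (digit x) (n + 1) : ℝ) ^ 2) := by
      rintro _ ⟨t, ht, rfl⟩
      obtain ⟨b1, b2⟩ := branch_mem ha ht.2 n
      refine ⟨⟨?_, b1⟩, ?_⟩
      · have : (gaussMap^[n]) ⁻¹' s = s := by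
          rw [preimage_iterate_eq, Function.iterate_fixed hinv]
        rw [← this, mem_preimage, b2]
        exact ht.1
      · rw [Metric.mem_closedBall, Real.dist_eq]
        have := abs_branch_sub_le ha (Ioo_subset_Icc_self ht.2) (Ioo_subset_Icc_self (hreg n)) n
        rwa [branch_digit] at this
    rw [Real.volume_closedBall]
    refine ENNReal.le_div_iff_mul_le (Or.inl ?_) (Or.inl ENNReal.ofReal_ne_top) |>.2 ?_
    · exact (ENNReal.ofReal_pos.2 (by positivity)).ne'
    · refine le_trans (le_of_eq ?_)
        ((measure_branch_image_ge ha hAm inter_subset_right n).trans (measure_mono hsub))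
      rw [mul_right_comm, ← ENNReal.ofReal_mul (by norm_num)]
      congr 2
      field_simp
      norm_num
  have := ge_of_tendsto' hlim hge
  rw [nonpos_iff_eq_zero, mul_eq_zero] at this
  rcases this with h | h
  · rw [ENNReal.ofReal_eq_zero] at h
    norm_num at h
  · exact h0 h

lemma ergodic_gaussMap : Ergodic gaussMap gaussMeasure := by
  refine ⟨measurePreserving_gaussMap, ⟨fun s hs hinv => ?_⟩⟩
  rw [eventuallyConst_set']
  by_cases h0 : volume (s ∩ Ioo 0 1) = 0
  · left
    rw [ae_eq_empty]
    refine gaussMeasure_absolutelyContinuous ?_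
    rwa [Measure.restrict_apply hs]
  · right
    rw [eventuallyEq_univ]
    exact gaussMap_density hs hinv h0

/-- The Birkhoff sums of `-ln`. -/
lemma ae_tendsto_birkhoffSum_neg_log : ∀ᵐ x ∂gaussMeasure,
    Tendsto (fun n : ℕ => birkhoffSum gaussMap (fun x => -Real.log x) n x / n) atTop
      (𝓝 (Real.pi ^ 2 / (12 * Real.log 2))) := by
  have := ae_tendsto_birkhoffSum_div ergodic_gaussMap (f := fun x => -Real.log x) (by fun_prop)
    integrable_neg_log
  rwa [integral_neg_log] at this

/-! ### Best approximations -/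

lemma distInt_le (y : ℝ) (p : ℤ) : distInt y ≤ |y - p| := by
  rw [← Real.dist_eq]
  exact Metric.infDist_le_dist_of_mem (mem_range_self p)

lemma le_distInt {y c : ℝ} (h : ∀ p : ℤ, c ≤ |y - p|) : c ≤ distInt y := by
  refine (Metric.le_infDist (range_nonempty _)).2 ?_
  rintro _ ⟨p, rfl⟩
  rw [Real.dist_eq]
  exact h p

lemma distInt_add_int (y : ℝ) (k : ℤ) : distInt (y + k) = distInt y := by
  refine le_antisymm (le_distInt fun p => ?_) (le_distInt fun p => ?_)
  · have := distInt_le (y + k) (p + k)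
    push_cast at this
    rwa [add_sub_add_right_eq_sub] at this
  · have := distInt_le y (p - k)
    push_cast at this
    rwa [sub_sub_eq_add_sub] at this

lemma distInt_neg (y : ℝ) : distInt (-y) = distInt y := by
  refine le_antisymm (le_distInt fun p => ?_) (le_distInt fun p => ?_)
  · have := distInt_le (-y) (-p)
    push_cast at this
    rwa [← neg_sub', abs_neg] at this
  · have := distInt_le y (-p)
    push_cast at this
    rwa [show y - -(p : ℝ) = -(-y - p) by ring, abs_neg] at this

lemma distInt_mul_natAbs (θ : ℝ) (Q : ℤ) : distInt (θ * Q.natAbs) = distInt (θ * Q) := by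
  rcases Int.natAbs_eq Q with h | h
  · conv_rhs => rw [h]
    simp
  · conv_rhs => rw [h]
    push_cast
    rw [mul_neg, distInt_neg]
    simp

lemma distInt_fract_mul (θ : ℝ) (Q : ℤ) : distInt (Int.fract θ * Q) = distInt (θ * Q) := by
  rw [← distInt_add_int (Int.fract θ * Q) (⌊θ⌋ * Q)]
  push_cast
  rw [← add_mul, Int.fract_add_floor]

lemma isBestDenominator_fract (θ : ℝ) (Q : ℤ) :
    IsBestDenominator (Int.fract θ) Q ↔ IsBestDenominator θ Q := by
  simp only [IsBestDenominator, distInt_fract_mul]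

lemma bestDenominator_fract (θ : ℝ) (n : ℕ) :
    bestDenominator (Int.fract θ) n = bestDenominator θ n := by
  simp only [bestDenominator, isBestDenominator_fract]

/-- The distance is even in Q, and the weak inequality adds only the case U = ±Q. What remains is
the notion of a strict record over the positive integers. -/
lemma exists_isBestDenominator_iff (θ : ℝ) (q : ℕ) :
    (∃ Q : ℤ, IsBestDenominator θ Q ∧ Q.natAbs = q) ↔
      0 < q ∧ ∀ u : ℕ, 0 < u → u < q → distInt (θ * q) < distInt (θ * u) := by
  constructor
  · rintro ⟨Q, ⟨hQ, h⟩, rfl⟩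
    refine ⟨Int.natAbs_pos.2 hQ, fun u hu hlt => ?_⟩
    have := (h u (by omega)).1 (by rw [Int.abs_eq_natAbs, Int.abs_eq_natAbs]; omega)
    rw [distInt_mul_natAbs]
    exact_mod_cast this
  · rintro ⟨hq, h⟩
    refine ⟨q, ⟨by omega, fun U hU => ?_⟩, by simp⟩
    have h1 : U.natAbs < q → distInt (θ * (q : ℤ)) < distInt (θ * U) := by
      intro hlt
      have := h U.natAbs (Int.natAbs_pos.2 hU) hlt
      rw [distInt_mul_natAbs] at this
      exact_mod_cast this
    rw [Int.abs_eq_natAbs, Int.abs_eq_natAbs]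
    refine ⟨fun hlt => h1 (by omega), fun hle => ?_⟩
    rcases lt_or_eq_of_le (show U.natAbs ≤ q by omega) with hlt | heq
    · exact (h1 hlt).le
    · rw [← distInt_mul_natAbs θ U, heq]
      exact_mod_cast le_rfl

/-- The number `q_n x - p_n`. -/
def defect (x : ℝ) (n : ℕ) : ℝ := contDen (digit x) n * x - contNum (digit x) n

lemma defect_zero (x : ℝ) : defect x 0 = -1 := by simp [defect, contDen, contNum]

section Regular

variable {x : ℝ}

lemma defect_succ (hx : IsRegular x) (n : ℕ) : defect x (n + 1) = -gaussMap^[n] x * defect x n := by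
  have h := branch_mul hx.one_le_digit (hx n).1.le n
  rw [branch_digit] at h
  rw [defect, defect]
  linear_combination h

lemma defect_ne_zero (hx : IsRegular x) (n : ℕ) : defect x n ≠ 0 := by
  induction n with
  | zero => simp [defect_zero]
  | succ n ih =>
    rw [defect_succ hx]
    exact mul_ne_zero (neg_ne_zero.2 (hx n).1.ne') ih

lemma abs_defect_succ_lt (hx : IsRegular x) (n : ℕ) : |defect x (n + 1)| < |defect x n| := by
  rw [defect_succ hx, abs_mul, abs_neg, abs_of_pos (hx n).1]
  exact mul_lt_of_lt_one_left (abs_pos.2 (defect_ne_zero hx n)) (hx n).2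

/-- Each step multiplies the defect by minus the current point of the orbit, and the initial defect
is -1. -/
lemma log_abs_defect (hx : IsRegular x) (n : ℕ) :
    Real.log |defect x n| = -birkhoffSum gaussMap (fun x => -Real.log x) n x := by
  induction n with
  | zero => simp [defect_zero]
  | succ n ih =>
    rw [defect_succ hx, abs_mul, abs_neg, abs_of_pos (hx n).1,
      Real.log_mul (hx n).1.ne' (abs_pos.2 (defect_ne_zero hx n)).ne', ih, birkhoffSum_succ]
    ring

lemma abs_defect_mul (hx : IsRegular x) (n : ℕ) :
    |defect x n| * (contDen (digit x) (n + 1) + gaussMap^[n] x * contDen (digit x) n) = 1 := by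
  have h := (branch_den_pos hx.one_le_digit (hx n).1.le n).2
  rw [← abs_of_pos h, ← abs_mul]
  have hd : (contNum (digit x) n * contDen (digit x) (n + 1)
      - contNum (digit x) (n + 1) * contDen (digit x) n : ℝ) = (-1) ^ n := by
    exact_mod_cast cont_det (digit x) n
  have h2 := defect_succ hx n
  have : defect x n * (contDen (digit x) (n + 1) + gaussMap^[n] x * contDen (digit x) n)
      = -(-1) ^ n := by
    rw [← hd]
    simp only [defect] at h2 ⊢
    linear_combination (contDen (digit x) n : ℝ) * h2
  rw [this, abs_neg, abs_pow, abs_neg, abs_one, one_pow]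

lemma contDen_cast_pos (hx : IsRegular x) (n : ℕ) : (0 : ℝ) < contDen (digit x) (n + 1) := by
  have := (contDen_bounds hx.one_le_digit n).2
  have : 0 < contDen (digit x) (n + 1) := by omega
  exact_mod_cast this

/-- By `abs_defect_mul` the Birkhoff sum is exactly ln(q_{n+1} + tqₙ), where t in (0,1) is the
current point of the orbit. The argument is between q_{n+1} and 2q_{n+1}. -/
lemma log_contDen (hx : IsRegular x) (n : ℕ) :
    Real.log (contDen (digit x) (n + 1)) ≤ birkhoffSum gaussMap (fun x => -Real.log x) n x ∧
    birkhoffSum gaussMap (fun x => -Real.log x) n x - Real.log 2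
      ≤ Real.log (contDen (digit x) (n + 1)) := by
  have h := branch_den_pos hx.one_le_digit (hx n).1.le n
  have h0 := contDen_cast_pos hx n
  have hS : birkhoffSum gaussMap (fun x => -Real.log x) n x =
      Real.log (contDen (digit x) (n + 1) + gaussMap^[n] x * contDen (digit x) n) := by
    have h1 := congr_arg Real.log (abs_defect_mul hx n)
    rw [Real.log_mul (abs_pos.2 (defect_ne_zero hx n)).ne' h.2.ne', Real.log_one,
      log_abs_defect hx] at h1
    linarith
  rw [hS]
  refine ⟨Real.log_le_log h0 h.1, ?_⟩
  rw [sub_le_iff_le_add, ← Real.log_mul h0.ne' two_ne_zero]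
  refine Real.log_le_log h.2 ?_
  have h3 : (contDen (digit x) n : ℝ) ≤ contDen (digit x) (n + 1) := by
    exact_mod_cast contDen_le_succ hx.one_le_digit n
  have h4 : (0 : ℝ) ≤ contDen (digit x) n := by
    exact_mod_cast (contDen_bounds hx.one_le_digit n).1
  have := (mul_le_of_le_one_left h4 (hx n).2.le).trans h3
  linarith

/-- The convergents are best approximations. -/
lemma abs_defect_le (hx : IsRegular x) {n : ℕ} {q : ℤ} (hq : 0 < q) (hlt : q < contDen (digit x) (n + 1)) (p : ℤ) :
    |defect x n| ≤ |q * x - p| := by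
  set P := contNum (digit x) n with hP
  set P' := contNum (digit x) (n + 1) with hP'
  set Q := contDen (digit x) n with hQ
  set Q' := contDen (digit x) (n + 1) with hQ'
  have hdet : P * Q' - P' * Q = (-1) ^ n := cont_det _ _
  have hsq : ((-1 : ℤ) ^ n) * (-1) ^ n = 1 := by rw [← mul_pow]; simp
  -- The coordinates of (q, p) in the unimodular basis of two consecutive convergents.
  set α : ℤ := (-1) ^ n * (p * Q' - q * P') with hα
  set β : ℤ := (-1) ^ n * (q * P - p * Q) with hβ
  have e1 : q = α * Q + β * Q' := by
    linear_combination -q * hsq - (-1) ^ n * q * hdet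
  have e2 : p = α * P + β * P' := by
    linear_combination -p * hsq - (-1) ^ n * p * hdet
  have hQ0 : 0 ≤ Q := (contDen_bounds hx.one_le_digit n).1
  have hx0 := (hx n).1
  have key : q * x - p = defect x n * (α - β * gaussMap^[n] x) := by
    have h1 : (q : ℝ) = α * Q + β * Q' := by exact_mod_cast e1
    have h2 : (p : ℝ) = α * P + β * P' := by exact_mod_cast e2
    have h3 := defect_succ hx n
    rw [h1, h2]
    rw [defect, defect, ← hP, ← hP', ← hQ, ← hQ'] at h3
    rw [defect, ← hP, ← hQ]
    linear_combination (β : ℝ) * h3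
  -- Since 0 < q < Q', the coordinate α is nonzero, and it has the sign opposite to β when β ≠ 0.
  -- The two terms then add up in absolute value.
  have hge : 1 ≤ |(α : ℝ) - β * gaussMap^[n] x| := by
    rcases lt_trichotomy β 0 with hb | hb | hb
    · have ha : 0 < α := by
        by_contra! h
        nlinarith
      have ha' : (1 : ℝ) ≤ α := by exact_mod_cast ha
      have hb' : (β : ℝ) < 0 := by exact_mod_cast hb
      refine le_trans ?_ (le_abs_self _)
      nlinarith
    · have ha : α ≠ 0 := by
        rintro h
        rw [h, hb] at e1
        omega
      rw [hb, Int.cast_zero, zero_mul, sub_zero]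
      exact_mod_cast Int.one_le_abs ha
    · have ha : α < 0 := by
        by_contra! h
        nlinarith
      have ha' : (α : ℝ) ≤ -1 := by
        have : α ≤ -1 := by omega
        exact_mod_cast this
      have hb' : (0 : ℝ) < β := by exact_mod_cast hb
      refine le_trans ?_ (neg_le_abs _)
      nlinarith
  rw [key, abs_mul]
  exact le_mul_of_one_le_right (abs_nonneg _) hge

lemma abs_defect_le_distInt (hx : IsRegular x) {n u : ℕ} (hu : 0 < u) (hlt : (u : ℤ) < contDen (digit x) (n + 1)) :
    |defect x n| ≤ distInt (x * u) := by
  refine le_distInt fun p => ?_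
  have := abs_defect_le hx (q := u) (by exact_mod_cast hu) hlt p
  rw [mul_comm x]
  exact_mod_cast this

lemma toNat_contDen (hx : IsRegular x) (n : ℕ) : (((contDen (digit x) n).toNat : ℕ) : ℤ) = contDen (digit x) n :=
  Int.toNat_of_nonneg (contDen_bounds hx.one_le_digit n).1

lemma toNat_contDen_cast (hx : IsRegular x) (n : ℕ) :
    (((contDen (digit x) n).toNat : ℕ) : ℝ) = contDen (digit x) n := by
  exact_mod_cast congr_arg (Int.cast (R := ℝ)) (toNat_contDen hx n)

lemma distInt_contDen_le (hx : IsRegular x) (n : ℕ) : distInt (x * (contDen (digit x) n).toNat) ≤ |defect x n| := by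
  rw [toNat_contDen_cast hx, mul_comm]
  exact distInt_le _ _

/-- The lower bound uses that the next denominator is strictly larger, which is guaranteed from
index 2 on. -/
lemma distInt_contDen (hx : IsRegular x) (n : ℕ) :
    distInt (x * (contDen (digit x) (n + 2)).toNat) = |defect x (n + 2)| := by
  refine le_antisymm (distInt_contDen_le hx _) (abs_defect_le_distInt hx ?_ ?_)
  · have := toNat_contDen hx (n + 2)
    have := (contDen_bounds hx.one_le_digit (n + 1)).2
    have : 1 ≤ contDen (digit x) (n + 2) := this
    omega
  · rw [toNat_contDen hx]
    exact contDen_lt_succ hx.one_le_digit n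

/-- An integer strictly between two consecutive denominators does no better than the smaller one.
Conversely, the defects strictly decrease, so every denominator is a record. -/
lemma exists_isBestDenominator_iff_contDen (hx : IsRegular x) (q : ℕ) :
    (∃ Q : ℤ, IsBestDenominator x Q ∧ Q.natAbs = q) ↔
      ∃ n, (contDen (digit x) (n + 1)).toNat = q := by
  rw [exists_isBestDenominator_iff]
  constructor
  · rintro ⟨hq, h⟩
    have hex : ∃ n, (q : ℤ) < contDen (digit x) (n + 2) := by
      refine ⟨q, ?_⟩
      have := le_contDen hx.one_le_digit q
      omega
    classical
    obtain ⟨n, hn, hmin⟩ : ∃ n, (q : ℤ) < contDen (digit x) (n + 2) ∧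
        contDen (digit x) (n + 1) ≤ q := by
      refine ⟨Nat.find hex, Nat.find_spec hex, ?_⟩
      rcases Nat.eq_zero_or_pos (Nat.find hex) with h0 | h0
      · rw [h0]
        simp only [contDen]
        omega
      · have := Nat.find_min hex (Nat.sub_lt h0 one_pos)
        rw [not_lt, show Nat.find hex - 1 + 2 = Nat.find hex + 1 by omega] at this
        exact this
    refine ⟨n, ?_⟩
    have hpos := (contDen_bounds hx.one_le_digit n).2
    have hnat := toNat_contDen hx (n + 1)
    by_contra hne
    have h1 := h (contDen (digit x) (n + 1)).toNat (by omega) (by omega)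
    have h2 := distInt_contDen_le hx (n + 1)
    have h3 := abs_defect_le_distInt hx hq hn
    linarith
  · rintro ⟨n, rfl⟩
    have hpos := (contDen_bounds hx.one_le_digit n).2
    have hnat := toNat_contDen hx (n + 1)
    refine ⟨by omega, fun u hu hlt => ?_⟩
    cases n with
    | zero =>
      simp only [contDen] at hlt
      omega
    | succ n =>
      have h1 := distInt_contDen_le hx (n + 1 + 1)
      have h2 := abs_defect_succ_lt hx (n + 1)
      have h3 := abs_defect_le_distInt hx (n := n + 1) hu (by omega)
      linarith

/-- The shift s is 1 when a₀ = 1, since the value 1 then occurs twice among the denominators, and 0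
otherwise. It does not affect the limits. -/
lemma exists_bestDenominator_eq (hx : IsRegular x) :
    ∃ s : ℕ, ∀ n, bestDenominator x n = (contDen (digit x) (n + 1 + s)).toNat := by
  have key : ∀ s : ℕ, (StrictMono fun n => (contDen (digit x) (n + 1 + s)).toNat) →
      (∀ n, ∃ m, (contDen (digit x) (m + 1 + s)).toNat = (contDen (digit x) (n + 1)).toNat) →
      ∀ n, bestDenominator x n = (contDen (digit x) (n + 1 + s)).toNat := by
    intro s hmono hrange n
    rw [bestDenominator]
    simp only [exists_isBestDenominator_iff_contDen hx]
    have := Nat.nth_comp_of_strictMono (n := n)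
      (p := fun q => ∃ n, (contDen (digit x) (n + 1)).toNat = q) hmono
      (by
        rintro k ⟨m, rfl⟩
        obtain ⟨l, hl⟩ := hrange m
        exact ⟨l, hl⟩)
      (by
        intro hfin
        exfalso
        refine (infinite_range_of_injective hmono.injective) (hfin.subset ?_)
        rintro _ ⟨m, rfl⟩
        exact ⟨m + s, by rw [add_right_comm]⟩)
    rw [← this]
    congr 2
    rw [Nat.nth_of_forall]
    intro m _
    exact ⟨m + s, by rw [add_right_comm]⟩
  by_cases h2 : contDen (digit x) 2 = 1
  · refine ⟨1, key 1 (strictMono_nat_of_lt_succ fun n => ?_) fun n => ?_⟩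
    · have h3 := contDen_lt_succ hx.one_le_digit n
      have h4 := toNat_contDen hx (n + 2)
      have h5 := toNat_contDen hx (n + 3)
      change (contDen (digit x) (n + 2)).toNat < (contDen (digit x) (n + 3)).toNat
      omega
    · cases n with
      | zero => exact ⟨0, by simp only [zero_add, one_add_one_eq_two, h2]; rfl⟩
      | succ n => exact ⟨n, rfl⟩
  · refine ⟨0, key 0 (strictMono_nat_of_lt_succ fun n => ?_) fun n => ⟨n, rfl⟩⟩
    have h3 : contDen (digit x) (n + 1) < contDen (digit x) (n + 2) := by
      cases n with
      | zero =>
        have := (contDen_bounds hx.one_le_digit 1).2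
        simp only [zero_add, one_add_one_eq_two] at this ⊢
        have h1 : contDen (digit x) 1 = 1 := rfl
        omega
      | succ n => exact contDen_lt_succ hx.one_le_digit n
    have h4 := toNat_contDen hx (n + 1)
    have h5 := toNat_contDen hx (n + 2)
    change (contDen (digit x) (n + 1)).toNat < (contDen (digit x) (n + 2)).toNat
    omega

end Regular

/-! ### Lévy's constant -/

lemma tendsto_shift_div {S : ℕ → ℝ} {L : ℝ} (h : Tendsto (fun n : ℕ => S n / n) atTop (𝓝 L))
    (c : ℕ) : Tendsto (fun n : ℕ => S (n + c) / n) atTop (𝓝 L) := by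
  have h1 : Tendsto (fun n : ℕ => S (n + c) / ((n + c : ℕ) : ℝ)) atTop (𝓝 L) :=
    (tendsto_add_atTop_iff_nat c).2 h
  have h2 : Tendsto (fun n : ℕ => 1 + (c : ℝ) / n) atTop (𝓝 (1 + 0)) :=
    tendsto_const_nhds.add (tendsto_const_div_atTop_nhds_zero_nat _)
  have h3 := h1.mul h2
  rw [add_zero, mul_one] at h3
  refine h3.congr' ?_
  filter_upwards [eventually_gt_atTop 0] with n hn
  have hn' : (0 : ℝ) < n := by exact_mod_cast hn
  push_cast
  field_simp

lemma IsRegular.tendsto_levy {x L : ℝ} (hx : IsRegular x)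
    (h : Tendsto (fun n : ℕ => birkhoffSum gaussMap (fun x => -Real.log x) n x / n) atTop (𝓝 L)) :
    Tendsto (fun n : ℕ => 1 / (n : ℝ) * Real.log (bestDenominator x n)) atTop (𝓝 L) ∧
    Tendsto (fun n : ℕ => 1 / (n : ℝ) * Real.log (distInt (x * bestDenominator x n)))
      atTop (𝓝 (-L)) := by
  obtain ⟨s, hs⟩ := exists_bestDenominator_eq hx
  constructor
  · have h1 := tendsto_shift_div h s
    have h2 := h1.sub (tendsto_const_div_atTop_nhds_zero_nat (Real.log 2))
    rw [sub_zero] at h2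
    refine tendsto_of_tendsto_of_tendsto_of_le_of_le h2 h1 (fun n => ?_) fun n => ?_
    · simp only
      rw [hs, toNat_contDen_cast hx, add_right_comm, ← sub_div, one_div, inv_mul_eq_div]
      exact div_le_div_of_nonneg_right (log_contDen hx _).2 (Nat.cast_nonneg n)
    · simp only
      rw [hs, toNat_contDen_cast hx, add_right_comm, one_div, inv_mul_eq_div]
      exact div_le_div_of_nonneg_right (log_contDen hx _).1 (Nat.cast_nonneg n)
  · refine ((tendsto_shift_div h (1 + s)).neg).congr' ?_
    filter_upwards [eventually_gt_atTop 0] with n hn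
    obtain ⟨m, hm⟩ : ∃ m, n + 1 + s = m + 2 := ⟨n + s - 1, by omega⟩
    rw [hs, hm, distInt_contDen hx, log_abs_defect hx, ← hm, ← add_assoc]
    ring

/-- The Gauss measure is equivalent to Lebesgue measure on (0,1), and the translations by the
countably many integers carry the result to the whole line. -/
theorem isLevyConstant : IsLevyConstant (Real.pi ^ 2 / (12 * Real.log 2)) := by
  have h1 : ∀ᵐ x ∂gaussMeasure,
      Tendsto (fun n : ℕ => 1 / (n : ℝ) * Real.log (bestDenominator x n)) atTop
        (𝓝 (Real.pi ^ 2 / (12 * Real.log 2))) ∧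
      Tendsto (fun n : ℕ => 1 / (n : ℝ) * Real.log (distInt (x * bestDenominator x n)))
        atTop (𝓝 (-(Real.pi ^ 2 / (12 * Real.log 2)))) := by
    filter_upwards [gaussMeasure_ae_isRegular, ae_tendsto_birkhoffSum_neg_log] with x hx h
    exact hx.tendsto_levy h
  have h2 := (ae_restrict_iff' measurableSet_Ioo).1 (absolutelyContinuous_gaussMeasure.ae_le h1)
  have h3 : ∀ᵐ θ : ℝ, ∀ k : ℤ, θ - k ∈ Ioo (0 : ℝ) 1 →
      Tendsto (fun n : ℕ => 1 / (n : ℝ) * Real.log (bestDenominator (θ - k) n)) atTop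
        (𝓝 (Real.pi ^ 2 / (12 * Real.log 2))) ∧
      Tendsto (fun n : ℕ => 1 / (n : ℝ) *
        Real.log (distInt ((θ - k) * bestDenominator (θ - k) n)))
        atTop (𝓝 (-(Real.pi ^ 2 / (12 * Real.log 2)))) := by
    refine ae_all_iff.2 fun k => ?_
    exact (measurePreserving_sub_right volume (k : ℝ)).quasiMeasurePreserving.ae h2
  have h4 : ∀ᵐ θ : ℝ, θ ∉ range ((↑) : ℤ → ℝ) := (countable_range _).ae_notMem _
  filter_upwards [h3, h4] with θ hθ hθ'
  have hne : Int.fract θ ≠ 0 := by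
    intro h
    rw [Int.fract_eq_zero_iff] at h
    exact hθ' h
  have := hθ ⌊θ⌋ ⟨lt_of_le_of_ne (Int.fract_nonneg θ) hne.symm, Int.fract_lt_one θ⟩
  rw [show θ - ⌊θ⌋ = Int.fract θ from rfl] at this
  simp only [bestDenominator_fract] at this
  refine ⟨this.1, this.2.congr fun n => ?_⟩
  have := distInt_fract_mul θ (bestDenominator θ n)
  push_cast at this
  rw [this]

/-! ### The natural extension -/

/-- The inverse of the planar map. -/
def gaussExtInv (p : ℝ × ℝ) : ℝ × ℝ := (gaussExt p.swap).swap

lemma measurePreserving_swap_gaussExtMeasure :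
    MeasurePreserving Prod.swap gaussExtMeasure gaussExtMeasure :=
  ⟨measurable_swap, by rw [gaussExtMeasure_eq, Measure.map_smul, squareMeasure_map_swap]⟩

lemma measurePreserving_gaussExtInv :
    MeasurePreserving gaussExtInv gaussExtMeasure gaussExtMeasure :=
  (measurePreserving_swap_gaussExtMeasure.comp measurePreserving_gaussExt).comp
    measurePreserving_swap_gaussExtMeasure

lemma gaussExtInv_gaussExt {p : ℝ × ℝ} (hp : p ∈ regularSquare) :
    gaussExtInv (gaussExt p) = p := by
  have hy := hp.1.2
  simp only [gaussExtInv, gaussExt, one_div_one_div, Prod.swap_prod_mk,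
    Int.floor_add_intCast, Int.fract_add_intCast]
  rw [Int.fract_eq_self.2 ⟨hy.1.le, hy.2⟩, Int.floor_eq_zero_iff.2 ⟨hy.1.le, hy.2⟩, zero_add,
    Int.fract_add_floor, one_div_one_div]

lemma gaussExtMeasure_ae_of {P : ℝ × ℝ → Prop} (h : ∀ᵐ p ∂squareMeasure, P p) :
    ∀ᵐ p ∂gaussExtMeasure, P p := by
  rw [gaussExtMeasure_eq]
  exact Measure.ae_smul_measure h _

lemma gaussExtInv_comp_ae : gaussExtInv ∘ gaussExt =ᵐ[gaussExtMeasure] id := by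
  filter_upwards [gaussExtMeasure_ae_of squareMeasure_ae_regular] with p hp
  exact gaussExtInv_gaussExt hp

lemma gaussExt_comp_inv_ae : gaussExt ∘ gaussExtInv =ᵐ[gaussExtMeasure] id := by
  filter_upwards [measurePreserving_swap_gaussExtMeasure.quasiMeasurePreserving.ae
    gaussExtInv_comp_ae] with p hp
  have h : gaussExtInv (gaussExt p.swap) = p.swap := hp
  rw [gaussExtInv] at h
  have := congr_arg Prod.swap h
  rwa [Prod.swap_swap, Prod.swap_swap] at this

lemma gaussExtInv_iterate_snd (p : ℝ × ℝ) (n : ℕ) :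
    (gaussExtInv^[n] p).2 = gaussMap^[n] p.2 := by
  induction n with
  | zero => rfl
  | succ n ih =>
    rw [Function.iterate_succ_apply', Function.iterate_succ_apply', ← ih]
    rfl

/-- The past first coordinates display the digits of y, so y is a function of the past of x. -/
lemma floor_gaussExtInv_iterate {p : ℝ × ℝ} (hp : ∀ n, gaussExtInv^[n] p ∈ unitSquare) (n : ℕ) :
    ⌊1 / (gaussExtInv^[n + 1] p).1⌋ = digit p.2 n := by
  rw [Function.iterate_succ_apply', gaussExtInv, gaussExt]
  simp only [Prod.fst_swap, Prod.snd_swap, one_div_one_div]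
  rw [Int.floor_add_intCast, Int.floor_eq_zero_iff.2 ⟨(hp n).1.1.le, (hp n).1.2⟩, zero_add,
    gaussExtInv_iterate_snd, digit]

lemma measurable_branch {β : Type*} [MeasurableSpace β] {d : ℕ → β → ℤ} {t : β → ℝ}
    (hd : ∀ n, Measurable (d n)) (ht : Measurable t) (n : ℕ) :
    Measurable fun z => branch (fun k => d k z) n (t z) := by
  induction n generalizing t with
  | zero => exact ht
  | succ n ih =>
    exact ih (t := fun z => 1 / (d n z + t z)) (measurable_const.div
      (((measurable_from_top (f := fun n : ℤ => (n : ℝ))).comp (hd n)).add ht))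

/-- The σ-algebra generated by the past first coordinates contains x, and all digits of y. The
convergents of y are measurable for it, hence so is y almost everywhere, and (x, y) generates the
Borel sets. -/
theorem isNaturalExtension_gaussExt :
    IsNaturalExtension gaussExt gaussExtMeasure gaussMap gaussMeasure Prod.fst := by
  refine ⟨measurePreserving_gaussMap, measurePreserving_gaussExt, measurePreserving_fst,
    EventuallyEq.rfl, gaussExtInv, measurePreserving_gaussExtInv, gaussExtInv_comp_ae,
    gaussExt_comp_inv_ae, fun B hB => ?_⟩
  have hreg : ∀ᵐ p ∂gaussExtMeasure, ∀ n, gaussExtInv^[n] p ∈ unitSquare :=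
    ae_all_iff.2 fun n => (measurePreserving_gaussExtInv.iterate n).quasiMeasurePreserving.ae
      (gaussExtMeasure_ae_of squareMeasure_ae_mem)
  let m : MeasurableSpace (ℝ × ℝ) := ⨆ n : ℕ,
    (inferInstance : MeasurableSpace ℝ).comap (Prod.fst ∘ gaussExtInv^[n])
  have hm : ∀ n, Measurable[m] fun p => (gaussExtInv^[n] p).1 := fun n =>
    Measurable.mono (comap_measurable (Prod.fst ∘ gaussExtInv^[n])) (le_iSup (fun n : ℕ =>
      (inferInstance : MeasurableSpace ℝ).comap (Prod.fst ∘ gaussExtInv^[n])) n) le_rfl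
  have hd : ∀ n, Measurable[m] fun p => ⌊1 / (gaussExtInv^[n + 1] p).1⌋ := fun n =>
    Int.measurable_floor.comp (measurable_const.div (hm (n + 1)))
  let f : ℕ → ℝ × ℝ → ℝ := fun n p => branch (fun k => ⌊1 / (gaussExtInv^[k + 1] p).1⌋) n 0
  have hf : ∀ n, Measurable[m] (f n) := fun n => measurable_branch hd measurable_const n
  -- An upper limit in the extended nonnegative reals is defined and measurable everywhere, also
  -- where the convergents need not converge.
  let h : ℝ × ℝ → ℝ := fun p => (limsup (fun n => ENNReal.ofReal (f n p)) atTop).toReal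
  have hh : Measurable[m] h :=
    (Measurable.limsup fun n => (hf n).ennreal_ofReal).ennreal_toReal
  have hpair : @Measurable _ _ m Prod.instMeasurableSpace fun p : ℝ × ℝ => (p.1, h p) := (hm 0).prodMk hh
  refine ⟨_, hpair hB, ?_⟩
  filter_upwards [hreg] with p hp
  have hy : IsRegular p.2 := fun n => by
    rw [← gaussExtInv_iterate_snd]
    exact (hp n).2
  have hfp : ∀ n, f n p = branch (digit p.2) n 0 := fun n => by
    simp only [f, floor_gaussExtInv_iterate hp]
  have hlim : Tendsto (fun n => f n p) atTop (𝓝 p.2) := by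
    rw [tendsto_iff_dist_tendsto_zero]
    refine squeeze_zero (fun _ => dist_nonneg) (fun n => ?_) (tendsto_inv_contDen_sq hy.one_le_digit)
    rw [hfp, Real.dist_eq]
    have := abs_branch_sub_le hy.one_le_digit (s := 0) ⟨le_rfl, zero_le_one⟩
      (Ioo_subset_Icc_self (hy n)) n
    rwa [branch_digit] at this
  have hhp : h p = p.2 := by
    simp only [h]
    rw [(ENNReal.tendsto_ofReal hlim).limsup_eq, ENNReal.toReal_ofReal (show 0 ≤ p.2 from (hy 0).1.le)]
  change (p ∈ B) = ((p.1, h p) ∈ B)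
  rw [hhp]

/-! ### The Haar measure -/

lemma isClosedEmbedding_entries :
    IsClosedEmbedding fun (M : SL(2, ℝ)) (i j : Fin 2) => M i j :=
  Matrix.SpecialLinearGroup.isClosedEmbedding_val

lemma measurable_SL {β : Type*} [MeasurableSpace β] {f : β → SL(2, ℝ)}
    (hf : ∀ i j, Measurable fun z => f z i j) : Measurable f := by
  refine isClosedEmbedding_entries.measurableEmbedding.measurable_comp_iff.1 ?_
  exact measurable_pi_iff.2 fun i => measurable_pi_iff.2 fun j => hf i j

lemma measurable_entry (i j : Fin 2) : Measurable fun M : SL(2, ℝ) => M i j :=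
  (measurable_pi_apply j).comp
    ((measurable_pi_apply i).comp isClosedEmbedding_entries.continuous.measurable)

lemma measurable_det : Measurable fun a : Fin 2 → Fin 2 → ℝ => (Matrix.of a).det := by
  simp only [Matrix.det_fin_two, Matrix.of_apply]
  fun_prop

lemma measurable_unimodular :
    Measurable fun a : Fin 2 → Fin 2 → ℝ => unimodular (Matrix.of a) := by
  refine measurable_SL fun i j => ?_
  have h : (fun a : Fin 2 → Fin 2 → ℝ => unimodular (Matrix.of a) i j) = fun a =>
      {a : Fin 2 → Fin 2 → ℝ | 0 < (Matrix.of a).det}.piecewise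
        (fun a => (Real.sqrt (Matrix.of a).det)⁻¹ * a i j)
        (fun _ => (1 : Matrix (Fin 2) (Fin 2) ℝ) i j) a := by
    ext a
    by_cases ha : 0 < (Matrix.of a).det
    · rw [piecewise_eq_of_mem _ _ _ (by exact ha), coe_unimodular ha]
      rfl
    · rw [piecewise_eq_of_notMem _ _ _ (by exact ha)]
      have : unimodular (Matrix.of a) = 1 := dif_neg ha
      rw [this]
      rfl
  rw [h]
  refine Measurable.piecewise (measurableSet_lt measurable_const measurable_det) ?_ measurable_const
  exact (Real.continuous_sqrt.measurable.comp measurable_det).inv.mul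
    ((measurable_pi_apply j).comp (measurable_pi_apply i))

/-- The matrices of determinant in `(0, 1]`. -/
def detRegion : Set (Fin 2 → Fin 2 → ℝ) := {a | 0 < (Matrix.of a).det ∧ (Matrix.of a).det ≤ 1}

lemma measurableSet_detRegion : MeasurableSet detRegion :=
  (measurableSet_lt measurable_const measurable_det).inter
    (measurableSet_le measurable_det measurable_const)

lemma haarSL_apply {B : Set SL(2, ℝ)} (hB : MeasurableSet B) :
    haarSL B = 2 * volume ({a | unimodular (Matrix.of a) ∈ B} ∩ detRegion) := by
  rw [haarSL, Measure.smul_apply, smul_eq_mul, Measure.map_apply measurable_unimodular hB,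
    Measure.restrict_apply (measurable_unimodular hB)]
  rfl

/-- `haarSL` is the image of Lebesgue measure on matrices of determinant in (0, 1], so a
measure-preserving map of matrices that keeps determinants descends to it. -/
lemma measurePreserving_haarSL {Φ : (Fin 2 → Fin 2 → ℝ) → Fin 2 → Fin 2 → ℝ}
    {φ : SL(2, ℝ) → SL(2, ℝ)} (hΦ : MeasurePreserving Φ volume volume) (hφ : Measurable φ)
    (hdet : ∀ a, (Matrix.of (Φ a)).det = (Matrix.of a).det)
    (hcomm : ∀ a, 0 < (Matrix.of a).det → unimodular (Matrix.of (Φ a)) = φ (unimodular (Matrix.of a))) :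
    MeasurePreserving φ haarSL haarSL := by
  refine ⟨hφ, ?_⟩
  ext B hB
  have hm : MeasurableSet ({a | unimodular (Matrix.of a) ∈ B} ∩ detRegion) :=
    (measurable_unimodular hB).inter measurableSet_detRegion
  rw [Measure.map_apply hφ hB, haarSL_apply (hφ hB), haarSL_apply hB,
    ← hΦ.measure_preimage hm.nullMeasurableSet]
  congr 2
  ext a
  simp only [mem_inter_iff, mem_ofPred_eq, mem_preimage, detRegion, hdet]
  constructor
  · rintro ⟨h1, h2⟩
    exact ⟨by rw [hcomm a h2.1]; exact h1, h2⟩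
  · rintro ⟨h1, h2⟩
    exact ⟨by rw [hcomm a h2.1] at h1; exact h1, h2⟩

/-- A linear map of finite order preserves the Lebesgue measure. -/
lemma measurePreserving_of_pow_eq_one {f : (Fin 2 → Fin 2 → ℝ) →ₗ[ℝ] Fin 2 → Fin 2 → ℝ} {n : ℕ}
    (hn : n ≠ 0) (hf : f ^ n = 1) : MeasurePreserving f volume volume := by
  have h1 : |LinearMap.det f| = 1 := by
    have : |LinearMap.det f| ^ n = 1 := by
      rw [← abs_pow, ← map_pow, hf, map_one, abs_one]
    exact (pow_eq_one_iff_of_nonneg (abs_nonneg _) hn).1 this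
  have h0 : LinearMap.det f ≠ 0 := by
    intro h
    rw [h, abs_zero] at h1
    exact zero_ne_one h1
  refine ⟨(LinearMap.continuous_of_finiteDimensional f).measurable, ?_⟩
  rw [Measure.map_linearMap_addHaar_eq_smul_addHaar _ h0, abs_inv, h1]
  simp

/-- Transposition. -/
def transposeLin : (Fin 2 → Fin 2 → ℝ) →ₗ[ℝ] Fin 2 → Fin 2 → ℝ where
  toFun a := fun i j => a j i
  map_add' _ _ := rfl
  map_smul' _ _ := rfl

lemma measurePreserving_transpose : MeasurePreserving transposeLin volume volume :=
  measurePreserving_of_pow_eq_one two_ne_zero (by rw [sq]; rfl)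

lemma measurePreserving_mulRight (g : SL(2, ℝ)) :
    MeasurePreserving (fun (a : Fin 2 → Fin 2 → ℝ) (i : Fin 2) =>
      Matrix.toLin' (g : Matrix (Fin 2) (Fin 2) ℝ).transpose (a i)) volume volume := by
  refine volume_preserving_pi fun _ => ⟨?_, ?_⟩
  · exact (LinearMap.continuous_of_finiteDimensional _).measurable
  · have h : (g : Matrix (Fin 2) (Fin 2) ℝ).transpose.det = 1 := by
      rw [Matrix.det_transpose]; exact g.2
    rw [Real.map_matrix_volume_pi_eq_smul_volume_pi (by rw [h]; exact one_ne_zero), h]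
    simp

lemma of_mulRight (g : SL(2, ℝ)) (a : Fin 2 → Fin 2 → ℝ) :
    Matrix.of (fun i => Matrix.toLin' (g : Matrix (Fin 2) (Fin 2) ℝ).transpose (a i))
      = Matrix.of a * (g : Matrix (Fin 2) (Fin 2) ℝ) := by
  ext i j
  fin_cases j <;> simp [Matrix.mul_apply, Fin.sum_univ_two, mul_comm]

lemma unimodular_mul {A : Matrix (Fin 2) (Fin 2) ℝ} (hA : 0 < A.det) (g : SL(2, ℝ)) :
    unimodular (A * (g : Matrix (Fin 2) (Fin 2) ℝ)) = unimodular A * g := by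
  have h : (A * (g : Matrix (Fin 2) (Fin 2) ℝ)).det = A.det := by
    rw [Matrix.det_mul, g.2, mul_one]
  apply Subtype.ext
  rw [Matrix.SpecialLinearGroup.coe_mul, coe_unimodular hA, coe_unimodular (h ▸ hA), h,
    Matrix.smul_mul]

lemma mul_unimodular {A : Matrix (Fin 2) (Fin 2) ℝ} (hA : 0 < A.det) (g : SL(2, ℝ)) :
    unimodular ((g : Matrix (Fin 2) (Fin 2) ℝ) * A) = g * unimodular A := by
  have h : ((g : Matrix (Fin 2) (Fin 2) ℝ) * A).det = A.det := by
    rw [Matrix.det_mul, g.2, one_mul]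
  apply Subtype.ext
  rw [Matrix.SpecialLinearGroup.coe_mul, coe_unimodular hA, coe_unimodular (h ▸ hA), h,
    Matrix.mul_smul]

lemma measurePreserving_haarSL_mul_right (g : SL(2, ℝ)) :
    MeasurePreserving (fun M : SL(2, ℝ) => M * g) haarSL haarSL := by
  refine measurePreserving_haarSL (measurePreserving_mulRight g)
    (continuous_mul_const g).measurable (fun a => ?_) fun a ha => ?_
  · rw [of_mulRight, Matrix.det_mul, g.2, mul_one]
  · rw [of_mulRight, unimodular_mul ha]

/-- Right multiplication acts on each row by a map of determinant one. Transposition, an involution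
that preserves Lebesgue measure, transfers this to left multiplication. -/
lemma measurePreserving_haarSL_mul_left (g : SL(2, ℝ)) :
    MeasurePreserving (fun M : SL(2, ℝ) => g * M) haarSL haarSL := by
  have hof : ∀ a : Fin 2 → Fin 2 → ℝ, Matrix.of (transposeLin fun i =>
      Matrix.toLin' (g.transpose : Matrix (Fin 2) (Fin 2) ℝ).transpose (transposeLin a i))
      = (g : Matrix (Fin 2) (Fin 2) ℝ) * Matrix.of a := by
    intro a
    have h := of_mulRight g.transpose (transposeLin a)
    have h2 : ∀ b : Fin 2 → Fin 2 → ℝ, Matrix.of (transposeLin b) = (Matrix.of b).transpose :=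
      fun _ => rfl
    rw [h2, h, h2, Matrix.transpose_mul, Matrix.transpose_transpose]
    rfl
  refine measurePreserving_haarSL (measurePreserving_transpose.comp
    ((measurePreserving_mulRight g.transpose).comp measurePreserving_transpose))
    (continuous_const_mul g).measurable (fun a => ?_) fun a ha => ?_
  · simp only [Function.comp_apply]
    rw [hof, Matrix.det_mul, g.2, one_mul]
  · simp only [Function.comp_apply]
    rw [hof, mul_unimodular ha]

/-! ### The measure on the space of lattices -/

lemma measurable_toLattice : Measurable toLattice := measurable_quotient_mk''

instance : Countable SL(2, ℤ) :=
  Function.Injective.countable (f := fun (g : SL(2, ℤ)) (i j : Fin 2) => g i j)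
    fun g h hgh => by ext i j; exact congr_fun (congr_fun hgh i) j

/-- Cut B into the pieces moved into D by the elements of SL(2,ℤ), and translate each piece. The
right invariance keeps the measures. -/
lemma haarSL_le_of_cover {B D : Set SL(2, ℝ)} (hB : MeasurableSet B) (hD : MeasurableSet D)
    (hinj : InjOn toLattice B)
    (hcov : ∀ᵐ M ∂haarSL, M ∈ B → ∃ N ∈ D, toLattice M = toLattice N) : haarSL B ≤ haarSL D := by
  let γ : SL(2, ℤ) → SL(2, ℝ) := Matrix.SpecialLinearGroup.map (Int.castRingHom ℝ)
  calc haarSL B ≤ haarSL (⋃ g : SL(2, ℤ), B ∩ (fun M => M * γ g) ⁻¹' D) := by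
        refine measure_mono_ae ?_
        filter_upwards [hcov] with M hM hMB
        obtain ⟨N, hN, hMN⟩ := hM hMB
        obtain ⟨g, rfl⟩ := toLattice_eq_iff.1 hMN
        exact mem_iUnion.2 ⟨g, hMB, hN⟩
    _ ≤ ∑' g : SL(2, ℤ), haarSL (B ∩ (fun M => M * γ g) ⁻¹' D) := measure_iUnion_le _
    _ = ∑' g : SL(2, ℤ), haarSL ((fun M => M * (γ g)⁻¹) ⁻¹' B ∩ D) := by
        refine tsum_congr fun g => ?_
        rw [← (measurePreserving_haarSL_mul_right (γ g)).measure_preimage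
          (((continuous_mul_const (γ g)⁻¹).measurable hB).inter hD).nullMeasurableSet]
        congr 1
        ext M
        simp
    -- The translated pieces are disjoint, because B contains at most one matrix of each lattice.
    _ = haarSL (⋃ g : SL(2, ℤ), (fun M => M * (γ g)⁻¹) ⁻¹' B ∩ D) := by
        rw [measure_iUnion]
        · intro g h hgh
          refine disjoint_left.2 fun M hM hM' => hgh ?_
          have hM1 : M * (γ g)⁻¹ ∈ B := hM.1
          have hM2 : M * (γ h)⁻¹ ∈ B := hM'.1
          have e : M * (γ g)⁻¹ = M * (γ h)⁻¹ := by
            refine hinj hM1 hM2 (toLattice_eq_iff.2 ⟨g * h⁻¹, ?_⟩)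
            rw [map_mul, map_inv]
            change M * (γ h)⁻¹ = M * (γ g)⁻¹ * (γ g * (γ h)⁻¹)
            group
          have e2 : γ g = γ h := inv_injective (mul_left_cancel e)
          have hinjγ : Function.Injective γ := by
            intro g h hgh
            ext i j
            have := congr_arg (fun M : SL(2, ℝ) => M i j) hgh
            simpa [γ] using this
          exact hinjγ e2
        · exact fun g => ((continuous_mul_const (γ g)⁻¹).measurable hB).inter hD
    _ ≤ haarSL D := measure_mono (iUnion_subset fun _ => inter_subset_right)

/-- `D` is a fundamental domain for the action of `SL(2,ℤ)`. -/
structure IsSection (D : Set SL(2, ℝ)) : Prop where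
  measurable : MeasurableSet D
  inj : InjOn toLattice D
  cover : ∀ᵐ M ∂haarSL, ∃ N ∈ D, toLattice M = toLattice N

/-- A section is one of the competitors in the supremum, and by `haarSL_le_of_cover` no other one
has a larger image. -/
lemma IsSection.latticeMeasure_eq {D : Set SL(2, ℝ)} (hD : IsSection D) :
    latticeMeasure = (haarSL.restrict D).map toLattice := by
  refine le_antisymm (iSup_le fun B => ?_) (le_iSup (fun B : {B : Set SL(2, ℝ) //
    MeasurableSet B ∧ InjOn toLattice B} => (haarSL.restrict B.1).map toLattice)
    ⟨D, hD.measurable, hD.inj⟩)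
  refine Measure.le_iff.2 fun A hA => ?_
  have hA' := measurable_toLattice hA
  rw [Measure.map_apply measurable_toLattice hA, Measure.map_apply measurable_toLattice hA,
    Measure.restrict_apply hA', Measure.restrict_apply hA']
  refine haarSL_le_of_cover (hA'.inter B.2.1) (hA'.inter hD.measurable)
    (B.2.2.mono inter_subset_right) ?_
  filter_upwards [hD.cover] with M hM hMB
  obtain ⟨N, hN, hMN⟩ := hM
  exact ⟨N, ⟨by rw [mem_preimage, ← hMN]; exact hMB.1, hN⟩, hMN⟩

lemma IsSection.latticeMeasure_univ {D : Set SL(2, ℝ)} (hD : IsSection D) :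
    latticeMeasure univ = haarSL D := by
  rw [hD.latticeMeasure_eq, Measure.map_apply measurable_toLattice MeasurableSet.univ,
    preimage_univ, Measure.restrict_apply_univ]

lemma measurableSet_image_toLattice {B : Set SL(2, ℝ)} (hB : MeasurableSet B) :
    MeasurableSet (toLattice '' B) := by
  have h : MeasurableSet (toLattice ⁻¹' (toLattice '' B)) := by
    have : toLattice ⁻¹' (toLattice '' B) = ⋃ g : SL(2, ℤ),
        (fun M => M * Matrix.SpecialLinearGroup.map (Int.castRingHom ℝ) g) ⁻¹' B := by
      ext M
      simp only [mem_preimage, mem_image, mem_iUnion]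
      constructor
      · rintro ⟨N, hN, h⟩
        obtain ⟨g, rfl⟩ := toLattice_eq_iff.1 h.symm
        exact ⟨g, hN⟩
      · rintro ⟨g, hg⟩
        exact ⟨_, hg, (toLattice_eq_iff.2 ⟨g, rfl⟩).symm⟩
    rw [this]
    exact MeasurableSet.iUnion fun g => (continuous_mul_const _).measurable hB
  exact h

lemma IsSection.latticeMeasure_image {D : Set SL(2, ℝ)} (hD : IsSection D) {B : Set SL(2, ℝ)}
    (hB : MeasurableSet B) (hinj : InjOn toLattice B) :
    latticeMeasure (toLattice '' B) = haarSL B := by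
  have hm := measurableSet_image_toLattice hB
  rw [hD.latticeMeasure_eq, Measure.map_apply measurable_toLattice hm,
    Measure.restrict_apply (measurable_toLattice hm)]
  refine le_antisymm (haarSL_le_of_cover ((measurable_toLattice hm).inter hD.measurable) hB
    (hD.inj.mono inter_subset_right) (Eventually.of_forall ?_))
    (haarSL_le_of_cover hB ((measurable_toLattice hm).inter hD.measurable) hinj ?_)
  · rintro M ⟨⟨N, hN, h⟩, -⟩
    exact ⟨N, hN, h.symm⟩
  · filter_upwards [hD.cover] with M hM hMB
    obtain ⟨N, hN, hMN⟩ := hM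
    exact ⟨N, ⟨⟨M, hMB, hMN⟩, hN⟩, hMN⟩

lemma measurable_smul_lattice (g : SL(2, ℝ)) : Measurable fun Λ : LatticeSpace => g • Λ := by
  refine measurable_from_quotient.2 ?_
  exact measurable_toLattice.comp (continuous_const_mul g).measurable

/-- The translate of a section is again a competitor in the supremum, so g does not increase the
measure. The inverse of g gives the other inequality. -/
lemma smulInvariant_latticeMeasure {D : Set SL(2, ℝ)} (hD : IsSection D) :
    SMulInvariantMeasure SL(2, ℝ) LatticeSpace latticeMeasure := by
  have key : ∀ (g : SL(2, ℝ)) {A : Set LatticeSpace}, MeasurableSet A →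
      latticeMeasure ((fun Λ => g • Λ) ⁻¹' A) ≤ latticeMeasure A := by
    intro g A hA
    have h : latticeMeasure.map (fun Λ => g • Λ) ≤ latticeMeasure := by
      conv_lhs => rw [hD.latticeMeasure_eq]
      rw [Measure.map_map (measurable_smul_lattice g) measurable_toLattice]
      refine le_trans (le_of_eq ?_) (le_iSup (fun B : {B : Set SL(2, ℝ) //
        MeasurableSet B ∧ InjOn toLattice B} => (haarSL.restrict B.1).map toLattice)
        ⟨(fun M => g⁻¹ * M) ⁻¹' D, (continuous_const_mul g⁻¹).measurable hD.measurable, ?_⟩)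
      · have h1 : (fun Λ : LatticeSpace => g • Λ) ∘ toLattice = toLattice ∘ fun M => g * M := rfl
        rw [h1, ← Measure.map_map measurable_toLattice (continuous_const_mul g).measurable]
        congr 1
        have h2 := (measurePreserving_haarSL_mul_left g).restrict_preimage
          ((continuous_const_mul g⁻¹).measurable hD.measurable)
        have h3 : (fun M => g * M) ⁻¹' ((fun M => g⁻¹ * M) ⁻¹' D) = D := by
          ext M; simp
        rw [h3] at h2
        exact h2.map_eq
      · intro M hM N hN h
        have : g⁻¹ * M = g⁻¹ * N := hD.inj hM hN (by
          have := congr_arg (fun Λ : LatticeSpace => g⁻¹ • Λ) h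
          exact this)
        exact mul_left_cancel this
    have := Measure.le_iff.1 h A hA
    rwa [Measure.map_apply (measurable_smul_lattice g) hA] at this
  refine ⟨fun g A hA => le_antisymm (key g hA) ?_⟩
  have := key g⁻¹ (measurable_smul_lattice g hA)
  rwa [← preimage_comp, show ((fun Λ : LatticeSpace => g • Λ) ∘ fun Λ => g⁻¹ • Λ) = id by
    ext Λ; simp, preimage_id] at this

/-! ### Generic lattices -/

lemma haarSL_ae {P : SL(2, ℝ) → Prop} (hP : MeasurableSet {M | P M})
    (h : ∀ᵐ a : Fin 2 → Fin 2 → ℝ, 0 < (Matrix.of a).det → P (unimodular (Matrix.of a))) :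
    ∀ᵐ M ∂haarSL, P M := by
  refine Measure.ae_smul_measure ?_ _
  rw [ae_map_iff measurable_unimodular.aemeasurable hP]
  refine (ae_restrict_iff' measurableSet_detRegion).2 ?_
  filter_upwards [h] with a ha h2 using ha h2.1

/-- Each nontrivial integral relation defines a hyperplane of ℝ⁴, which is null, and there are
countably many. The relations are homogeneous, so they are insensitive to the normalization of the
determinant. -/
lemma haarSL_ae_isGeneric : ∀ᵐ M ∂haarSL, IsGeneric M := by
  refine ae_all_iff.2 fun k => ae_all_iff.2 fun l => ae_all_iff.2 fun m => ae_all_iff.2 fun n => ?_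
  by_cases h0 : k = 0 ∧ l = 0 ∧ m = 0 ∧ n = 0
  · exact Eventually.of_forall fun _ _ => h0
  have hlin : Measurable fun M : SL(2, ℝ) => M 0 0 * k + M 0 1 * l + M 1 0 * m + M 1 1 * n :=
    ((((measurable_entry 0 0).mul_const _).add ((measurable_entry 0 1).mul_const _)).add
      ((measurable_entry 1 0).mul_const _)).add ((measurable_entry 1 1).mul_const _)
  simp only [h0, imp_false]
  refine haarSL_ae (measurableSet_eq_fun hlin measurable_const).compl ?_
  let φ : (Fin 2 → Fin 2 → ℝ) →ₗ[ℝ] ℝ :=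
    { toFun := fun a => a 0 0 * k + a 0 1 * l + a 1 0 * m + a 1 1 * n
      map_add' := fun a b => by simp only [Pi.add_apply]; ring
      map_smul' := fun c a => by
        simp only [Pi.smul_apply, smul_eq_mul, RingHom.id_apply]; ring }
  have hker : LinearMap.ker φ ≠ ⊤ := by
    intro h
    have hz : φ = 0 := LinearMap.ker_eq_top.1 h
    have e : ∀ a : Fin 2 → Fin 2 → ℝ, a 0 0 * k + a 0 1 * l + a 1 0 * m + a 1 1 * n = 0 :=
      fun a => LinearMap.congr_fun hz a
    have e1 := e ![![1, 0], ![0, 0]]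
    have e2 := e ![![0, 1], ![0, 0]]
    have e3 := e ![![0, 0], ![1, 0]]
    have e4 := e ![![0, 0], ![0, 1]]
    simp at e1 e2 e3 e4
    exact h0 ⟨e1, e2, e3, e4⟩
  have hnull := Measure.addHaar_submodule (volume : Measure (Fin 2 → Fin 2 → ℝ)) _ hker
  filter_upwards [measure_eq_zero_iff_ae_notMem.1 hnull] with a ha hdet h
  apply ha
  rw [coe_unimodular hdet] at h
  simp only [Matrix.smul_apply, Matrix.of_apply, smul_eq_mul] at h
  have hs : (Real.sqrt (Matrix.of a).det)⁻¹ ≠ 0 := (inv_pos.2 (Real.sqrt_pos.2 hdet)).ne'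
  have : (Real.sqrt (Matrix.of a).det)⁻¹ * (a 0 0 * k + a 0 1 * l + a 1 0 * m + a 1 1 * n) = 0 := by
    linear_combination h
  exact (mul_eq_zero.1 this).resolve_left hs

/-! ### The Haar measure in the coordinates of a flow box -/

/-- A cyclic permutation of three of the entries. -/
def rotateEntries : (Fin 2 → Fin 2 → ℝ) →ₗ[ℝ] Fin 2 → Fin 2 → ℝ where
  toFun a := ![![a 0 0, a 1 1], ![a 0 1, a 1 0]]
  map_add' a b := by ext i j; fin_cases i <;> fin_cases j <;> rfl
  map_smul' c a := by ext i j; fin_cases i <;> fin_cases j <;> rfl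

/-- The diagonal and the antidiagonal of a matrix. -/
def diagonals (a : Fin 2 → Fin 2 → ℝ) : (ℝ × ℝ) × (ℝ × ℝ) := ((a 0 0, a 1 1), (a 0 1, a 1 0))

lemma measurePreserving_diagonals : MeasurePreserving diagonals volume volume := by
  have h1 : MeasurePreserving rotateEntries volume volume := by
    refine measurePreserving_of_pow_eq_one three_ne_zero ?_
    refine LinearMap.ext fun a => ?_
    rw [pow_succ, pow_two]
    ext i j
    fin_cases i <;> fin_cases j <;> rfl
  have h2 : MeasurePreserving (fun (a : Fin 2 → Fin 2 → ℝ) (i : Fin 2) =>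
      MeasurableEquiv.finTwoArrow (a i)) volume volume :=
    volume_preserving_pi fun _ => volume_preserving_finTwoArrow ℝ
  exact (volume_preserving_finTwoArrow (ℝ × ℝ)).comp (h2.comp h1)

/-- The hyperbolic coordinates `(r, t) ↦ (r eᵗ, r e⁻ᵗ)`. -/
def hyperbolic (w : ℝ × ℝ) : ℝ × ℝ := (w.1 * Real.exp w.2, w.1 * Real.exp (-w.2))

lemma hyperbolic_image : hyperbolic '' (Ioi 0 ×ˢ univ) = Ioi 0 ×ˢ Ioi 0 := by
  ext ⟨a, d⟩
  constructor
  · rintro ⟨⟨r, t⟩, ⟨hr, -⟩, h⟩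
    obtain ⟨rfl, rfl⟩ := Prod.mk.inj h
    exact ⟨mul_pos hr (Real.exp_pos _), mul_pos hr (Real.exp_pos _)⟩
  · rintro ⟨ha, hd⟩
    have ha' : 0 < a := ha
    have hd' : 0 < d := hd
    have e1 : Real.exp (Real.log a / 2) * Real.exp (Real.log a / 2) = a := by
      rw [← Real.exp_add, add_halves, Real.exp_log ha']
    have e2 : Real.exp (Real.log d / 2) * Real.exp (Real.log d / 2) = d := by
      rw [← Real.exp_add, add_halves, Real.exp_log hd']
    refine ⟨(Real.exp (Real.log a / 2 + Real.log d / 2), Real.log a / 2 - Real.log d / 2),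
      ⟨Real.exp_pos _, trivial⟩, ?_⟩
    refine Prod.ext ?_ ?_
    · simp only [hyperbolic]
      rw [← Real.exp_add, ← e1, ← Real.exp_add]
      simp only [Real.log_exp]
      congr 1
      ring
    · simp only [hyperbolic]
      rw [← Real.exp_add, ← e2, ← Real.exp_add]
      simp only [Real.log_exp]
      congr 1
      ring

lemma hyperbolic_log {w : ℝ × ℝ} (hw : 0 < w.1) :
    1 / 2 * Real.log ((hyperbolic w).1 / (hyperbolic w).2) = w.2 := by
  have : (hyperbolic w).1 / (hyperbolic w).2 = Real.exp (2 * w.2) := by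
    simp only [hyperbolic]
    rw [mul_div_mul_left _ _ hw.ne', ← Real.exp_sub]
    congr 1
    ring
  rw [this, Real.log_exp]
  ring

lemma hyperbolic_mul (w : ℝ × ℝ) : (hyperbolic w).1 * (hyperbolic w).2 = w.1 ^ 2 := by
  simp only [hyperbolic]
  have : Real.exp w.2 * Real.exp (-w.2) = 1 := by rw [← Real.exp_add]; simp
  linear_combination w.1 ^ 2 * this

lemma hyperbolic_injOn : InjOn hyperbolic (Ioi 0 ×ˢ univ) := by
  rintro w ⟨hw, -⟩ w' ⟨hw', -⟩ h
  have hw0 : 0 < w.1 := hw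
  have hw0' : 0 < w'.1 := hw'
  have h1 := hyperbolic_mul w
  rw [h, hyperbolic_mul] at h1
  have h2 := hyperbolic_log hw0
  rw [h, hyperbolic_log hw0'] at h2
  exact Prod.ext ((pow_left_inj₀ hw0.le hw0'.le two_ne_zero).1 h1.symm) h2.symm

/-- The derivative of the hyperbolic coordinates. -/
def hyperbolicDeriv (w : ℝ × ℝ) : ℝ × ℝ →L[ℝ] ℝ × ℝ :=
  LinearMap.toContinuousLinearMap (Matrix.toLin (Module.Basis.finTwoProd ℝ)
    (Module.Basis.finTwoProd ℝ) !![Real.exp w.2, w.1 * Real.exp w.2;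
      Real.exp (-w.2), -(w.1 * Real.exp (-w.2))])

lemma hasFDerivAt_hyperbolic (w : ℝ × ℝ) : HasFDerivAt hyperbolic (hyperbolicDeriv w) w := by
  unfold hyperbolicDeriv
  rw [Matrix.toLin_finTwoProd_toContinuousLinearMap]
  refine HasFDerivAt.congr_fderiv (HasFDerivAt.prodMk
    (hasFDerivAt_fst.mul hasFDerivAt_snd.exp)
    (hasFDerivAt_fst.mul hasFDerivAt_snd.fun_neg.exp)) ?_
  ext <;> simp

lemma det_hyperbolicDeriv (w : ℝ × ℝ) : (hyperbolicDeriv w).det = -(2 * w.1) := by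
  rw [hyperbolicDeriv, LinearMap.det_toContinuousLinearMap, LinearMap.det_toLin,
    Matrix.det_fin_two_of]
  have : Real.exp w.2 * Real.exp (-w.2) = 1 := by rw [← Real.exp_add]; simp
  linear_combination (-2 * w.1) * this

/-- The antidiagonal in the coordinates of the unit square. -/
def antidiagonalLin (ε : ℤˣ) (w : ℝ × ℝ) : ℝ × ℝ →ₗ[ℝ] ℝ × ℝ :=
  LinearMap.prodMap ((-((ε : ℤ) : ℝ) / w.1) • LinearMap.id) ((((ε : ℤ) : ℝ) / w.2) • LinearMap.id)

lemma antidiagonalLin_apply (ε : ℤˣ) (w q : ℝ × ℝ) :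
    antidiagonalLin ε w q = (-((ε : ℤ) : ℝ) * q.1 / w.1, ((ε : ℤ) : ℝ) * q.2 / w.2) := by
  refine Prod.ext ?_ ?_ <;> simp [antidiagonalLin] <;> ring

lemma volume_preimage_antidiagonalLin (ε : ℤˣ) {w : ℝ × ℝ} (h1 : 0 < w.1) (h2 : 0 < w.2)
    (s : Set (ℝ × ℝ)) :
    volume (antidiagonalLin ε w ⁻¹' s) = ENNReal.ofReal (w.1 * w.2) * volume s := by
  have he := sign_mul_self ε
  have hdet : LinearMap.det (antidiagonalLin ε w) = -(w.1 * w.2)⁻¹ := by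
    rw [antidiagonalLin, LinearMap.det_prodMap, LinearMap.det_smul, LinearMap.det_smul]
    simp only [Module.finrank_self, pow_one, LinearMap.det_id, mul_one]
    field_simp
    linear_combination -he
  have hp := mul_pos h1 h2
  rw [Measure.addHaar_preimage_linearMap _ (by rw [hdet]; exact (neg_neg_of_pos (inv_pos.2 hp)).ne),
    hdet, inv_neg, inv_inv, abs_neg, abs_of_pos hp]

lemma lintegral_cube {c : ℝ} (hc : 0 < c) :
    ∫⁻ r in Ioi (0 : ℝ), {r : ℝ | r ^ 2 * c ≤ 1}.indicator (fun r => ENNReal.ofReal (2 * r ^ 3)) r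
      = ENNReal.ofReal (1 / (2 * c ^ 2)) := by
  have hs : 0 < (Real.sqrt c)⁻¹ := inv_pos.2 (Real.sqrt_pos.2 hc)
  have hs2 : (Real.sqrt c)⁻¹ ^ 2 = c⁻¹ := by rw [inv_pow, Real.sq_sqrt hc.le]
  have hset : {r : ℝ | r ^ 2 * c ≤ 1} ∩ Ioi 0 = Ioc 0 (Real.sqrt c)⁻¹ := by
    ext r
    simp only [mem_inter_iff, mem_ofPred_eq, mem_Ioi, mem_Ioc]
    constructor
    · rintro ⟨h1, h0⟩
      refine ⟨h0, ?_⟩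
      refine (pow_le_pow_iff_left₀ h0.le hs.le two_ne_zero).1 ?_
      rw [hs2, ← one_div, le_div_iff₀ hc]
      exact h1
    · rintro ⟨h0, h1⟩
      refine ⟨?_, h0⟩
      have := (pow_le_pow_iff_left₀ h0.le hs.le two_ne_zero).2 h1
      rwa [hs2, ← one_div, le_div_iff₀ hc] at this
  have hm : MeasurableSet {r : ℝ | r ^ 2 * c ≤ 1} :=
    measurableSet_le (by fun_prop) measurable_const
  rw [lintegral_indicator hm, Measure.restrict_restrict hm, hset,
    ← ofReal_integral_eq_lintegral_ofReal]
  · rw [← intervalIntegral.integral_of_le hs.le, intervalIntegral.integral_const_mul, integral_pow]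
    congr 1
    have : (Real.sqrt c)⁻¹ ^ (3 + 1) = (c⁻¹) ^ 2 := by rw [← hs2]; ring
    rw [this]
    field_simp
    norm_num
  · exact (by fun_prop : Continuous fun r : ℝ => 2 * r ^ 3).integrableOn_Ioc
  · filter_upwards [ae_restrict_mem measurableSet_Ioc] with r hr
    have := hr.1.le
    positivity

/-- The open cone of the matrices `(a, -εb; εc, d)` with `0 < b < a` and `0 < c < d`. -/
def cell (ε : ℤˣ) : Set SL(2, ℝ) := {M | 0 < M 0 0 ∧ 0 < M 1 1 ∧
  (-((ε : ℤ) : ℝ) * M 0 1 / M 0 0, ((ε : ℤ) : ℝ) * M 1 0 / M 1 1) ∈ unitSquare}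

/-- The coordinates `(t, p)` of a matrix `frame t p ε`. -/
def cellCoord (ε : ℤˣ) (M : SL(2, ℝ)) : ℝ × (ℝ × ℝ) :=
  (1 / 2 * Real.log (M 0 0 / M 1 1),
    (-((ε : ℤ) : ℝ) * M 0 1 / M 0 0, ((ε : ℤ) : ℝ) * M 1 0 / M 1 1))

lemma measurable_cellCoord (ε : ℤˣ) : Measurable (cellCoord ε) := by
  have h1 := measurable_entry 0 0
  have h2 := measurable_entry 0 1
  have h3 := measurable_entry 1 0
  have h4 := measurable_entry 1 1
  exact ((Real.measurable_log.comp (h1.div h4)).const_mul _).prodMk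
    (((h2.const_mul _).div h1).prodMk ((h3.const_mul _).div h4))

lemma measurableSet_cell (ε : ℤˣ) : MeasurableSet (cell ε) :=
  (measurableSet_lt measurable_const (measurable_entry 0 0)).inter
    ((measurableSet_lt measurable_const (measurable_entry 1 1)).inter
      ((measurable_cellCoord ε).snd measurableSet_unitSquare))

/-- The part of a cone over a cell, in the diagonal and the antidiagonal entries. -/
def cellCone (ε : ℤˣ) (K : Set (ℝ × (ℝ × ℝ))) : Set ((ℝ × ℝ) × (ℝ × ℝ)) :=
  {z | 0 < z.1.1 ∧ 0 < z.1.2 ∧ antidiagonalLin ε z.1 z.2 ∈ unitSquare ∧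
    z.1.1 * z.1.2 * (1 + (antidiagonalLin ε z.1 z.2).1 * (antidiagonalLin ε z.1 z.2).2) ≤ 1 ∧
    (1 / 2 * Real.log (z.1.1 / z.1.2), antidiagonalLin ε z.1 z.2) ∈ K}

lemma measurableSet_cellCone (ε : ℤˣ) {K : Set (ℝ × (ℝ × ℝ))} (hK : MeasurableSet K) :
    MeasurableSet (cellCone ε K) := by
  have h1 : Measurable fun z : (ℝ × ℝ) × (ℝ × ℝ) => z.1.1 := by fun_prop
  have h2 : Measurable fun z : (ℝ × ℝ) × (ℝ × ℝ) => z.1.2 := by fun_prop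
  have h3 : Measurable fun z : (ℝ × ℝ) × (ℝ × ℝ) => antidiagonalLin ε z.1 z.2 := by
    simp only [antidiagonalLin_apply]
    fun_prop
  have h4 : MeasurableSet {z : (ℝ × ℝ) × (ℝ × ℝ) | z.1.1 * z.1.2 *
      (1 + (antidiagonalLin ε z.1 z.2).1 * (antidiagonalLin ε z.1 z.2).2) ≤ 1} :=
    measurableSet_le ((h1.mul h2).mul ((h3.fst.mul h3.snd).const_add 1)) measurable_const
  have h5 : Measurable fun z : (ℝ × ℝ) × (ℝ × ℝ) =>
      (1 / 2 * Real.log (z.1.1 / z.1.2), antidiagonalLin ε z.1 z.2) :=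
    ((Real.measurable_log.comp (h1.div h2)).const_mul _).prodMk h3
  exact (measurableSet_lt measurable_const h1).inter ((measurableSet_lt measurable_const h2).inter
    ((h3 measurableSet_unitSquare).inter (h4.inter (h5 hK))))

/-- The coordinates t, x, y are homogeneous of degree zero in the matrix, so normalizing the
determinant does not change them, and the determinant is ad(1 + xy). -/
lemma preimage_cellCone (ε : ℤˣ) (K : Set (ℝ × (ℝ × ℝ))) :
    diagonals ⁻¹' cellCone ε K
      = {a | unimodular (Matrix.of a) ∈ cell ε ∩ cellCoord ε ⁻¹' K} ∩ detRegion := by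
  ext a
  have he := sign_mul_self ε
  have hdet : 0 < a 0 0 → 0 < a 1 1 → a 0 0 * a 1 1 *
      (1 + (-((ε : ℤ) : ℝ) * a 0 1 / a 0 0) * (((ε : ℤ) : ℝ) * a 1 0 / a 1 1))
      = (Matrix.of a).det := by
    intro h1 h2
    rw [Matrix.det_fin_two]
    simp only [Matrix.of_apply]
    field_simp
    linear_combination (-a 0 1 * a 1 0) * he
  have hentry : ∀ i j, 0 < (Matrix.of a).det →
      unimodular (Matrix.of a) i j = (Real.sqrt (Matrix.of a).det)⁻¹ * a i j := by
    intro i j h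
    rw [coe_unimodular h]
    rfl
  have hscale : 0 < (Matrix.of a).det → cellCoord ε (unimodular (Matrix.of a))
      = (1 / 2 * Real.log (a 0 0 / a 1 1),
        (-((ε : ℤ) : ℝ) * a 0 1 / a 0 0, ((ε : ℤ) : ℝ) * a 1 0 / a 1 1)) := by
    intro h
    have hs : (Real.sqrt (Matrix.of a).det)⁻¹ ≠ 0 := (inv_pos.2 (Real.sqrt_pos.2 h)).ne'
    simp only [cellCoord, hentry _ _ h]
    rw [mul_div_mul_left _ _ hs, mul_left_comm, mul_div_mul_left _ _ hs, mul_left_comm,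
      mul_div_mul_left _ _ hs]
  have hcell : 0 < (Matrix.of a).det → (unimodular (Matrix.of a) ∈ cell ε ↔ 0 < a 0 0 ∧ 0 < a 1 1 ∧
      (-((ε : ℤ) : ℝ) * a 0 1 / a 0 0, ((ε : ℤ) : ℝ) * a 1 0 / a 1 1) ∈ unitSquare) := by
    intro h
    have hs : 0 < (Real.sqrt (Matrix.of a).det)⁻¹ := inv_pos.2 (Real.sqrt_pos.2 h)
    have h2 := congr_arg Prod.snd (hscale h)
    simp only [cellCoord] at h2
    rw [cell, mem_ofPred_eq, h2, hentry _ _ h, hentry _ _ h, mul_pos_iff_of_pos_left hs,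
      mul_pos_iff_of_pos_left hs]
  simp only [mem_preimage, cellCone, diagonals, antidiagonalLin_apply, mem_ofPred_eq, mem_inter_iff,
    detRegion]
  constructor
  · rintro ⟨h1, h2, h3, h4, h5⟩
    rw [hdet h1 h2] at h4
    have hpos : 0 < (Matrix.of a).det := by
      rw [← hdet h1 h2]
      exact mul_pos (mul_pos h1 h2) (one_add_mul_pos h3)
    rw [hscale hpos, hcell hpos]
    exact ⟨⟨⟨h1, h2, h3⟩, h5⟩, hpos, h4⟩
  · rintro ⟨⟨hc, h5⟩, hpos, h4⟩
    rw [hscale hpos] at h5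
    obtain ⟨h1, h2, h3⟩ := (hcell hpos).1 hc
    refine ⟨h1, h2, h3, ?_, h5⟩
    rw [hdet h1 h2]
    exact h4

/-- The Haar measure in the coordinates of a cell. -/
theorem haarSL_cell (ε : ℤˣ) {K : Set (ℝ × (ℝ × ℝ))} (hK : MeasurableSet K) :
    haarSL (cell ε ∩ cellCoord ε ⁻¹' K) = (volume.prod squareMeasure) K := by
  have hcone := measurableSet_cellCone ε hK
  let H : ℝ × ℝ → Set (ℝ × ℝ) := fun w =>
    {p | p ∈ unitSquare ∧ w.1 ^ 2 * (1 + p.1 * p.2) ≤ 1 ∧ (w.2, p) ∈ K}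
  -- For a fixed diagonal (a, d), passing from the antidiagonal to (x, y) scales areas by ad = r².
  have hpre : ∀ w ∈ Ioi (0 : ℝ) ×ˢ (univ : Set ℝ), volume (Prod.mk (hyperbolic w) ⁻¹' cellCone ε K)
      = ENNReal.ofReal (w.1 ^ 2) * volume (H w) := by
    intro w hw
    have hw' : hyperbolic w ∈ Ioi (0 : ℝ) ×ˢ Ioi (0 : ℝ) := by
      rw [← hyperbolic_image]; exact mem_image_of_mem _ hw
    rw [← hyperbolic_mul, ← volume_preimage_antidiagonalLin ε hw'.1 hw'.2]
    congr 1
    ext q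
    simp only [mem_preimage, cellCone, mem_ofPred_eq, H]
    rw [hyperbolic_log hw.1, hyperbolic_mul]
    exact ⟨fun h => h.2.2, fun h => ⟨hw'.1, hw'.2, h⟩⟩
  let S : ℝ × ℝ → Set ℝ := fun p => {r | r ^ 2 * (1 + p.1 * p.2) ≤ 1}
  -- The weight 2r³ is the Jacobian 2r of the hyperbolic coordinates times the factor r² of the
  -- antidiagonal.
  let g : ℝ → ℝ → ℝ × ℝ → ENNReal := fun r t p =>
    (S p).indicator (fun r => ENNReal.ofReal (2 * r ^ 3)) r * K.indicator 1 (t, p)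
  have hgm : Measurable fun z : (ℝ × ℝ) × (ℝ × ℝ) => g z.1.1 z.1.2 z.2 := by
    have hS : MeasurableSet {z : (ℝ × ℝ) × (ℝ × ℝ) | z.1.1 ∈ S z.2} :=
      measurableSet_le (f := fun z : (ℝ × ℝ) × (ℝ × ℝ) => z.1.1 ^ 2 * (1 + z.2.1 * z.2.2))
        (by fun_prop) measurable_const
    have h1 : Measurable ({z : (ℝ × ℝ) × (ℝ × ℝ) | z.1.1 ∈ S z.2}.indicator
        fun z => ENNReal.ofReal (2 * z.1.1 ^ 3)) :=
      Measurable.indicator (by fun_prop) hS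
    exact h1.mul ((measurable_one.indicator hK).comp (measurable_fst.snd.prodMk measurable_snd))
  have hH : ∀ w : ℝ × ℝ, ENNReal.ofReal (2 * w.1 ^ 3) * volume (H w)
      = ∫⁻ p in unitSquare, g w.1 w.2 p := by
    intro w
    have hm1 : MeasurableSet {p : ℝ × ℝ | w.1 ^ 2 * (1 + p.1 * p.2) ≤ 1} :=
      measurableSet_le (by fun_prop) measurable_const
    have hm2 : MeasurableSet {p : ℝ × ℝ | (w.2, p) ∈ K} := measurable_prodMk_left hK
    have hm : MeasurableSet {p : ℝ × ℝ | w.1 ^ 2 * (1 + p.1 * p.2) ≤ 1 ∧ (w.2, p) ∈ K} :=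
      hm1.inter hm2
    have e : H w = {p : ℝ × ℝ | w.1 ^ 2 * (1 + p.1 * p.2) ≤ 1 ∧ (w.2, p) ∈ K} ∩ unitSquare := by
      ext p
      simp only [H, mem_ofPred_eq, mem_inter_iff]
      tauto
    rw [e, ← Measure.restrict_apply hm, ← lintegral_indicator_const hm]
    refine lintegral_congr fun p => ?_
    by_cases h1 : w.1 ∈ S p
    · by_cases h2 : (w.2, p) ∈ K
      · rw [indicator_of_mem (by exact ⟨h1, h2⟩)]
        simp only [g]
        rw [indicator_of_mem h1, indicator_of_mem h2, Pi.one_apply, mul_one]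
      · rw [indicator_of_notMem (by exact fun h => h2 h.2)]
        simp only [g]
        rw [indicator_of_notMem h2, mul_zero]
    · rw [indicator_of_notMem (by exact fun h => h1 h.1)]
      simp only [g]
      rw [indicator_of_notMem h1, zero_mul]
  have hsupp : Function.support (fun w => volume (Prod.mk w ⁻¹' cellCone ε K))
      ⊆ Ioi (0 : ℝ) ×ˢ Ioi (0 : ℝ) := by
    intro w hw
    obtain ⟨q, hq⟩ := nonempty_of_measure_ne_zero hw
    exact ⟨hq.1, hq.2.1⟩
  have hvol : volume (cellCone ε K) = ∫⁻ t, ∫⁻ p in unitSquare,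
      K.indicator 1 (t, p) * ENNReal.ofReal (1 / (2 * (1 + p.1 * p.2) ^ 2)) := by
    calc volume (cellCone ε K) = ∫⁻ w, volume (Prod.mk w ⁻¹' cellCone ε K) := by
          rw [Measure.volume_eq_prod, Measure.prod_apply hcone]
      _ = ∫⁻ w in hyperbolic '' (Ioi 0 ×ˢ univ), volume (Prod.mk w ⁻¹' cellCone ε K) := by
          rw [hyperbolic_image, setLIntegral_eq_of_support_subset hsupp]
      _ = ∫⁻ w in Ioi 0 ×ˢ univ, ∫⁻ p in unitSquare, g w.1 w.2 p := by
          rw [lintegral_image_eq_lintegral_abs_det_fderiv_mul volume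
            (measurableSet_Ioi.prod MeasurableSet.univ)
            (fun w _ => (hasFDerivAt_hyperbolic w).hasFDerivWithinAt) hyperbolic_injOn]
          refine setLIntegral_congr_fun (measurableSet_Ioi.prod MeasurableSet.univ) fun w hw => ?_
          have hw0 : 0 < w.1 := hw.1
          rw [hpre w hw, ← hH, det_hyperbolicDeriv, abs_neg, abs_of_pos (by linarith), ← mul_assoc,
            ← ENNReal.ofReal_mul (by linarith)]
          congr 2
          ring
      _ = ∫⁻ t, ∫⁻ r in Ioi 0, ∫⁻ p in unitSquare, g r t p := by
          rw [Measure.volume_eq_prod, ← Measure.prod_restrict, Measure.restrict_univ,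
            lintegral_prod_symm' _ hgm.lintegral_prod_right']
      _ = _ := by
          refine lintegral_congr fun t => ?_
          rw [lintegral_lintegral_swap]
          · refine setLIntegral_congr_fun measurableSet_unitSquare fun p hp => ?_
            simp only [g]
            rw [lintegral_mul_const, lintegral_cube (one_add_mul_pos hp), mul_comm]
            exact Measurable.indicator (by fun_prop) (measurableSet_le (by fun_prop) measurable_const)
          · exact (hgm.comp ((measurable_fst.prodMk measurable_const).prodMk
              measurable_snd)).aemeasurable
  rw [haarSL_apply ((measurableSet_cell ε).inter (measurable_cellCoord ε hK)),
    ← preimage_cellCone, measurePreserving_diagonals.measure_preimage hcone.nullMeasurableSet, hvol,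
    Measure.prod_apply hK, ← lintegral_const_mul' _ _ ENNReal.ofNat_ne_top]
  refine lintegral_congr fun t => ?_
  have hKt : MeasurableSet (Prod.mk t ⁻¹' K) := measurable_prodMk_left hK
  rw [← lintegral_const_mul' _ _ ENNReal.ofNat_ne_top, ← lintegral_indicator_one hKt,
    lintegral_squareMeasure (measurable_one.indicator hKt)]
  refine setLIntegral_congr_fun measurableSet_unitSquare fun p hp => ?_
  have e : (Prod.mk t ⁻¹' K).indicator (1 : ℝ × ℝ → ENNReal) p = K.indicator 1 (t, p) := rfl
  have e2 : (2 : ENNReal) = ENNReal.ofReal 2 := by simp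
  have hpos := one_add_mul_pos hp
  -- The factor 2 of Siegel's normalization cancels the ½ of the radial integral.
  rw [e, mul_left_comm, mul_comm, e2, ← ENNReal.ofReal_mul zero_le_two]
  congr 2
  field_simp

/-! ### A fundamental domain and the mass of the space of lattices -/

lemma cellCoord_frame (t : ℝ) {p : ℝ × ℝ} (hp : p ∈ unitSquare) (ε : ℤˣ) :
    cellCoord ε (frame t p ε) = (t, p) := by
  obtain ⟨ha, hd, hb, hc, hab, hcd⟩ := frame_pos t hp ε
  obtain ⟨h1, h2⟩ := eq_frame ha hd hb hc hab hcd
  obtain ⟨e1, e2, -⟩ := frame_inj hp h1 h2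
  exact Prod.ext e1.symm e2.symm

lemma frame_mem_cell (t : ℝ) {p : ℝ × ℝ} (hp : p ∈ unitSquare) (ε : ℤˣ) :
    frame t p ε ∈ cell ε := by
  obtain ⟨ha, hd, hb, hc, hab, hcd⟩ := frame_pos t hp ε
  exact ⟨ha, hd, (eq_frame ha hd hb hc hab hcd).1⟩

lemma eq_frame_of_mem_cell {ε : ℤˣ} {M : SL(2, ℝ)} (hM : M ∈ cell ε) :
    M = frame (cellCoord ε M).1 (cellCoord ε M).2 ε := by
  obtain ⟨ha, hd, ⟨hx0, hx1⟩, ⟨hy0, hy1⟩⟩ := hM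
  simp only at hx0 hx1 hy0 hy1
  have hb := (div_pos_iff_of_pos_right ha).1 hx0
  have hc := (div_pos_iff_of_pos_right hd).1 hy0
  rw [div_lt_one ha] at hx1
  rw [div_lt_one hd] at hy1
  refine (eq_frame ha hd hb hc ?_ ?_).2
  · rwa [← abs_of_pos hb, abs_mul, abs_neg, abs_sign, one_mul] at hx1
  · rwa [← abs_of_pos hc, abs_mul, abs_sign, one_mul] at hy1

lemma mem_cell_inter {ε : ℤˣ} {K : Set (ℝ × (ℝ × ℝ))} {M : SL(2, ℝ)} :
    M ∈ cell ε ∩ cellCoord ε ⁻¹' K ↔ ∃ t, ∃ p ∈ unitSquare, (t, p) ∈ K ∧ M = frame t p ε := by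
  constructor
  · rintro ⟨h1, h2⟩
    exact ⟨_, _, h1.2.2, h2, eq_frame_of_mem_cell h1⟩
  · rintro ⟨t, p, hp, hK, rfl⟩
    refine ⟨frame_mem_cell t hp ε, ?_⟩
    rw [mem_preimage, cellCoord_frame t hp]
    exact hK

lemma flow_smul_frame (s t : ℝ) (p : ℝ × ℝ) (ε : ℤˣ) :
    flow s • toLattice (frame t p ε) = toLattice (frame (s + t) p ε) := by
  rw [← flow_smul_param, ← flow_smul_param, flow_add, mul_smul]

/-- Boxes of orbit segments that do not come back to the transversal embed in the space of
lattices. -/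
lemma frame_inj_of_notMem {A : Set (ℝ × ℝ)} {T : ℝ × ℝ → ℝ} (hA : A ⊆ unitSquare)
    (hT : ∀ p ∈ A, ∀ ε s, 0 < s → s < T p → toLattice (frame s p ε) ∉ transversal)
    {p p' : ℝ × ℝ} (hp : p ∈ A) (hp' : p' ∈ A) {t t' : ℝ} (ht : t ∈ Ico 0 (T p))
    (ht' : t' ∈ Ico 0 (T p')) {ε ε' : ℤˣ}
    (h : toLattice (frame t p ε) = toLattice (frame t' p' ε')) : t = t' ∧ p = p' ∧ ε = ε' := by
  wlog htt : t ≤ t' generalizing p p' t t' ε ε'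
  · obtain ⟨h1, h2, h3⟩ := this hp' hp ht' ht h.symm (le_of_not_ge htt)
    exact ⟨h1.symm, h2.symm, h3.symm⟩
  -- Flowing back by the smaller time puts one lattice on the transversal and the other at time t' -
  -- t of its segment, which must then be zero.
  have h2 := congr_arg (fun Λ : LatticeSpace => flow (-t) • Λ) h
  simp only [flow_smul_frame, neg_add_cancel] at h2
  rcases htt.eq_or_lt with rfl | hlt
  · rw [neg_add_cancel, toLattice_frame_zero, toLattice_frame_zero] at h2
    exact ⟨rfl, param_injective (hA hp) (hA hp') h2⟩
  · exfalso
    refine hT p' hp' ε' (-t + t') (by linarith) (by linarith [ht.1, ht'.2]) ?_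
    rw [← h2, toLattice_frame_zero]
    exact param_mem_transversal (hA hp) ε

/-- The coordinates `(t, p)` of the lattices that have not yet come back to the transversal. -/
def returnRegion : Set (ℝ × (ℝ × ℝ)) :=
  {z | z.2 ∈ regularSquare ∧ 0 ≤ z.1 ∧ z.1 < returnTimeCoord z.2}

lemma measurableSet_returnRegion : MeasurableSet returnRegion :=
  (measurable_snd measurableSet_regularSquare).inter
    ((measurableSet_le measurable_const measurable_fst).inter
      (measurableSet_lt measurable_fst (measurable_returnTimeCoord.comp measurable_snd)))

/-- The orbit segments from the transversal to itself. -/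
def returnDomain : Set SL(2, ℝ) := ⋃ ε : ℤˣ, cell ε ∩ cellCoord ε ⁻¹' returnRegion

lemma notMem_transversal_of_regular : ∀ p ∈ regularSquare, ∀ (ε : ℤˣ) (s : ℝ), 0 < s →
    s < returnTimeCoord p → toLattice (frame s p ε) ∉ transversal := by
  intro p hp ε s h0 hs hmem
  exact absurd ((isLeast_visitTimes hp.1 ε hp.2).2 ⟨h0, hmem⟩) (not_le.2 hs)

/-- Segments before the first return cannot overlap, and by `IsGeneric.exists_frame` they reach
every generic lattice. -/
lemma isSection_returnDomain : IsSection returnDomain where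
  measurable := MeasurableSet.iUnion fun ε =>
    (measurableSet_cell ε).inter (measurable_cellCoord ε measurableSet_returnRegion)
  inj := by
    intro M hM N hN h
    obtain ⟨ε, hM⟩ := mem_iUnion.1 hM
    obtain ⟨ε', hN⟩ := mem_iUnion.1 hN
    obtain ⟨t, p, -, ⟨hp, ht⟩, rfl⟩ := mem_cell_inter.1 hM
    obtain ⟨t', p', -, ⟨hp', ht'⟩, rfl⟩ := mem_cell_inter.1 hN
    obtain ⟨rfl, rfl, rfl⟩ := frame_inj_of_notMem (fun p hp => hp.1)
      notMem_transversal_of_regular hp hp' ht ht' h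
    rfl
  cover := by
    filter_upwards [haarSL_ae_isGeneric] with M hM
    obtain ⟨p, hp, ε, t, hfr, h0, ht, h⟩ := hM.exists_frame
    exact ⟨_, mem_iUnion.2 ⟨ε, mem_cell_inter.2 ⟨t, p, hp, ⟨⟨hp, hfr⟩, h0, ht⟩, rfl⟩⟩, h⟩

lemma sum_units {α : Type*} [AddCommMonoid α] (c : α) : ∑ _ε : ℤˣ, c = c + c := by
  rw [Finset.sum_const, Finset.card_univ, Fintype.card_units_int, two_nsmul]

/-- On each sheet the section is the region under the graph of the return time, so its measure is
the integral π²/12 of this time. There are two sheets. -/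
lemma latticeMeasure_univ : latticeMeasure univ = ENNReal.ofReal (Real.pi ^ 2 / 6) := by
  have hcell : ∀ ε : ℤˣ, haarSL (cell ε ∩ cellCoord ε ⁻¹' returnRegion)
      = ENNReal.ofReal (Real.pi ^ 2 / 12) := by
    intro ε
    rw [haarSL_cell ε measurableSet_returnRegion, Measure.prod_apply_symm measurableSet_returnRegion,
      ← lintegral_returnTimeCoord]
    refine lintegral_congr_ae ?_
    filter_upwards [squareMeasure_ae_regular] with p hp
    have : (fun t => (t, p)) ⁻¹' returnRegion = Ico 0 (returnTimeCoord p) := by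
      ext t
      exact ⟨fun h => h.2, fun h => ⟨hp, h⟩⟩
    rw [this, Real.volume_Ico, sub_zero]
  rw [isSection_returnDomain.latticeMeasure_univ, returnDomain, measure_iUnion, tsum_fintype]
  · simp only [hcell]
    rw [sum_units, ← ENNReal.ofReal_add (by positivity) (by positivity)]
    congr 1
    ring
  · intro ε ε' hne
    refine disjoint_left.2 fun M hM hM' => hne ?_
    obtain ⟨t, p, hp, -, rfl⟩ := mem_cell_inter.1 hM
    obtain ⟨t', p', hp', -, h⟩ := mem_cell_inter.1 hM'
    exact (frame_inj hp hp' h).2.2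
  · exact fun ε => (measurableSet_cell ε).inter (measurable_cellCoord ε measurableSet_returnRegion)

/-! ### The induced measure -/

lemma measurable_param (ε : ℤˣ) : Measurable fun p : ℝ × ℝ => param p ε := by
  have h : Measurable fun p : ℝ × ℝ =>
      (![![1, -((ε : ℤ) : ℝ) * p.1], ![((ε : ℤ) : ℝ) * p.2, 1]] : Fin 2 → Fin 2 → ℝ) := by
    refine measurable_pi_iff.2 fun i => measurable_pi_iff.2 fun j => ?_
    fin_cases i <;> fin_cases j <;> simp <;> fun_prop
  exact measurable_toLattice.comp (measurable_unimodular.comp h)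

/-- The image is also that of the slice t = 0 of a cell, which is measurable in SL(2,ℝ), and
`toLattice` maps measurable sets to measurable sets. -/
lemma measurableSet_image_param (ε : ℤˣ) {N : Set (ℝ × ℝ)} (hN : MeasurableSet N)
    (hNs : N ⊆ unitSquare) : MeasurableSet ((fun p => param p ε) '' N) := by
  have h : (fun p => param p ε) '' N
      = toLattice '' (cell ε ∩ cellCoord ε ⁻¹' ({0} ×ˢ N)) := by
    ext Λ
    constructor
    · rintro ⟨p, hp, rfl⟩
      exact ⟨frame 0 p ε, mem_cell_inter.2 ⟨0, p, hNs hp, ⟨rfl, hp⟩, rfl⟩, toLattice_frame_zero p ε⟩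
    · rintro ⟨M, hM, rfl⟩
      obtain ⟨t, p, -, ⟨ht, hp⟩, rfl⟩ := mem_cell_inter.1 hM
      obtain rfl : t = 0 := ht
      exact ⟨p, hp, (toLattice_frame_zero p ε).symm⟩
  rw [h]
  exact measurableSet_image_toLattice ((measurableSet_cell ε).inter
    (measurable_cellCoord ε ((measurableSet_singleton 0).prod hN)))

lemma transversal_eq_iUnion : transversal = ⋃ ε : ℤˣ, (fun p => param p ε) '' unitSquare := by
  ext Λ
  rw [mem_transversal_iff_exists_param, mem_iUnion]
  constructor
  · rintro ⟨p, hp, ε, rfl⟩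
    exact ⟨ε, p, hp, rfl⟩
  · rintro ⟨ε, p, hp, rfl⟩
    exact ⟨p, hp, ε, rfl⟩

lemma measurableSet_transversal : MeasurableSet transversal := by
  rw [transversal_eq_iUnion]
  exact MeasurableSet.iUnion fun ε => measurableSet_image_param ε measurableSet_unitSquare subset_rfl

/-- The measure on the transversal that has the density `1 / (1 + x y)²` in the coordinates. -/
def transversalMeasure : Measure LatticeSpace := ∑ ε : ℤˣ, squareMeasure.map fun p => param p ε

lemma transversalMeasure_apply {A : Set LatticeSpace} (hA : MeasurableSet A) :
    transversalMeasure A = ∑ ε : ℤˣ, squareMeasure ((fun p => param p ε) ⁻¹' A) := by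
  rw [transversalMeasure, Measure.finsetSum_apply]
  exact Finset.sum_congr rfl fun ε _ => Measure.map_apply (measurable_param ε) hA

lemma transversalMeasure_ae {Q : LatticeSpace → Prop}
    (h : ∀ p ∈ regularSquare, ∀ ε, Q (param p ε)) : ∀ᵐ Λ ∂transversalMeasure, Q Λ := by
  have hm : MeasurableSet (⋃ ε : ℤˣ, (fun p => param p ε) '' regularSquare) :=
    MeasurableSet.iUnion fun ε =>
      measurableSet_image_param ε measurableSet_regularSquare fun _ hp => hp.1
  have h0 : transversalMeasure (⋃ ε : ℤˣ, (fun p => param p ε) '' regularSquare)ᶜ = 0 := by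
    rw [transversalMeasure_apply hm.compl]
    refine Finset.sum_eq_zero fun ε _ => ?_
    refine measure_eq_zero_iff_ae_notMem.2 (squareMeasure_ae_regular.mono fun p hp h => h ?_)
    exact mem_iUnion.2 ⟨ε, p, hp, rfl⟩
  filter_upwards [measure_eq_zero_iff_ae_notMem.1 h0] with Λ hΛ
  obtain ⟨ε, p, hp, rfl⟩ := mem_iUnion.1 (not_not.1 hΛ)
  exact h p hp ε

lemma transversalMeasure_compl : transversalMeasure transversalᶜ = 0 :=
  transversalMeasure_ae (Q := (· ∈ transversal)) fun _ hp ε => param_mem_transversal hp.1 ε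

lemma transversalMeasure_univ : transversalMeasure univ = ENNReal.ofReal (2 * Real.log 2) := by
  rw [transversalMeasure_apply MeasurableSet.univ]
  simp only [preimage_univ, squareMeasure_univ]
  rw [sum_units, ← ENNReal.ofReal_add log_two_pos.le log_two_pos.le, two_mul]

lemma transversalMeasure_transversal :
    transversalMeasure transversal = ENNReal.ofReal (2 * Real.log 2) := by
  rw [← transversalMeasure_univ]
  exact measure_congr (eventuallyEq_univ.2 transversalMeasure_compl)

/-- Already with n = 1 the bound is ½ ln((y + 1)/x) > ½ ln(1 + η). The return times are thus bounded
below where y > η, which makes the times of the flow boxes uniform. -/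
lemma notMem_transversal_of_height {η : ℝ} (hη : 0 < η) {p : ℝ × ℝ} (hp : p ∈ unitSquare)
    (hpη : η < p.2) (ε : ℤˣ) {s : ℝ} (h0 : 0 < s) (hs : s < 1 / 2 * Real.log (1 + η)) :
    toLattice (frame s p ε) ∉ transversal := by
  refine notMem_transversal_of_lt (n := 1) hp ε le_rfl (by rw [Nat.cast_one, one_mul]; exact hp.1.2)
    h0 (hs.trans ?_)
  have hx0 := hp.1.1
  refine mul_lt_mul_of_pos_left (Real.log_lt_log (by linarith) ?_) (by norm_num)
  rw [lt_div_iff₀ hx0, Nat.cast_one]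
  nlinarith [hp.1.2]

/-- A neighbourhood of matrices whose lattices meet the transversal only in the parameters of
height at least `η`. -/
def boxFrames (ε : ℤˣ) (η : ℝ) : Set SL(2, ℝ) :=
  {M | 0 < M 0 0 ∧ 0 < M 1 1 ∧ 0 < -((ε : ℤ) : ℝ) * M 0 1 ∧ 0 < ((ε : ℤ) : ℝ) * M 1 0 ∧
    |M 0 1| < M 0 0 ∧ |M 1 0| < M 1 1 ∧ M 1 1 < M 0 0 + |M 0 1| ∧ M 0 0 < M 1 1 + |M 1 0| ∧
    η * M 1 1 < ((ε : ℤ) : ℝ) * M 1 0}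

lemma continuous_entry (i j : Fin 2) : Continuous fun M : SL(2, ℝ) => M i j :=
  (continuous_apply j).comp ((continuous_apply i).comp isClosedEmbedding_entries.continuous)

lemma isOpen_boxFrames (ε : ℤˣ) (η : ℝ) : IsOpen (boxFrames ε η) := by
  have h1 := continuous_entry 0 0
  have h2 := continuous_entry 0 1
  have h3 := continuous_entry 1 0
  have h4 := continuous_entry 1 1
  refine (isOpen_lt continuous_const h1).inter ((isOpen_lt continuous_const h4).inter
    ((isOpen_lt continuous_const (h2.const_mul _)).inter
    ((isOpen_lt continuous_const (h3.const_mul _)).inter ((isOpen_lt h2.abs h1).inter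
    ((isOpen_lt h3.abs h4).inter ((isOpen_lt h4 (h1.add h2.abs)).inter
    ((isOpen_lt h1 (h4.add h3.abs)).inter (isOpen_lt (h4.const_mul _) (h3.const_mul _)))))))))

lemma frame_zero_mem_boxFrames {ε : ℤˣ} {η : ℝ} {p : ℝ × ℝ} (hp : p ∈ unitSquare) (hη : η < p.2) :
    frame 0 p ε ∈ boxFrames ε η := by
  obtain ⟨ha, hd, hb, hc, hab, hcd⟩ := frame_pos 0 hp ε
  have hz := frame_zero_diag hp ε
  obtain ⟨-, -, e3, e4⟩ := frame_entries 0 hp ε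
  have hb' : 0 < |frame 0 p ε 0 1| := abs_pos.2 fun h => by simp [h] at hb
  have hc' : 0 < |frame 0 p ε 1 0| := abs_pos.2 fun h => by simp [h] at hc
  refine ⟨ha, hd, hb, hc, hab, hcd, by linarith, by linarith, ?_⟩
  rw [e3, ← e4, ← mul_assoc, ← mul_assoc, sign_mul_self, one_mul]
  exact mul_lt_mul_of_pos_right hη hd

lemma exists_param_of_mem_boxFrames {ε : ℤˣ} {η : ℝ} {M : SL(2, ℝ)} (hM : M ∈ boxFrames ε η)
    (hS : toLattice M ∈ transversal) :
    ∃ p ∈ unitSquare, η < p.2 ∧ toLattice M = param p ε := by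
  obtain ⟨ha, hd, hb, hc, hab, hcd, h1, h2, hη⟩ := hM
  have hbc : M 0 1 * M 1 0 < 0 := by
    have := mul_pos hb hc
    have he := sign_mul_self ε
    nlinarith
  have heq := (mem_transversal_iff ha hd hbc hab hcd h1 h2).1 hS
  obtain ⟨hp, hM⟩ := eq_frame ha hd hb hc hab hcd
  refine ⟨_, hp, ?_, ?_⟩
  · simp only
    rwa [lt_div_iff₀ hd]
  · have h0 : 1 / 2 * Real.log (M 0 0 / M 1 1) = 0 := by
      rw [heq, div_self hd.ne', Real.log_one, mul_zero]
    rw [← toLattice_frame_zero, ← h0, ← hM]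

/-- For such short times the box embeds in the space of lattices, and its measure is read in the
coordinates as that of a product. -/
lemma latticeMeasure_flowBox {η : ℝ} (hη : 0 < η) (ε : ℤˣ) {N : Set (ℝ × ℝ)} (hN : MeasurableSet N)
    (hNs : N ⊆ unitSquare) (hNη : ∀ p ∈ N, η < p.2) {e : ℝ}
    (he : e < 1 / 2 * Real.log (1 + η)) :
    latticeMeasure (⋃ t ∈ Icc (0 : ℝ) e, (fun Λ => flow t • Λ) '' ((fun p => param p ε) '' N))
      = ENNReal.ofReal e * squareMeasure N := by
  have hK : MeasurableSet (Icc 0 e ×ˢ N) := measurableSet_Icc.prod hN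
  have hunion : ⋃ t ∈ Icc (0 : ℝ) e, (fun Λ => flow t • Λ) '' ((fun p => param p ε) '' N)
      = toLattice '' (cell ε ∩ cellCoord ε ⁻¹' (Icc 0 e ×ˢ N)) := by
    ext Λ
    simp only [mem_iUnion, exists_prop]
    constructor
    · rintro ⟨t, ht, -, ⟨p, hp, rfl⟩, rfl⟩
      exact ⟨frame t p ε, mem_cell_inter.2 ⟨t, p, hNs hp, ⟨ht, hp⟩, rfl⟩, rfl⟩
    · rintro ⟨M, hM, rfl⟩
      obtain ⟨t, p, -, ⟨ht, hp⟩, rfl⟩ := mem_cell_inter.1 hM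
      exact ⟨t, ht, _, ⟨p, hp, rfl⟩, rfl⟩
  have hinj : InjOn toLattice (cell ε ∩ cellCoord ε ⁻¹' (Icc 0 e ×ˢ N)) := by
    intro M hM M' hM' h
    obtain ⟨t, p, -, ⟨ht, hp⟩, rfl⟩ := mem_cell_inter.1 hM
    obtain ⟨t', p', -, ⟨ht', hp'⟩, rfl⟩ := mem_cell_inter.1 hM'
    obtain ⟨rfl, rfl, -⟩ := frame_inj_of_notMem (T := fun _ => 1 / 2 * Real.log (1 + η)) hNs
      (fun p hp ε s h0 hs => notMem_transversal_of_height hη (hNs hp) (hNη p hp) ε h0 hs)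
      hp hp' ⟨ht.1, ht.2.trans_lt he⟩ ⟨ht'.1, ht'.2.trans_lt he⟩ h
    rfl
  rw [hunion, isSection_returnDomain.latticeMeasure_image
    ((measurableSet_cell ε).inter (measurable_cellCoord ε hK)) hinj, haarSL_cell ε hK,
    Measure.prod_prod, Real.volume_Icc, sub_zero]

lemma transversalMeasure_image_param (ε : ℤˣ) {N : Set (ℝ × ℝ)} (hN : MeasurableSet N)
    (hNs : N ⊆ unitSquare) : transversalMeasure ((fun p => param p ε) '' N) = squareMeasure N := by
  rw [transversalMeasure_apply (measurableSet_image_param ε hN hNs), Finset.sum_eq_single ε]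
  · refine measure_congr ?_
    filter_upwards [squareMeasure_ae_mem] with p hp
    refine propext ⟨?_, fun h => ⟨p, h, rfl⟩⟩
    rintro ⟨p', hp', h⟩
    rwa [(param_injective (hNs hp') hp h).1] at hp'
  · intro ε' _ hne
    refine measure_eq_zero_iff_ae_notMem.2 (squareMeasure_ae_mem.mono fun p hpu hp => ?_)
    obtain ⟨p', hp', h⟩ := hp
    exact hne (param_injective (hNs hp') hpu h).2.symm
  · exact fun h => absurd (Finset.mem_univ ε) h

lemma isInducedMeasure_transversalMeasure : IsInducedMeasure transversalMeasure where
  carried := transversalMeasure_compl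
  flow_box := by
    intro Λ hΛ
    obtain ⟨p, hp, ε, rfl⟩ := mem_transversal_iff_exists_param.1 hΛ
    have hη : 0 < p.2 / 2 := half_pos hp.2.1
    have hlog : 0 < 1 / 2 * Real.log (1 + p.2 / 2) :=
      mul_pos (by norm_num) (Real.log_pos (by linarith))
    -- Half the height of the point bounds the heights of its neighbours from below. The time is
    -- halved to stay strictly below the bound on the return times.
    refine ⟨transversal ∩ toLattice '' boxFrames ε (p.2 / 2), ?_,
      1 / 2 * Real.log (1 + p.2 / 2) / 2, half_pos hlog, ?_⟩
    · refine inter_mem self_mem_nhdsWithin (mem_nhdsWithin_of_mem_nhds (IsOpen.mem_nhds ?_ ?_))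
      · exact QuotientGroup.isOpenMap_coe _ (isOpen_boxFrames ε _)
      · exact ⟨_, frame_zero_mem_boxFrames hp (half_lt_self hp.2.1), toLattice_frame_zero p ε⟩
    · intro V hV hVW hVS e he
      have hNm : MeasurableSet ({q | q ∈ unitSquare ∧ p.2 / 2 < q.2} ∩ (fun q => param q ε) ⁻¹' V) :=
        (measurableSet_unitSquare.inter (measurableSet_lt measurable_const measurable_snd)).inter
          (measurable_param ε hV)
      have hVeq : V = (fun q => param q ε) ''
          ({q | q ∈ unitSquare ∧ p.2 / 2 < q.2} ∩ (fun q => param q ε) ⁻¹' V) := by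
        refine Subset.antisymm (fun Λ' h => ?_) (by rintro _ ⟨q, hq, rfl⟩; exact hq.2)
        obtain ⟨hS, M, hM, rfl⟩ := hVW h
        obtain ⟨q, hq, hq2, hMq⟩ := exists_param_of_mem_boxFrames hM hS
        exact ⟨q, ⟨⟨hq, hq2⟩, by rw [mem_preimage, ← hMq]; exact h⟩, hMq.symm⟩
      rw [hVeq, transversalMeasure_image_param ε hNm fun q hq => hq.1.1]
      exact latticeMeasure_flowBox hη ε hNm (fun q hq => hq.1.1) (fun q hq => hq.1.2)
        (he.2.trans_lt (half_lt_self hlog))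

lemma measurableSet_of_isOpen_lattice {U : Set LatticeSpace} (hU : IsOpen U) : MeasurableSet U := by
  have h : MeasurableSet (toLattice ⁻¹' U) :=
    (hU.preimage QuotientGroup.continuous_mk).measurableSet
  exact h

instance : SecondCountableTopology SL(2, ℝ) :=
  isClosedEmbedding_entries.isEmbedding.secondCountableTopology

/-- Near each point both measures satisfy the flow box formula with a common positive time, so they
agree there. Countably many such neighbourhoods cover the transversal, which carries both measures.
-/
lemma IsInducedMeasure.unique {σ σ' : Measure LatticeSpace} (hσ : IsInducedMeasure σ)
    (hσ' : IsInducedMeasure σ') : σ = σ' := by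
  have key : ∀ Λ ∈ transversal, ∃ U : Set LatticeSpace, IsOpen U ∧ Λ ∈ U ∧
      σ.restrict (U ∩ transversal) = σ'.restrict (U ∩ transversal) := by
    intro Λ hΛ
    obtain ⟨W, hW, e, he, h⟩ := hσ.flow_box Λ hΛ
    obtain ⟨W', hW', e', he', h'⟩ := hσ'.flow_box Λ hΛ
    obtain ⟨U, hU, hΛU, hUW⟩ := mem_nhdsWithin.1 (inter_mem hW hW')
    refine ⟨U, hU, hΛU, ?_⟩
    ext A hA
    have hm : MeasurableSet (U ∩ transversal) :=
      (measurableSet_of_isOpen_lattice hU).inter measurableSet_transversal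
    rw [Measure.restrict_apply hA, Measure.restrict_apply hA]
    have hpos : 0 < min e e' := lt_min he he'
    have h1 := h _ (hA.inter hm) (fun z hz => (hUW hz.2).1) (fun z hz => hz.2.2) (min e e')
      ⟨hpos.le, min_le_left _ _⟩
    have h2 := h' _ (hA.inter hm) (fun z hz => (hUW hz.2).2) (fun z hz => hz.2.2) (min e e')
      ⟨hpos.le, min_le_right _ _⟩
    rw [h1] at h2
    exact (ENNReal.mul_right_inj (ENNReal.ofReal_pos.2 hpos).ne' ENNReal.ofReal_ne_top).1 h2
  choose! U hU hmem heq using key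
  obtain ⟨s, hs, hsc, hcov⟩ := TopologicalSpace.countable_cover_nhdsWithin
    (f := fun Λ => U Λ ∩ transversal) (s := transversal)
    fun Λ hΛ => inter_mem (mem_nhdsWithin_of_mem_nhds ((hU Λ hΛ).mem_nhds (hmem Λ hΛ)))
      self_mem_nhdsWithin
  have hunion : ⋃ Λ ∈ s, U Λ ∩ transversal = transversal :=
    Subset.antisymm (iUnion₂_subset fun _ _ => inter_subset_right) hcov
  have hr : σ.restrict transversal = σ'.restrict transversal := by
    rw [← hunion]
    exact (Measure.restrict_biUnion_congr hsc).2 fun Λ hΛ => heq Λ (hs hΛ)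
  have e : ∀ {ν : Measure LatticeSpace}, IsInducedMeasure ν → ν.restrict transversal = ν :=
    fun hν => Measure.restrict_eq_self_of_ae_mem (mem_ae_iff.2 hν.carried)
  rwa [e hσ, e hσ'] at hr

/-! ### The return map as a two-fold extension -/

open Classical in
/-- The parameter in the unit square of a lattice of the transversal. -/
def paramCoord (Λ : LatticeSpace) : ℝ × ℝ :=
  if h : ∃ p ∈ unitSquare, ∃ ε : ℤˣ, Λ = param p ε then h.choose else 0

lemma paramCoord_param {p : ℝ × ℝ} (hp : p ∈ unitSquare) (ε : ℤˣ) :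
    paramCoord (param p ε) = p := by
  have h : ∃ p' ∈ unitSquare, ∃ ε' : ℤˣ, param p ε = param p' ε' := ⟨p, hp, ε, rfl⟩
  rw [paramCoord, dif_pos h]
  obtain ⟨h1, ε', h2⟩ := h.choose_spec
  exact (param_injective hp h1 h2).1.symm

lemma paramCoord_of_notMem {Λ : LatticeSpace} (h : Λ ∉ transversal) : paramCoord Λ = 0 :=
  dif_neg fun h' => h (mem_transversal_iff_exists_param.2 h')

lemma measurable_paramCoord : Measurable paramCoord := by
  intro N hN
  have h : paramCoord ⁻¹' N = (⋃ ε : ℤˣ, (fun p => param p ε) '' (N ∩ unitSquare)) ∪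
      (transversalᶜ ∩ {_Λ | (0 : ℝ × ℝ) ∈ N}) := by
    ext Λ
    by_cases hΛ : Λ ∈ transversal
    · obtain ⟨p, hp, ε, rfl⟩ := mem_transversal_iff_exists_param.1 hΛ
      rw [mem_preimage, paramCoord_param hp]
      constructor
      · exact fun hpN => Or.inl (mem_iUnion.2 ⟨ε, p, ⟨hpN, hp⟩, rfl⟩)
      · rintro (h | h)
        · obtain ⟨ε', p', hp', h⟩ := mem_iUnion.1 h
          rw [(param_injective hp hp'.2 h.symm).1]
          exact hp'.1
        · exact absurd hΛ h.1
    · rw [mem_preimage, paramCoord_of_notMem hΛ]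
      constructor
      · exact fun h => Or.inr ⟨hΛ, h⟩
      · rintro (h | h)
        · obtain ⟨ε', p', hp', rfl⟩ := mem_iUnion.1 h
          exact absurd (param_mem_transversal hp'.2 ε') hΛ
        · exact h.2
  rw [h]
  exact (MeasurableSet.iUnion fun ε => measurableSet_image_param ε
    (hN.inter measurableSet_unitSquare) inter_subset_right).union
    (measurableSet_transversal.compl.inter (MeasurableSet.const _))

open Classical in
/-- The return map in the coordinates, on the whole space of lattices. -/
def coordReturnMap (Λ : LatticeSpace) : LatticeSpace :=
  if Λ ∈ (fun p => param p 1) '' unitSquare then param (gaussExt (paramCoord Λ)) (-1)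
  else param (gaussExt (paramCoord Λ)) 1

lemma coordReturnMap_param {p : ℝ × ℝ} (hp : p ∈ unitSquare) (ε : ℤˣ) :
    coordReturnMap (param p ε) = param (gaussExt p) (-ε) := by
  rw [coordReturnMap, paramCoord_param hp]
  rcases Int.units_eq_one_or ε with rfl | rfl
  · rw [if_pos ⟨p, hp, rfl⟩]
  · rw [if_neg, neg_neg]
    rintro ⟨p', hp', h⟩
    exact absurd (param_injective hp' hp h).2 (by decide)

lemma measurable_coordReturnMap : Measurable coordReturnMap := by
  have h : ∀ ε : ℤˣ, Measurable fun Λ => param (gaussExt (paramCoord Λ)) ε := fun ε =>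
    (measurable_param ε).comp (measurable_gaussExt.comp measurable_paramCoord)
  exact Measurable.ite (measurableSet_image_param 1 measurableSet_unitSquare subset_rfl) (h _) (h _)

/-- The return time is an infimum with no evident measurability; the formula in coordinates supplies
a measurable version of the return map. -/
lemma returnMap_ae_eq : returnMap =ᵐ[transversalMeasure] coordReturnMap :=
  transversalMeasure_ae (Q := fun Λ => returnMap Λ = coordReturnMap Λ) fun p hp ε => by
    rw [returnMap_param hp.1 ε hp.2, coordReturnMap_param hp.1]

/-- The return map exchanges the two sheets and acts by the planar map on the square. After
relabelling the sheets, each term of the sum is invariant. -/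
lemma map_returnMap : transversalMeasure.map returnMap = transversalMeasure := by
  rw [Measure.map_congr returnMap_ae_eq]
  ext A hA
  rw [Measure.map_apply measurable_coordReturnMap hA,
    transversalMeasure_apply (measurable_coordReturnMap hA), transversalMeasure_apply hA,
    ← Equiv.sum_comp (Equiv.neg ℤˣ)]
  refine Finset.sum_congr rfl fun ε _ => ?_
  rw [← measurePreserving_gaussExt_square.measure_preimage
    (measurable_param ε hA).nullMeasurableSet]
  refine measure_congr ?_
  filter_upwards [squareMeasure_ae_mem] with p hp
  refine propext ?_
  change coordReturnMap (param p (-ε)) ∈ A ↔ param (gaussExt p) ε ∈ A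
  rw [coordReturnMap_param hp, neg_neg]

lemma map_paramCoord : transversalMeasure.map paramCoord = (2 : ENNReal) • squareMeasure := by
  ext A hA
  rw [Measure.map_apply measurable_paramCoord hA,
    transversalMeasure_apply (measurable_paramCoord hA), Measure.smul_apply, smul_eq_mul, two_mul,
    ← sum_units]
  refine Finset.sum_congr rfl fun ε _ => measure_congr ?_
  filter_upwards [squareMeasure_ae_mem] with p hp
  refine propext ?_
  change paramCoord (param p ε) ∈ A ↔ p ∈ A
  rw [paramCoord_param hp]

lemma isTwoFoldExtension_returnMap :
    IsTwoFoldExtension transversal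
      ((transversalMeasure transversal)⁻¹ • transversalMeasure) returnMap
      unitSquare gaussExtMeasure gaussExt paramCoord where
  carried := by
    rw [Measure.smul_apply, transversalMeasure_compl, smul_zero]
  carried_base := by
    rw [gaussExtMeasure_eq, Measure.smul_apply]
    have : squareMeasure unitSquareᶜ = 0 := squareMeasure_ae_mem
    rw [this, smul_zero]
  aemeasurable_map :=
    (AEMeasurable.congr measurable_coordReturnMap.aemeasurable returnMap_ae_eq.symm).smul_measure _
  map_eq := by rw [Measure.map_smul, map_returnMap]
  measurePreserving_base := measurePreserving_gaussExt
  aemeasurable_factor := measurable_paramCoord.aemeasurable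
  map_factor := by
    rw [Measure.map_smul, map_paramCoord, gaussExtMeasure_eq, smul_smul,
      transversalMeasure_transversal]
    congr 1
    have h2 : (2 : ENNReal) = ENNReal.ofReal 2 := by simp
    rw [h2, ← ENNReal.ofReal_inv_of_pos (mul_pos two_pos log_two_pos),
      ← ENNReal.ofReal_mul (inv_nonneg.2 (mul_pos two_pos log_two_pos).le)]
    congr 1
    have := log_two_pos.ne'
    field_simp
  mapsTo := by
    intro Λ hΛ
    obtain ⟨p, hp, ε, rfl⟩ := mem_transversal_iff_exists_param.1 hΛ
    rwa [paramCoord_param hp]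
  semiconj := by
    refine Measure.ae_smul_measure (transversalMeasure_ae
      (Q := fun Λ => (paramCoord ∘ returnMap) Λ = (gaussExt ∘ paramCoord) Λ) fun p hp ε => ?_) _
    simp only [Function.comp_apply]
    rw [returnMap_param hp.1 ε hp.2, paramCoord_param (gaussExt_mem hp.1 hp.2),
      paramCoord_param hp.1]
  two_preimages := by
    intro p hp
    have h : transversal ∩ paramCoord ⁻¹' {p} = {param p 1, param p (-1)} := by
      ext Λ
      constructor
      · rintro ⟨hΛ, h⟩
        obtain ⟨p', hp', ε, rfl⟩ := mem_transversal_iff_exists_param.1 hΛ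
        rw [mem_preimage, paramCoord_param hp'] at h
        obtain rfl : p' = p := h
        rcases Int.units_eq_one_or ε with rfl | rfl
        · exact Or.inl rfl
        · exact Or.inr rfl
      · rintro (rfl | rfl)
        · exact ⟨param_mem_transversal hp _, paramCoord_param hp _⟩
        · exact ⟨param_mem_transversal hp _, paramCoord_param hp _⟩
    rw [h, ncard_pair]
    intro h
    exact absurd (param_injective hp hp h).2 (by decide)

end

end PlaneLattices

theorem mainTheorem8 :
    -- `(x, y, ε) ↦ param (x, y) ε` is a bijection from `(0,1)² × {±1}` onto the transversal
    Set.BijOn (fun z : (ℝ × ℝ) × ℤˣ => param z.1 z.2) (unitSquare ×ˢ Set.univ) transversal ∧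
    -- `latticeMeasure` is invariant, of total mass `ζ(2)`
    SMulInvariantMeasure SL(2, ℝ) LatticeSpace latticeMeasure ∧
    latticeMeasure Set.univ = ENNReal.ofReal (riemannZeta 2).re ∧
    -- the flow induces a unique measure on the transversal
    (∃! σ : Measure LatticeSpace, IsInducedMeasure σ) ∧
    (∀ σ : Measure LatticeSpace, IsInducedMeasure σ →
      -- its density in the coordinates, and its mass
      σ = ∑ ε : ℤˣ, Measure.map (fun p : ℝ × ℝ => param p ε)
        (((volume : Measure (ℝ × ℝ)).restrict unitSquare).withDensity
          fun p => ENNReal.ofReal (1 / (1 + p.1 * p.2) ^ 2)) ∧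
      σ transversal = ENNReal.ofReal (2 * Real.log 2) ∧
      -- Lévy's constant
      IsLevyConstant ((latticeMeasure Set.univ).toReal / (σ transversal).toReal) ∧
      (((latticeMeasure Set.univ).toReal / (σ transversal).toReal : ℝ) : ℂ)
        = riemannZeta 2 / (2 * Real.log 2 : ℝ) ∧
      (latticeMeasure Set.univ).toReal / (σ transversal).toReal
        = Real.pi ^ 2 / (12 * Real.log 2) ∧
      -- the return map is a two-fold extension of the planar map `gaussExt`
      ∃ P : LatticeSpace → ℝ × ℝ,
        (∀ p ∈ unitSquare, ∀ ε : ℤˣ, P (param p ε) = p) ∧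
        IsTwoFoldExtension transversal ((σ transversal)⁻¹ • σ) returnMap
          unitSquare gaussExtMeasure gaussExt P) ∧
    -- the return time and the return map in the coordinates
    (∀ x ∈ Set.Ioo (0 : ℝ) 1, ∀ y ∈ Set.Ioo (0 : ℝ) 1, ∀ ε : ℤˣ, Int.fract (1 / x) ≠ 0 →
      IsLeast (visitTimes (param (x, y) ε)) (1 / 2 * Real.log ((y + ⌊1 / x⌋) / x)) ∧
      returnMap (param (x, y) ε) = param (Int.fract (1 / x), 1 / (y + ⌊1 / x⌋)) (-ε)) ∧
    -- `gaussExt` is the natural extension of the Gauss map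
    IsNaturalExtension gaussExt gaussExtMeasure gaussMap gaussMeasure Prod.fst := by
  have hzeta : (riemannZeta 2).re = Real.pi ^ 2 / 6 := by
    rw [riemannZeta_two]
    have : ((Real.pi : ℂ) ^ 2 / 6) = ((Real.pi ^ 2 / 6 : ℝ) : ℂ) := by push_cast; rfl
    rw [this, Complex.ofReal_re]
  have hratio : (latticeMeasure Set.univ).toReal / (transversalMeasure transversal).toReal
      = Real.pi ^ 2 / (12 * Real.log 2) := by
    rw [latticeMeasure_univ, transversalMeasure_transversal, ENNReal.toReal_ofReal (by positivity),
      ENNReal.toReal_ofReal (by positivity), div_div]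
    congr 1
    ring
  refine ⟨bijOn_param, smulInvariant_latticeMeasure isSection_returnDomain, ?_,
    ⟨transversalMeasure, isInducedMeasure_transversalMeasure,
      fun σ hσ => hσ.unique isInducedMeasure_transversalMeasure⟩, fun σ hσ => ?_,
    fun x hx y hy ε h => ⟨isLeast_visitTimes (p := (x, y)) ⟨hx, hy⟩ ε h,
      returnMap_param (p := (x, y)) ⟨hx, hy⟩ ε h⟩, isNaturalExtension_gaussExt⟩
  · rw [latticeMeasure_univ, hzeta]
  · obtain rfl := hσ.unique isInducedMeasure_transversalMeasure
    refine ⟨rfl, transversalMeasure_transversal, ?_, ?_, hratio, paramCoord,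
      fun p hp ε => paramCoord_param hp ε, isTwoFoldExtension_returnMap⟩
    · rw [hratio]
      exact isLevyConstant
    · rw [hratio, riemannZeta_two]
      push_cast
      field_simp
      norm_num
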